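/- Let $d,k\ge 1$ be integers and $H=-\Delta+|x|^2$ on $\mathbb R^d$. Fix a window $0\ne g\in\mathcal S(\mathbb R^d)$. For a tempered distribution $f$ let $V_gf(x,y)=(2\pi)^{-d/2}\int_{\mathbb R^d} f(t)\,\overline{g(t-x)}\,e^{-iy\cdot t}\,dt$ (understood as a duality pairing), and for $1\le p,q\le\infty$ let $M^{p,q}(\mathbb R^d)$ be the space of all $f\in\mathcal S'(\mathbb R^d)$ for which $$\|f\|_{M^{p,q}}=\Big\|\,\|V_gf(x,y)\|_{L^p_x}\Big\|_{L^q_y}$$ is finite. Let $\mathcal FL^q(\mathbb R^d)$ be the space of all $f\in\mathcal S'(\mathbb R^d)$ with $\widehat f\in L^q(\mathbb R^d)$. Consider, for $K\in\mathcal S'(\mathbb R^d)$, the Cauchy problem $$i\partial_t u-Hu=F(u),\qquad F(u)=(K*|u|^{2k})\,u,\qquad u(0)=u_0 .\tag{1}$$ Here $K*h$, for $h\in L^1(\mathbb R^d)$, is the function whose Fourier transform is a constant multiple (fixed by the normalization of the Fourier transform, as in the convolution theorem) of $\widehat K\,\widehat h$, where $\widehat K$ is a function and $\widehat K\,\widehat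 h\in L^1(\mathbb R^d)$. A solution of (1) in $C([0,T),M^{p,p}(\mathbb R^d))$ is a $u\in C([0,T),M^{p,p}(\mathbb R^d))$ with $u(0)=u_0$ such that for every $t\in[0,T)$ the nonlinearity $F(u(t))$ is defined and the equation holds in $\mathcal S'(\mathbb R^d)$, that is, for every $\varphi\in\mathcal S(\mathbb R^d)$ the function $t\mapsto\langle u(t),\varphi\rangle$ is differentiable on $[0,T)$ with $i\frac{d}{dt}\langle u(t),\varphi\rangle=\langle Hu(t)+F(u(t)),\varphi\rangle$. (1) Let $K\in\mathcal FL^q(\mathbb R^d)$ with $1<q<\infty$. Then there is a function $T^*:[0,\infty)\to(0,\infty)$ such that for every $u_0\in M^{1,1}(\mathbb R^d)$, with $T^*=T^*(\|u_0\|_{M^{1,1}})$, problem (1) has a unique solution $u\in C([0,T^*),M^{1,1}(\mathbb R^d))$. (2) Let $k=1$ and $K\in\mathcal FL^q(\mathbb R^d)$ with $1<q<2$, let $q<r<\infty$, and put $s=\frac{2r}{2r-1}$. Then there is a function $T^*:[0,\infty)\to(0,\infty)$ such that for every $u_0\in M^{s,s}(\mathbb R^d)$, with $T^*=T^*(\|u_0\|_{M^{s,s}})$,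 problem (1) has a unique solution $u\in C([0,T^*),M^{s,s}(\mathbb R^d))$. (3) Let $K\in M^{1,\infty}(\mathbb R^d)$. Then there is a function $T^*:[0,\infty)\to(0,\infty)$ such that for every $u_0\in M^{1,1}(\mathbb R^d)$, with $T^*=T^*(\|u_0\|_{M^{1,1}})$, problem (1) has a unique solution $u\in C([0,T^*),M^{1,1}(\mathbb R^d))$. -/

import Mathlib

open MeasureTheory Set Filter Topology
open scoped SchwartzMap FourierTransform Laplacian ENNReal

noncomputable section

namespace HarmonicNLS

/-- `ℝ^d` with its Euclidean norm. -/
abbrev Rd (d : ℕ) : Type := EuclideanSpace ℝ (Fin d)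

variable {d : ℕ}

/-- The character `t ↦ e^{- i y·t}`. -/
def phase (y : Rd d) (t : Rd d) : ℂ := Complex.exp (-(Complex.I * ((inner ℝ y t : ℝ) : ℂ)))

theorem phase_hasTemperateGrowth (y : Rd d) : (phase y).HasTemperateGrowth := by
  have hexp : (fun s : ℝ => Complex.exp (-(Complex.I * (s : ℂ)))).HasTemperateGrowth := by
    have hder : ∀ s : ℝ, HasDerivAt (fun s : ℝ => Complex.exp (-(Complex.I * (s : ℂ))))
        (-Complex.I * Complex.exp (-(Complex.I * (s : ℂ)))) s := by
      intro s
      have h1 : HasDerivAt (fun s : ℝ => -(Complex.I * (s : ℂ))) (-Complex.I) s := by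
        simpa using ((HasDerivAt.ofReal_comp (hasDerivAt_id s)).const_mul Complex.I).fun_neg
      have h2 := h1.cexp
      rwa [mul_comm] at h2
    have hit : ∀ n : ℕ, iteratedDeriv n (fun s : ℝ => Complex.exp (-(Complex.I * (s : ℂ)))) =
        fun s : ℝ => (-Complex.I) ^ n * Complex.exp (-(Complex.I * (s : ℂ))) := by
      intro n
      induction n with
      | zero => simp
      | succ n ih =>
        rw [iteratedDeriv_succ, ih]
        funext s
        rw [((hder s).const_mul _).deriv]
        ring
    refine ⟨Complex.contDiff_exp.comp
      ((contDiff_const.mul Complex.ofRealCLM.contDiff).neg), fun n => ⟨0, 1, fun s => ?_⟩⟩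
    rw [norm_iteratedFDeriv_eq_norm_iteratedDeriv, hit]
    simp [Complex.norm_exp]
  exact hexp.comp (Function.hasTemperateGrowth_inner_right y)

/-- The Schwartz function `t ↦ e^{- i y·t} conj (g (t - x))`, the complex conjugate of the
time-frequency shift `M_y T_x g`. -/
def stftAtom (g : 𝓢(Rd d, ℂ)) (x y : Rd d) : 𝓢(Rd d, ℂ) :=
  SchwartzMap.smulLeftCLM ℂ (phase y)
    (SchwartzMap.postcompCLM (Complex.conjCLE : ℂ →L[ℝ] ℂ) (SchwartzMap.compSubConstCLM ℂ x g))

theorem stftAtom_apply (g : 𝓢(Rd d, ℂ)) (x y t : Rd d) :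
    stftAtom g x y t = phase y t * (starRingEnd ℂ) (g (t - x)) := by
  simp [stftAtom, SchwartzMap.smulLeftCLM_apply_apply (phase_hasTemperateGrowth y)]

/-- The short-time Fourier transform
`V_g f (x, y) = (2π)^{-d/2} ∫ f(t) conj (g (t - x)) e^{- i y·t} dt` of a tempered distribution. -/
def stft (g : 𝓢(Rd d, ℂ)) (f : 𝓢'(Rd d, ℂ)) (x y : Rd d) : ℂ :=
  (((2 * Real.pi) ^ (-(d : ℝ) / 2) : ℝ) : ℂ) * f (stftAtom g x y)

/-- The modulation space norm of a tempered distribution, with window `g`: the `L^p` norm of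
`V_g f (x, y)` in `x`, followed by the `L^q` norm in `y`; it is `∞` off the modulation space. -/
def modNorm (g : 𝓢(Rd d, ℂ)) (p q : ℝ≥0∞) (f : 𝓢'(Rd d, ℂ)) : ℝ≥0∞ :=
  eLpNorm (fun y : Rd d => eLpNorm (fun x : Rd d => stft g f x y) p volume) q volume

/-- `f ∈ M^{p,q}(ℝ^d)`. -/
def MemModulation (g : 𝓢(Rd d, ℂ)) (p q : ℝ≥0∞) (f : 𝓢'(Rd d, ℂ)) : Prop :=
  modNorm g p q f < ∞

/-- The tempered distribution `w` is the function `f`. -/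
def IsRepresentedBy (w : 𝓢'(Rd d, ℂ)) (f : Rd d → ℂ) : Prop :=
  ∀ φ : 𝓢(Rd d, ℂ), Integrable (fun x => φ x * f x) volume ∧ w φ = ∫ x, φ x * f x

/-- `K ∈ 𝓕L^q(ℝ^d)`: the Fourier transform of the tempered distribution `K` is a function in `L^q`.
(Here `𝓕` has the kernel `e^{-2πi x·ξ}`; a change of the normalization of the Fourier transform
rescales `𝓕 K` and its argument by constants, which does not affect membership.) -/
def MemFourierLebesgue (q : ℝ≥0∞) (K : 𝓢'(Rd d, ℂ)) : Prop :=
  ∃ κ : Rd d → ℂ, MemLp κ q volume ∧ IsRepresentedBy (𝓕 K) κ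

/-- `V = K * h`, for a tempered distribution `K` whose Fourier transform is a function `κ` and for
an integrable function `h`: the convolution is the function whose Fourier transform is the product
`𝓕 K · 𝓕 h`, which is required to be integrable. With the kernel `e^{-2πi x·ξ}` there is no
constant in front of the product. -/
def IsConvolution (K : 𝓢'(Rd d, ℂ)) (h V : Rd d → ℂ) : Prop :=
  Integrable h volume ∧ ∃ κ : Rd d → ℂ, IsRepresentedBy (𝓕 K) κ ∧
    Integrable (fun ξ => κ ξ * 𝓕 h ξ) volume ∧ V = 𝓕⁻ (fun ξ => κ ξ * 𝓕 h ξ)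

/-- `N = F(w)` for the Hartree type nonlinearity `F(w) = (K * |w|^{2k}) w`, where `w` and `N` are
tempered distributions that are given by functions. -/
def IsHartree (K : 𝓢'(Rd d, ℂ)) (k : ℕ) (w N : 𝓢'(Rd d, ℂ)) : Prop :=
  ∃ f V : Rd d → ℂ, IsRepresentedBy w f ∧
    IsConvolution K (fun x => ((‖f x‖ ^ (2 * k) : ℝ) : ℂ)) V ∧
    IsRepresentedBy N (fun x => V x * f x)

/-- The harmonic oscillator `H = -Δ + |x|²` on tempered distributions. -/
def oscillator (w : 𝓢'(Rd d, ℂ)) : 𝓢'(Rd d, ℂ) :=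
  -(Δ w) + TemperedDistribution.smulLeftCLM ℂ (fun x : Rd d => ((‖x‖ ^ 2 : ℝ) : ℂ)) w

theorem oscillator_apply (w : 𝓢'(Rd d, ℂ)) (φ : 𝓢(Rd d, ℂ)) :
    oscillator w φ = w (-(Δ φ) +
      SchwartzMap.smulLeftCLM ℂ (fun x : Rd d => ((‖x‖ ^ 2 : ℝ) : ℂ)) φ) := by
  rw [map_add, map_neg, ← TemperedDistribution.laplacian_apply_apply,
    ← TemperedDistribution.smulLeftCLM_apply_apply]
  rfl

theorem normSq_smul_apply (φ : 𝓢(Rd d, ℂ)) (x : Rd d) :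
    SchwartzMap.smulLeftCLM ℂ (fun x : Rd d => ((‖x‖ ^ 2 : ℝ) : ℂ)) φ x =
      ((‖x‖ ^ 2 : ℝ) : ℂ) * φ x := by
  rw [SchwartzMap.smulLeftCLM_apply_apply (by fun_prop), smul_eq_mul]

/-- `u ∈ C([0, T), M^{p,p}(ℝ^d))`. The values of `u` outside `[0, T)` play no role. -/
def IsContinuousCurve (g : 𝓢(Rd d, ℂ)) (p : ℝ≥0∞) (T : ℝ) (u : ℝ → 𝓢'(Rd d, ℂ)) : Prop :=
  ∀ t ∈ Ico 0 T, MemModulation g p p (u t) ∧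
    Tendsto (fun s => modNorm g p p (u s - u t)) (𝓝[Ico 0 T] t) (𝓝 0)

/-- `u ∈ C([0, T), M^{p,p}(ℝ^d))` solves `i ∂_t u - H u = (K * |u|^{2k}) u`, `u(0) = u₀`, on
`[0, T)`. The equation `∂_t u = -i (H u + F(u))` is understood in the sense of tempered
distributions: it holds, at every time, after pairing with any Schwartz function. -/
structure IsSolution (g : 𝓢(Rd d, ℂ)) (p : ℝ≥0∞) (K : 𝓢'(Rd d, ℂ)) (k : ℕ) (u₀ : 𝓢'(Rd d, ℂ))
    (T : ℝ) (u : ℝ → 𝓢'(Rd d, ℂ)) : Prop where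
  continuous : IsContinuousCurve g p T u
  initial : u 0 = u₀
  equation : ∀ t ∈ Ico 0 T, ∃ N : 𝓢'(Rd d, ℂ), IsHartree K k (u t) N ∧
    ∀ φ : 𝓢(Rd d, ℂ), HasDerivWithinAt (fun s => u s φ)
      (-Complex.I * ((oscillator (u t)) φ + N φ)) (Ico 0 T) t

/-- For all `u₀ ∈ M^{p,p}` the Cauchy problem has exactly one solution in `C([0, T*), M^{p,p})`,
where `T* > 0` depends on `u₀` through its norm only. -/
def UniquelySolvable (g : 𝓢(Rd d, ℂ)) (p : ℝ≥0∞) (K : 𝓢'(Rd d, ℂ)) (k : ℕ) : Prop :=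
  ∃ T : ℝ → ℝ, (∀ a, 0 < T a) ∧
    ∀ u₀ : 𝓢'(Rd d, ℂ), MemModulation g p p u₀ →
      (∃ u, IsSolution g p K k u₀ (T (modNorm g p p u₀).toReal) u) ∧
      ∀ u v, IsSolution g p K k u₀ (T (modNorm g p p u₀).toReal) u →
        IsSolution g p K k u₀ (T (modNorm g p p u₀).toReal) v →
        EqOn u v (Ico 0 (T (modNorm g p p u₀).toReal))

end HarmonicNLS

end

noncomputable section

namespace HarmonicNLS

variable {d : ℕ}

/-! ### Schwartz seminorms of time-frequency shifts -/

/-! For `p ≤ 2` the space `M^{p,p}` is realized inside `L²`: it consists of the `F` whose pairing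
`gabor F` with Gaussian coherent states lies in `L^p` of phase space (`exists_coe_fn_eq`,
`exists_modNorm_le`). A different window gives an equivalent norm, because the passage between
windows is dominated by convolution with an integrable function. In this picture both sides of the
equation become geometric.

Linear part. The inner product of two coherent states is a Gaussian in the distance of their centres
times a phase given by the symplectic form (`integral_conj_coherent_mul`). Both are invariant under
the rotations `rot θ`, so composition with a rotation preserves the range of the Gabor transform and
defines a unitary group `prop` (`gabor_prop`). It carries coherent states to coherent states, up to
a unimodular factor, and a computation on these identifies its generator with the harmonic
oscillator (`hasDerivAt_prop`). Rotations preserve Lebesgue measure, so the group acts by isometries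
for every `p`, strongly continuously for `p < ∞`.

Nonlinear part. A character `e^{i η·t}` translates `gabor F` in frequency, so multiplication by `𝓕⁻
m` costs at most `‖m‖₁` (Minkowski). It remains to place `𝓕 K · 𝓕(|u|^{2k})` in `L¹`, where
`|u|^{2k} = a b̄` with `a = b = u^k`. By Parseval in phase space `|𝓕(a b̄)(ξ)|` is at most the
integral of `|gabor b (x, y)| |gabor a (x, y + 2πξ)|`. For fixed `x`, pairing with `𝓕 K ∈ L^q` is
Young's inequality in `L^s`, `2/s = 2 - 1/q`; Cauchy–Schwarz in `x` leaves the mixed norm `L²_x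
L^s_y`, which the `L^s` norm controls because the reproducing formula bounds every section. Thus any
`p ≤ s = 2q/(2q-1)` is allowed: `p = 1` in (1), and `p = 2r/(2r-1)` with `r > q` in (2). In (3) the
transform `𝓕 K` is bounded and `s = 1`. Powers `u^k` stay in `M^{1,1}` because its elements are
inverse Fourier transforms of integrable functions; in (2) only `k = 1` occurs.

The nonlinearity is therefore Lipschitz on balls, and `y(t) = U(-t) u(t)` satisfies an ordinary
differential equation in a Banach space. Picard–Lindelöf gives a solution on a time interval that
depends on the norm only. For uniqueness, a distributional solution is tested against propagated
coherent states, which are Schwartz functions; this gives the equation for `y` weakly, then strongly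
after integration, and Grönwall's inequality finishes. -/

/-- The largest of the Schwartz seminorms of index at most `m`. -/
def schwartzNorm (m : ℕ × ℕ) : Seminorm ℂ 𝓢(Rd d, ℂ) :=
  (Finset.Iic m).sup (schwartzSeminormFamily ℂ (Rd d) ℂ)

theorem weight_le_schwartzNorm (m : ℕ × ℕ) {n : ℕ} (hn : n ≤ m.2) (φ : 𝓢(Rd d, ℂ)) (x : Rd d) :
    (1 + ‖x‖) ^ m.1 * ‖iteratedFDeriv ℝ n φ x‖ ≤ 2 ^ m.1 * schwartzNorm m φ :=
  SchwartzMap.one_add_le_sup_seminorm_apply (𝕜 := ℂ) le_rfl hn φ x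

theorem weight_le_schwartzNorm_zero (N : ℕ) (φ : 𝓢(Rd d, ℂ)) (x : Rd d) :
    (1 + ‖x‖) ^ N * ‖φ x‖ ≤ 2 ^ N * schwartzNorm (N, 0) φ := by
  simpa using weight_le_schwartzNorm (N, 0) le_rfl φ x

/-- The finitely many indices that bound `q` all lie below their supremum, so one index suffices.
This turns each continuity statement into a single inequality. -/
theorem exists_le_schwartzNorm (q : Seminorm ℂ 𝓢(Rd d, ℂ)) (hq : Continuous q) :
    ∃ (m : ℕ × ℕ) (C : ℝ), 0 ≤ C ∧ ∀ φ, q φ ≤ C * schwartzNorm m φ := by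
  obtain ⟨s, C, -, h⟩ := Seminorm.bound_of_continuous (schwartz_withSeminorms ℂ (Rd d) ℂ) q hq
  refine ⟨s.sup id, C, C.2, fun φ => (h φ).trans ?_⟩
  change (C : ℝ) * _ ≤ _
  gcongr
  exact Seminorm.le_def.1 (Finset.sup_mono fun i hi =>
    Finset.mem_Iic.2 (Finset.le_sup (f := id) hi)) φ

theorem schwartzNorm_continuous (m : ℕ × ℕ) :
    Continuous (schwartzNorm m : Seminorm ℂ 𝓢(Rd d, ℂ)) := by
  have h := (schwartz_withSeminorms ℂ (Rd d) ℂ).finset_sups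
  exact h.continuous_seminorm (Finset.Iic m)

theorem exists_clm_bound (L : 𝓢(Rd d, ℂ) →L[ℂ] 𝓢(Rd d, ℂ)) (m : ℕ × ℕ) :
    ∃ (m' : ℕ × ℕ) (C : ℝ), 0 ≤ C ∧ ∀ φ, schwartzNorm m (L φ) ≤ C * schwartzNorm m' φ :=
  exists_le_schwartzNorm ((schwartzNorm m).comp L.toLinearMap)
    ((schwartzNorm_continuous m).comp L.continuous)

theorem exists_distribution_bound (f : 𝓢'(Rd d, ℂ)) :
    ∃ (m : ℕ × ℕ) (C : ℝ), 0 ≤ C ∧ ∀ φ, ‖f φ‖ ≤ C * schwartzNorm m φ :=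
  exists_le_schwartzNorm ((normSeminorm ℂ ℂ).comp (f : 𝓢(Rd d, ℂ) →ₗ[ℂ] ℂ))
    (continuous_norm.comp (map_continuous f))


/-- The translation `φ ↦ φ (· - x)` of Schwartz functions. -/
abbrev translate (x : Rd d) (φ : 𝓢(Rd d, ℂ)) : 𝓢(Rd d, ℂ) := SchwartzMap.compSubConstCLM ℂ x φ

/-- The modulation `φ ↦ e^{-i y·} φ` of Schwartz functions. -/
abbrev modulate (y : Rd d) (φ : 𝓢(Rd d, ℂ)) : 𝓢(Rd d, ℂ) := SchwartzMap.smulLeftCLM ℂ (phase y) φ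

theorem modulate_apply (y : Rd d) (φ : 𝓢(Rd d, ℂ)) (t : Rd d) :
    modulate y φ t = phase y t * φ t := by
  simp [modulate, SchwartzMap.smulLeftCLM_apply_apply (phase_hasTemperateGrowth y)]

theorem iteratedFDeriv_translate (x : Rd d) (φ : 𝓢(Rd d, ℂ)) (n : ℕ) (t : Rd d) :
    iteratedFDeriv ℝ n (translate x φ) t = iteratedFDeriv ℝ n φ (t - x) := by
  rw [← iteratedFDeriv_comp_sub]
  congr 1

theorem norm_pow_le_of_translate (k : ℕ) (x t : Rd d) :
    ‖t‖ ^ k ≤ (1 + ‖x‖) ^ k * (1 + ‖t - x‖) ^ k := by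
  rw [← mul_pow]
  gcongr
  have : ‖t‖ ≤ ‖t - x‖ + ‖x‖ := by simpa using norm_add_le (t - x) x
  nlinarith [norm_nonneg x, norm_nonneg (t - x)]

theorem schwartzNorm_translate_le (m : ℕ × ℕ) (x : Rd d) (φ : 𝓢(Rd d, ℂ)) :
    schwartzNorm m (translate x φ) ≤ 2 ^ m.1 * (1 + ‖x‖) ^ m.1 * schwartzNorm m φ := by
  have h0 : 0 ≤ schwartzNorm m φ := apply_nonneg _ _
  refine Seminorm.finset_sup_apply_le (by positivity) fun i hi => ?_
  obtain ⟨h1, h2⟩ := Prod.mk_le_mk.1 (Finset.mem_Iic.1 hi)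
  refine SchwartzMap.seminorm_le_bound ℂ i.1 i.2 _ (by positivity) fun t => ?_
  rw [iteratedFDeriv_translate]
  calc ‖t‖ ^ i.1 * ‖iteratedFDeriv ℝ i.2 φ (t - x)‖
      ≤ (1 + ‖x‖) ^ i.1 * (1 + ‖t - x‖) ^ i.1 * ‖iteratedFDeriv ℝ i.2 φ (t - x)‖ := by
        gcongr; exact norm_pow_le_of_translate _ _ _
    _ ≤ (1 + ‖x‖) ^ m.1 * (1 + ‖t - x‖) ^ m.1 * ‖iteratedFDeriv ℝ i.2 φ (t - x)‖ := by
        gcongr <;> simp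
    _ = (1 + ‖x‖) ^ m.1 * ((1 + ‖t - x‖) ^ m.1 * ‖iteratedFDeriv ℝ i.2 φ (t - x)‖) := by ring
    _ ≤ (1 + ‖x‖) ^ m.1 * (2 ^ m.1 * schwartzNorm m φ) := by
        exact mul_le_mul_of_nonneg_left (weight_le_schwartzNorm m h2 φ _) (by positivity)
    _ = _ := by ring

/-- Mean value inequality for the `n`-th derivative on the segment from `t - x'` to `t - x`. The
weight `‖t‖ ^ k` is a constant along it, and is absorbed because every point of the segment is
within `‖x'‖ + ‖x - x'‖` of `t`. -/
theorem seminorm_translate_sub_le (k n : ℕ) (x x' : Rd d) (φ : 𝓢(Rd d, ℂ)) :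
    SchwartzMap.seminorm ℂ k n (translate x φ - translate x' φ) ≤
      ‖x - x'‖ * ((1 + ‖x'‖ + ‖x - x'‖) ^ k * (2 ^ k * schwartzNorm (k, n + 1) φ)) := by
  have h0 : 0 ≤ schwartzNorm (k, n + 1) φ := apply_nonneg _ _
  refine SchwartzMap.seminorm_le_bound ℂ k n _ (by positivity) fun t => ?_
  have hfun : ⇑(translate x φ - translate x' φ) =
      (⇑(translate x φ) - ⇑(translate x' φ)) := by ext; simp
  have hsub : iteratedFDeriv ℝ n (⇑(translate x φ - translate x' φ)) t =
      iteratedFDeriv ℝ n φ (t - x) - iteratedFDeriv ℝ n φ (t - x') := by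
    rw [hfun, iteratedFDeriv_sub_apply ((translate x φ).smooth n).contDiffAt
      ((translate x' φ).smooth n).contDiffAt, iteratedFDeriv_translate, iteratedFDeriv_translate]
  rw [hsub]
  have hdiff : Differentiable ℝ (fun s => ‖t‖ ^ k • iteratedFDeriv ℝ n φ s) := by
    exact ((φ.smooth (n + 1)).differentiable_iteratedFDeriv
      (by exact_mod_cast Nat.lt_succ_self n)).const_smul (‖t‖ ^ k)
  have key := Convex.norm_image_sub_le_of_norm_fderiv_le (𝕜 := ℝ)
    (f := fun s => ‖t‖ ^ k • iteratedFDeriv ℝ n φ s) (s := segment ℝ (t - x') (t - x))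
    (C := (1 + ‖x'‖ + ‖x - x'‖) ^ k * (2 ^ k * schwartzNorm (k, n + 1) φ))
    (x := t - x') (y := t - x) (fun s _ => hdiff s) (fun s hs => ?_)
    (convex_segment _ _) (left_mem_segment _ _ _) (right_mem_segment _ _ _)
  · rw [← smul_sub, norm_smul, norm_pow, norm_norm] at key
    refine key.trans (le_of_eq ?_)
    rw [show t - x - (t - x') = -(x - x') by abel, norm_neg]; ring
  · rw [fderiv_fun_const_smul ((φ.smooth (n + 1)).differentiable_iteratedFDeriv
      (by exact_mod_cast Nat.lt_succ_self n) s), norm_smul, norm_fderiv_iteratedFDeriv, norm_pow,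
      norm_norm]
    have hts : ‖t - s‖ ≤ ‖x'‖ + ‖x - x'‖ := by
      obtain ⟨a, b, ha, hb, hab, rfl⟩ := hs
      have : t - (a • (t - x') + b • (t - x)) = x' + b • (x - x') := by
        have : t = (a + b) • t := by rw [hab, one_smul]
        have h2 : x' = (a + b) • x' := by rw [hab, one_smul]
        nth_rw 1 [this]
        nth_rw 2 [h2]
        module
      rw [this]
      refine (norm_add_le _ _).trans ?_
      rw [norm_smul, Real.norm_of_nonneg hb]
      gcongr
      exact mul_le_of_le_one_left (norm_nonneg _) (by linarith)
    calc ‖t‖ ^ k * ‖iteratedFDeriv ℝ (n + 1) φ s‖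
        ≤ ((1 + ‖t - s‖) ^ k * (1 + ‖t - (t - s)‖) ^ k) * ‖iteratedFDeriv ℝ (n + 1) φ s‖ := by
          gcongr; exact norm_pow_le_of_translate _ _ _
      _ = (1 + ‖t - s‖) ^ k * ((1 + ‖s‖) ^ k * ‖iteratedFDeriv ℝ (n + 1) φ s‖) := by
          rw [sub_sub_cancel]; ring
      _ ≤ _ := by
          have h3 : 1 + ‖t - s‖ ≤ 1 + ‖x'‖ + ‖x - x'‖ := by linarith
          refine mul_le_mul (by gcongr) (weight_le_schwartzNorm (k, n + 1) le_rfl φ s)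
            (by positivity) (by positivity)

theorem continuous_translate (φ : 𝓢(Rd d, ℂ)) : Continuous fun x : Rd d => translate x φ := by
  rw [continuous_iff_continuousAt]
  intro x'
  rw [ContinuousAt, (schwartz_withSeminorms ℂ (Rd d) ℂ).tendsto_nhds]
  rintro ⟨k, n⟩ ε hε
  have hlim : Tendsto (fun x : Rd d => ‖x - x'‖ *
      ((1 + ‖x'‖ + ‖x - x'‖) ^ k * (2 ^ k * schwartzNorm (k, n + 1) φ))) (𝓝 x') (𝓝 0) := by
    have : Continuous (fun x : Rd d => ‖x - x'‖ *
      ((1 + ‖x'‖ + ‖x - x'‖) ^ k * (2 ^ k * schwartzNorm (k, n + 1) φ))) := by fun_prop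
    simpa using this.tendsto x'
  filter_upwards [hlim.eventually_lt_const hε] with x hx
  exact (seminorm_translate_sub_le k n x x' φ).trans_lt hx

/-- Modulations inherit continuity and polynomial bounds from translations in this way. The factor
`(2π)⁻¹` compares `e^{-i y·t}` with the Fourier kernel `e^{-2πi v·t}`. -/
theorem modulate_eq_fourier (y : Rd d) (φ : 𝓢(Rd d, ℂ)) :
    modulate y φ = 𝓕 (translate ((2 * Real.pi)⁻¹ • y) (𝓕⁻ φ)) := by
  ext t
  rw [modulate_apply, SchwartzMap.fourier_coe]
  have h1 : ⇑(translate ((2 * Real.pi)⁻¹ • y) (𝓕⁻ φ)) =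
      (fun v => (𝓕⁻ φ : 𝓢(Rd d, ℂ)) (v + -((2 * Real.pi)⁻¹ • y))) := by
    ext v; simp [sub_eq_add_neg]
  have h2 : φ t = 𝓕 (⇑(𝓕⁻ φ : 𝓢(Rd d, ℂ))) t := by
    rw [← SchwartzMap.fourier_coe, FourierTransform.fourier_fourierInv_eq]
  rw [h1, h2, Real.fourier_eq', Real.fourier_eq', ← integral_const_mul,
    ← integral_sub_right_eq_self _ ((2 * Real.pi)⁻¹ • y)]
  refine integral_congr_ae (.of_forall fun v => ?_)
  simp only [smul_eq_mul, ← sub_eq_add_neg, phase]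
  rw [← mul_assoc, ← Complex.exp_add]
  congr 2
  rw [inner_sub_left, inner_smul_left]
  have : (Real.pi : ℂ) ≠ 0 := by exact_mod_cast Real.pi_ne_zero
  push_cast
  simp only [conj_trivial]
  push_cast
  field_simp
  ring

theorem continuous_modulate (φ : 𝓢(Rd d, ℂ)) : Continuous fun y : Rd d => modulate y φ := by
  simp_rw [modulate_eq_fourier]
  have h : Continuous (fun ψ : 𝓢(Rd d, ℂ) => 𝓕 ψ) := by fun_prop
  exact h.comp ((continuous_translate (𝓕⁻ φ)).comp (by fun_prop))

theorem exists_schwartzNorm_modulate_le (m : ℕ × ℕ) :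
    ∃ (m' : ℕ × ℕ) (C : ℝ) (N : ℕ), 0 ≤ C ∧ ∀ (y : Rd d) (φ : 𝓢(Rd d, ℂ)),
      schwartzNorm m (modulate y φ) ≤ C * (1 + ‖y‖) ^ N * schwartzNorm m' φ := by
  obtain ⟨m1, C1, h1, hC1⟩ := exists_clm_bound (SchwartzMap.fourierTransformCLM ℂ
    (V := Rd d) (E := ℂ)) m
  obtain ⟨m2, C2, h2, hC2⟩ := exists_clm_bound
    (FourierTransform.fourierInvCLM ℂ 𝓢(Rd d, ℂ)) m1
  refine ⟨m2, C1 * 2 ^ m1.1 * C2, m1.1, by positivity, fun y φ => ?_⟩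
  rw [modulate_eq_fourier]
  have hy : ‖(2 * Real.pi)⁻¹ • y‖ ≤ ‖y‖ := by
    rw [norm_smul, Real.norm_of_nonneg (by positivity)]
    exact mul_le_of_le_one_left (norm_nonneg _)
      (inv_le_one_of_one_le₀ (by linarith [Real.pi_gt_three]))
  have h0 : 0 ≤ schwartzNorm m2 φ := apply_nonneg _ _
  calc _ ≤ C1 * schwartzNorm m1 (translate ((2 * Real.pi)⁻¹ • y) (𝓕⁻ φ)) := hC1 _
    _ ≤ C1 * (2 ^ m1.1 * (1 + ‖(2 * Real.pi)⁻¹ • y‖) ^ m1.1 * schwartzNorm m1 (𝓕⁻ φ)) := by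
        gcongr; exact schwartzNorm_translate_le _ _ _
    _ ≤ C1 * (2 ^ m1.1 * (1 + ‖y‖) ^ m1.1 * (C2 * schwartzNorm m2 φ)) := by
        gcongr; exact hC2 φ
    _ = _ := by ring

/-- Separate continuity alone would not suffice. The bound for modulations is locally uniform in
`y`, and so handles the error made by freezing the translation at `x'`. -/
theorem continuous_modulate_translate (g : 𝓢(Rd d, ℂ)) :
    Continuous fun z : Rd d × Rd d => modulate z.2 (translate z.1 g) := by
  rw [continuous_iff_continuousAt]
  rintro ⟨x', y'⟩
  rw [ContinuousAt, (schwartz_withSeminorms ℂ (Rd d) ℂ).tendsto_nhds]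
  intro i ε hε
  obtain ⟨m', C, N, hC, hb⟩ := exists_schwartzNorm_modulate_le (d := d) i
  have hle : ∀ ψ : 𝓢(Rd d, ℂ), schwartzSeminormFamily ℂ (Rd d) ℂ i ψ ≤ schwartzNorm i ψ :=
    fun ψ => Seminorm.le_def.1 (Finset.le_sup (f := schwartzSeminormFamily ℂ (Rd d) ℂ)
      (Finset.mem_Iic.2 le_rfl)) ψ
  have c1 : Continuous fun z : Rd d × Rd d =>
      C * (1 + ‖z.2‖) ^ N * schwartzNorm m' (translate z.1 g - translate x' g) +
        schwartzNorm i (modulate z.2 (translate x' g) - modulate y' (translate x' g)) := by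
    have a1 : Continuous fun z : Rd d × Rd d => translate z.1 g :=
      (continuous_translate g).comp continuous_fst
    have a2 : Continuous fun z : Rd d × Rd d => modulate z.2 (translate x' g) :=
      (continuous_modulate _).comp continuous_snd
    have a3 := (schwartzNorm_continuous m').comp (a1.sub (continuous_const (y := translate x' g)))
    have a4 := (schwartzNorm_continuous i).comp
      (a2.sub (continuous_const (y := modulate y' (translate x' g))))
    exact (Continuous.mul (by fun_prop) a3).add a4
  have hlim := c1.tendsto (x', y')
  simp only [sub_self, map_zero, mul_zero, add_zero] at hlim
  filter_upwards [hlim.eventually_lt_const hε] with z hz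
  refine lt_of_le_of_lt ?_ hz
  have heq : modulate z.2 (translate z.1 g) - modulate y' (translate x' g) =
      modulate z.2 (translate z.1 g - translate x' g) +
        (modulate z.2 (translate x' g) - modulate y' (translate x' g)) := by
    simp only [modulate, map_sub]; abel
  refine (hle _).trans ?_
  rw [heq]
  exact (map_add_le_add _ _ _).trans (by gcongr; exact hb _ _)

theorem exists_schwartzNorm_modulate_translate_le (m : ℕ × ℕ) (g : 𝓢(Rd d, ℂ)) :
    ∃ (C : ℝ) (N : ℕ), 0 ≤ C ∧ ∀ z : Rd d × Rd d,
      schwartzNorm m (modulate z.2 (translate z.1 g)) ≤ C * (1 + ‖z‖) ^ N := by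
  obtain ⟨m', C, N, hC, hb⟩ := exists_schwartzNorm_modulate_le (d := d) m
  have h0 : 0 ≤ schwartzNorm m' g := apply_nonneg _ _
  refine ⟨C * (2 ^ m'.1 * schwartzNorm m' g), N + m'.1, by positivity, fun z => ?_⟩
  have h1 : ‖z.1‖ ≤ ‖z‖ := norm_fst_le z
  have h2 : ‖z.2‖ ≤ ‖z‖ := norm_snd_le z
  calc _ ≤ C * (1 + ‖z.2‖) ^ N * schwartzNorm m' (translate z.1 g) := hb _ _
    _ ≤ C * (1 + ‖z‖) ^ N * (2 ^ m'.1 * (1 + ‖z‖) ^ m'.1 * schwartzNorm m' g) := by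
        gcongr
        exact (schwartzNorm_translate_le m' z.1 g).trans (by gcongr)
    _ = _ := by ring

/-! ### Integrals of Schwartz functions under a tempered distribution -/

set_option linter.unusedSectionVars false

section Interchange

open BoundedContinuousFunction LineDeriv

/-- The points at which `schwartzNorm m` evaluates derivatives, with their directions. -/
abbrev JetPoint (d : ℕ) (m : ℕ × ℕ) : Type :=
  Σ i : Finset.Iic m, Rd d × (Fin (i : ℕ × ℕ).2 → Metric.closedBall (0 : Rd d) 1)

/-- The weighted derivatives of a Schwartz function. -/
def jetFun (m : ℕ × ℕ) (φ : 𝓢(Rd d, ℂ)) (j : JetPoint d m) : ℂ :=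
  ((‖j.2.1‖ ^ (j.1 : ℕ × ℕ).1 : ℝ) : ℂ) *
    iteratedFDeriv ℝ (j.1 : ℕ × ℕ).2 φ j.2.1 (fun l => (j.2.2 l : Rd d))

theorem seminorm_le_schwartzNorm {m i : ℕ × ℕ} (hi : i ≤ m) (φ : 𝓢(Rd d, ℂ)) :
    SchwartzMap.seminorm ℂ i.1 i.2 φ ≤ schwartzNorm m φ :=
  Seminorm.le_def.1 (Finset.le_sup (f := schwartzSeminormFamily ℂ (Rd d) ℂ)
      (Finset.mem_Iic.2 hi)) φ

theorem norm_jetFun_le (m : ℕ × ℕ) (φ : 𝓢(Rd d, ℂ)) (j : JetPoint d m) :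
    ‖jetFun m φ j‖ ≤ schwartzNorm m φ := by
  refine le_trans ?_ (seminorm_le_schwartzNorm (Finset.mem_Iic.1 j.1.2) φ)
  refine le_trans ?_ (SchwartzMap.le_seminorm ℂ _ _ φ j.2.1)
  rw [jetFun, norm_mul, Complex.norm_real, norm_pow, norm_norm]
  gcongr
  refine (ContinuousMultilinearMap.le_opNorm _ _).trans ?_
  refine mul_le_of_le_one_right (norm_nonneg _) (Finset.prod_le_one (fun _ _ => norm_nonneg _) ?_)
  intro l _
  exact mem_closedBall_zero_iff.1 (j.2.2 l).2

theorem continuous_jetFun (m : ℕ × ℕ) (φ : 𝓢(Rd d, ℂ)) : Continuous (jetFun m φ) := by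
  refine continuous_sigma fun i => ?_
  have h0 : Continuous fun p : Rd d × (Fin (i : ℕ × ℕ).2 → Metric.closedBall (0 : Rd d) 1) =>
      ((‖p.1‖ ^ (i : ℕ × ℕ).1 : ℝ) : ℂ) := by fun_prop
  refine Continuous.mul h0 ?_
  have h1 : Continuous fun p : Rd d × (Fin (i : ℕ × ℕ).2 → Metric.closedBall (0 : Rd d) 1) =>
      iteratedFDeriv ℝ (i : ℕ × ℕ).2 φ p.1 :=
    ((φ.smooth _).continuous_iteratedFDeriv le_rfl).comp continuous_fst
  have h2 : Continuous fun p : Rd d × (Fin (i : ℕ × ℕ).2 → Metric.closedBall (0 : Rd d) 1) =>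
      (fun l => (p.2 l : Rd d)) := by fun_prop
  exact h1.eval h2

/-- The embedding of the Schwartz functions, with the norm `schwartzNorm m`, into a space of
bounded continuous functions. -/
def jet (m : ℕ × ℕ) : 𝓢(Rd d, ℂ) →ₗ[ℂ] (JetPoint d m →ᵇ ℂ) where
  toFun φ := BoundedContinuousFunction.ofNormedAddCommGroup (jetFun m φ)
    (continuous_jetFun m φ) (schwartzNorm m φ) (norm_jetFun_le m φ)
  map_add' φ ψ := by
    ext j
    have : ⇑(φ + ψ) = ⇑φ + ⇑ψ := by ext; simp
    simp only [BoundedContinuousFunction.coe_ofNormedAddCommGroup,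
      BoundedContinuousFunction.add_apply, jetFun]
    rw [this, iteratedFDeriv_add_apply (φ.smooth _).contDiffAt (ψ.smooth _).contDiffAt,
      _root_.add_apply, mul_add]
  map_smul' c φ := by
    ext j
    have : ⇑(c • φ) = c • ⇑φ := by ext; simp
    simp only [BoundedContinuousFunction.coe_ofNormedAddCommGroup,
      BoundedContinuousFunction.smul_apply, jetFun, RingHom.id_apply]
    rw [this, iteratedFDeriv_const_smul_apply (φ.smooth _).contDiffAt,
      _root_.smul_apply, smul_eq_mul, smul_eq_mul]
    ring

theorem jet_apply (m : ℕ × ℕ) (φ : 𝓢(Rd d, ℂ)) (j : JetPoint d m) :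
    jet m φ j = jetFun m φ j := rfl

theorem norm_jet_le (m : ℕ × ℕ) (φ : 𝓢(Rd d, ℂ)) : ‖jet m φ‖ ≤ schwartzNorm m φ :=
  BoundedContinuousFunction.norm_ofNormedAddCommGroup_le (f := jetFun m φ) (continuous_jetFun m φ)
    (apply_nonneg (schwartzNorm m) φ) (norm_jetFun_le m φ)

/-- By homogeneity a tuple of directions can be normalized to the unit ball, where `jetFun` samples
the derivative. A zero direction is harmless, since `0⁻¹ • 0 = 0` still lies in the ball. -/
theorem schwartzNorm_le_norm_jet (m : ℕ × ℕ) (φ : 𝓢(Rd d, ℂ)) : schwartzNorm m φ ≤ ‖jet m φ‖ := by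
  refine Seminorm.finset_sup_apply_le (norm_nonneg _) fun i hi => ?_
  refine SchwartzMap.seminorm_le_bound ℂ i.1 i.2 _ (norm_nonneg _) fun x => ?_
  have key : ‖((‖x‖ ^ i.1 : ℝ) • iteratedFDeriv ℝ i.2 φ x)‖ ≤ ‖jet m φ‖ := by
    refine ContinuousMultilinearMap.opNorm_le_bound (norm_nonneg _) fun v => ?_
    have hu : ∀ l, ‖v l‖⁻¹ • v l ∈ Metric.closedBall (0 : Rd d) 1 := fun l => by
      rw [mem_closedBall_zero_iff, norm_smul, norm_inv, norm_norm]
      exact inv_mul_le_one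
    have hv : v = fun l => ‖v l‖ • (‖v l‖⁻¹ • v l) := by
      ext1 l
      rcases eq_or_ne (v l) 0 with h | h
      · simp [h]
      · rw [smul_inv_smul₀ (norm_ne_zero_iff.2 h)]
    have h1 := (jet m φ).norm_coe_le_norm ⟨⟨i, hi⟩, x, fun l => ⟨_, hu l⟩⟩
    rw [jet_apply, jetFun] at h1
    rw [hv, ContinuousMultilinearMap.map_smul_univ, norm_smul, ← hv, mul_comm, Finset.prod_congr rfl
      (fun l _ => rfl), norm_prod, Finset.prod_congr rfl (fun l _ => norm_norm (v l))]
    gcongr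
    refine le_trans (le_of_eq ?_) h1
    rw [_root_.smul_apply, norm_smul, norm_mul, Complex.norm_real]
  rw [norm_smul, norm_pow, norm_norm] at key
  exact key

theorem jet_injective (m : ℕ × ℕ) : Function.Injective (jet (d := d) m) := by
  intro φ ψ h
  ext x
  have h0 := DFunLike.congr_fun h
    ⟨⟨(0, 0), Finset.mem_Iic.2 ⟨Nat.zero_le _, Nat.zero_le _⟩⟩, x, fun l => ⟨0, by simp⟩⟩
  simpa [jet_apply, jetFun] using h0

/-- Hahn–Banach: `f` is bounded for some `schwartzNorm m`, hence a bounded functional on the range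
of `jet m`, and extends to the whole Banach space. There it can be exchanged with Bochner integrals.
-/
theorem exists_jet_extension (f : 𝓢'(Rd d, ℂ)) :
    ∃ (m : ℕ × ℕ) (G : (JetPoint d m →ᵇ ℂ) →L[ℂ] ℂ), ∀ φ, G (jet m φ) = f φ := by
  obtain ⟨m, C, hC, hb⟩ := exists_distribution_bound f
  refine ⟨m, ?_⟩
  let e := LinearEquiv.ofInjective (jet (d := d) m) (jet_injective m)
  let F0 : LinearMap.range (jet (d := d) m) →ₗ[ℂ] ℂ :=
    (f : 𝓢(Rd d, ℂ) →ₗ[ℂ] ℂ) ∘ₗ e.symm.toLinearMap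
  have h1 : ∀ φ, F0 (e φ) = f φ := fun φ => by simp [F0]
  let F : StrongDual ℂ (LinearMap.range (jet (d := d) m)) := F0.mkContinuous C fun ψ => by
    obtain ⟨φ, rfl⟩ := e.surjective ψ
    rw [h1]
    exact (hb φ).trans (by gcongr; exact schwartzNorm_le_norm_jet m φ)
  obtain ⟨G, hG, -⟩ := exists_extension_norm_eq (LinearMap.range (jet (d := d) m)) F
  refine ⟨G, fun φ => ?_⟩
  rw [← h1 φ]
  exact hG (e φ)

theorem continuous_jet {W : Type*} [TopologicalSpace W] (m : ℕ × ℕ) {Φ : W → 𝓢(Rd d, ℂ)} (hΦ : Continuous Φ) :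
    Continuous fun w => jet m (Φ w) := by
  rw [continuous_iff_continuousAt]
  intro w₀
  rw [ContinuousAt, tendsto_iff_norm_sub_tendsto_zero]
  have h1 : Continuous fun w => schwartzNorm m (Φ w - Φ w₀) :=
    (schwartzNorm_continuous m).comp (hΦ.sub continuous_const)
  have h2 := h1.tendsto w₀
  simp only [sub_self, map_zero] at h2
  refine squeeze_zero (fun _ => norm_nonneg _) (fun w => ?_) h2
  rw [← map_sub]
  exact norm_jet_le m _

theorem norm_le_schwartzNorm (m : ℕ × ℕ) (φ : 𝓢(Rd d, ℂ)) (x : Rd d) :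
    ‖φ x‖ ≤ schwartzNorm m φ :=
  (SchwartzMap.norm_le_seminorm ℂ φ x).trans
    (seminorm_le_schwartzNorm (i := (0, 0)) ⟨Nat.zero_le _, Nat.zero_le _⟩ φ)

theorem continuous_eval_schwartz (x : Rd d) : Continuous fun φ : 𝓢(Rd d, ℂ) => φ x :=
  (TemperedDistribution.delta x).continuous

variable {W : Type*} [TopologicalSpace W] [MeasurableSpace W] [BorelSpace W]
  [SecondCountableTopology W] {μ : Measure W}

/-- Differentiation under the integral sign: a Schwartz seminorm bounds the derivative uniformly
along the line, so it serves as dominating function. -/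
theorem lineDeriv_eq_integral {c : W → ℂ} (hc : AEStronglyMeasurable c μ)
    {Φ : W → 𝓢(Rd d, ℂ)} (hΦ : Continuous Φ)
    (hint : ∀ m, Integrable (fun w => ‖c w‖ * schwartzNorm m (Φ w)) μ) {φ : 𝓢(Rd d, ℂ)}
    (hφ : ∀ t, φ t = ∫ w, c w * Φ w t ∂μ) (v x : Rd d) :
    (∂_{v} φ : 𝓢(Rd d, ℂ)) x = ∫ w, c w * (∂_{v} (Φ w) : 𝓢(Rd d, ℂ)) x ∂μ := by
  obtain ⟨m', C, hC, hb⟩ := exists_clm_bound (lineDerivOpCLM ℂ 𝓢(Rd d, ℂ) v) (0, 0)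
  have hmeas : ∀ (Ψ : W → 𝓢(Rd d, ℂ)) x, Continuous Ψ →
      AEStronglyMeasurable (fun w => c w * Ψ w x) μ :=
    fun Ψ x hΨ => hc.mul ((continuous_eval_schwartz x).comp hΨ).aestronglyMeasurable
  have hline : ∀ (ψ : 𝓢(Rd d, ℂ)) (s : ℝ),
      HasDerivAt (fun s : ℝ => ψ (x + s • v)) ((∂_{v} ψ : 𝓢(Rd d, ℂ)) (x + s • v)) s :=
    fun ψ s => by
      rw [SchwartzMap.lineDerivOp_apply_eq_fderiv]
      have h1 : HasDerivAt (fun s : ℝ => x + s • v) v s := by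
        simpa using ((hasDerivAt_id s).smul_const v).const_add x
      exact (ψ.hasFDerivAt (x + s • v)).comp_hasDerivAt s h1
  have hder := hasDerivAt_integral_of_dominated_loc_of_deriv_le (𝕜 := ℝ) (μ := μ)
    (F := fun (s : ℝ) w => c w * Φ w (x + s • v))
    (F' := fun (s : ℝ) w => c w * (∂_{v} (Φ w) : 𝓢(Rd d, ℂ)) (x + s • v))
    (x₀ := 0) (s := univ) (bound := fun w => C * (‖c w‖ * schwartzNorm m' (Φ w)))
    univ_mem (.of_forall fun s => hmeas Φ _ hΦ)
    ((hint (0, 0)).mono' (hmeas Φ _ hΦ) (.of_forall fun w => by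
      rw [norm_mul]
      gcongr
      exact norm_le_schwartzNorm _ _ _))
    (hmeas _ _ ((lineDerivOpCLM ℂ 𝓢(Rd d, ℂ) v).continuous.comp hΦ))
    (.of_forall fun w s _ => by
      rw [norm_mul]
      have := (norm_le_schwartzNorm (0, 0) _ (x + s • v)).trans (hb (Φ w))
      calc _ ≤ ‖c w‖ * (C * schwartzNorm m' (Φ w)) := by gcongr; exact this
        _ = _ := by ring)
    ((hint m').const_mul C)
    (.of_forall fun w s _ => (hline (Φ w) s).const_mul (c w))
  have h1 := hder.2
  simp_rw [← hφ] at h1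
  have h2 := h1.unique (hline φ 0)
  simpa using h2.symm

/-- Integrability is assumed for all seminorms at once, so that the hypothesis passes from `Φ` to
its derivative in the induction. -/
theorem iteratedLineDeriv_eq_integral {c : W → ℂ} (hc : AEStronglyMeasurable c μ)
    (n : ℕ) (v : Fin n → Rd d)
    {Φ : W → 𝓢(Rd d, ℂ)} (hΦ : Continuous Φ)
    (hint : ∀ m, Integrable (fun w => ‖c w‖ * schwartzNorm m (Φ w)) μ) {φ : 𝓢(Rd d, ℂ)}
    (hφ : ∀ t, φ t = ∫ w, c w * Φ w t ∂μ) (x : Rd d) :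
    (∂^{v} φ : 𝓢(Rd d, ℂ)) x = ∫ w, c w * (∂^{v} (Φ w) : 𝓢(Rd d, ℂ)) x ∂μ := by
  induction n generalizing Φ φ with
  | zero => simpa using hφ x
  | succ n ih =>
    simp_rw [iteratedLineDerivOp_succ_right]
    refine ih _ (Φ := fun w => ∂_{v (Fin.last n)} (Φ w))
      ((lineDerivOpCLM ℂ 𝓢(Rd d, ℂ) (v (Fin.last n))).continuous.comp hΦ) (fun m => ?_)
      fun t => lineDeriv_eq_integral hc hΦ hint hφ _ t
    obtain ⟨m', C, hC, hb⟩ := exists_clm_bound (lineDerivOpCLM ℂ 𝓢(Rd d, ℂ) (v (Fin.last n))) m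
    refine ((hint m').const_mul C).mono' ?_ (.of_forall fun w => ?_)
    · have h1 : Continuous fun w => schwartzNorm m (∂_{v (Fin.last n)} (Φ w)) :=
        (schwartzNorm_continuous m).comp
          ((lineDerivOpCLM ℂ 𝓢(Rd d, ℂ) (v (Fin.last n))).continuous.comp hΦ)
      exact hc.norm.mul h1.aestronglyMeasurable
    · rw [norm_mul, norm_norm, Real.norm_of_nonneg (apply_nonneg _ _)]
      calc _ ≤ ‖c w‖ * (C * schwartzNorm m' (Φ w)) := by gcongr; exact hb (Φ w)
        _ = _ := by ring

/-- A tempered distribution commutes with an absolutely convergent integral of Schwartz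
functions. -/
theorem distribution_apply_eq_integral {c : W → ℂ} (hc : AEStronglyMeasurable c μ)
    {Φ : W → 𝓢(Rd d, ℂ)} (hΦ : Continuous Φ)
    (hint : ∀ m, Integrable (fun w => ‖c w‖ * schwartzNorm m (Φ w)) μ) {φ : 𝓢(Rd d, ℂ)}
    (hφ : ∀ t, φ t = ∫ w, c w * Φ w t ∂μ) (f : 𝓢'(Rd d, ℂ)) :
    f φ = ∫ w, c w * f (Φ w) ∂μ := by
  obtain ⟨m, G, hG⟩ := exists_jet_extension f
  have hJ : Integrable (fun w => c w • jet m (Φ w)) μ := by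
    refine (hint m).mono' (hc.smul (continuous_jet m hΦ).aestronglyMeasurable)
      (.of_forall fun w => ?_)
    rw [norm_smul]
    gcongr
    exact norm_jet_le m _
  -- Each entry of the jet is an evaluation functional, which commutes with the Bochner integral;
  -- entrywise the claim is differentiation under the integral sign.
  have key : jet m φ = ∫ w, c w • jet m (Φ w) ∂μ := by
    ext j
    have h2 := (BoundedContinuousFunction.evalCLM ℂ j).integral_comp_comm hJ
    refine Eq.trans ?_ h2
    change jetFun m φ j = ∫ w, c w • jetFun m (Φ w) j ∂μ
    simp only [jetFun]
    simp_rw [← SchwartzMap.iteratedLineDerivOp_eq_iteratedFDeriv, smul_eq_mul,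
      mul_left_comm (c _)]
    rw [integral_const_mul, iteratedLineDeriv_eq_integral hc _ _ hΦ hint hφ]
  rw [← hG, key, ← G.integral_comp_comm hJ]
  refine integral_congr_ae (.of_forall fun w => ?_)
  simp [hG]

end Interchange

/-! ### Time-frequency shifts and the inversion formula -/

/-- The complex conjugate of a Schwartz function. -/
def conjS (g : 𝓢(Rd d, ℂ)) : 𝓢(Rd d, ℂ) :=
  SchwartzMap.postcompCLM (Complex.conjCLE : ℂ →L[ℝ] ℂ) g

@[simp] theorem conjS_apply (g : 𝓢(Rd d, ℂ)) (t : Rd d) : conjS g t = starRingEnd ℂ (g t) := by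
  simp [conjS]

@[simp] theorem conjS_conjS (g : 𝓢(Rd d, ℂ)) : conjS (conjS g) = g := by
  ext; simp

/-- The time-frequency shift `t ↦ e^{i y·t} g (t - x)` with `z = (x, y)`. -/
def tfShift (g : 𝓢(Rd d, ℂ)) (z : Rd d × Rd d) : 𝓢(Rd d, ℂ) := modulate (-z.2) (translate z.1 g)

theorem tfShift_apply (g : 𝓢(Rd d, ℂ)) (z : Rd d × Rd d) (t : Rd d) :
    tfShift g z t = phase (-z.2) t * g (t - z.1) := by
  rw [tfShift, modulate_apply]; simp

theorem norm_phase (y t : Rd d) : ‖phase y t‖ = 1 := by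
  rw [phase, Complex.norm_exp]; simp

theorem conj_phase (y t : Rd d) : starRingEnd ℂ (phase y t) = phase (-y) t := by
  rw [phase, phase, ← Complex.exp_conj]; simp

theorem norm_tfShift_apply (g : 𝓢(Rd d, ℂ)) (z : Rd d × Rd d) (t : Rd d) :
    ‖tfShift g z t‖ = ‖g (t - z.1)‖ := by
  rw [tfShift_apply, norm_mul, norm_phase, one_mul]

theorem conjS_tfShift (g : 𝓢(Rd d, ℂ)) (z : Rd d × Rd d) :
    conjS (tfShift g z) = stftAtom g z.1 z.2 := by
  ext t
  rw [conjS_apply, stftAtom_apply, tfShift_apply, map_mul, conj_phase, neg_neg]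

theorem stftAtom_eq (g : 𝓢(Rd d, ℂ)) (z : Rd d × Rd d) :
    stftAtom g z.1 z.2 = tfShift (conjS g) (z.1, -z.2) := by
  ext t
  rw [stftAtom_apply, tfShift_apply]; simp

theorem continuous_tfShift (g : 𝓢(Rd d, ℂ)) : Continuous (tfShift g) := by
  have := (continuous_modulate_translate g).comp
    (continuous_fst.prodMk (continuous_snd.neg) : Continuous fun z : Rd d × Rd d => (z.1, -z.2))
  exact this

theorem continuous_stftAtom (g : 𝓢(Rd d, ℂ)) :
    Continuous fun z : Rd d × Rd d => stftAtom g z.1 z.2 := by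
  simp_rw [stftAtom_eq]
  exact (continuous_tfShift _).comp (continuous_fst.prodMk continuous_snd.neg)

theorem exists_schwartzNorm_tfShift_le (m : ℕ × ℕ) (g : 𝓢(Rd d, ℂ)) :
    ∃ (C : ℝ) (N : ℕ), 0 ≤ C ∧ ∀ z, schwartzNorm m (tfShift g z) ≤ C * (1 + ‖z‖) ^ N := by
  obtain ⟨C, N, hC, h⟩ := exists_schwartzNorm_modulate_translate_le m g
  refine ⟨C, N, hC, fun z => (h (z.1, -z.2)).trans (le_of_eq ?_)⟩
  simp [Prod.norm_def]

theorem exists_schwartzNorm_stftAtom_le (m : ℕ × ℕ) (g : 𝓢(Rd d, ℂ)) :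
    ∃ (C : ℝ) (N : ℕ), 0 ≤ C ∧ ∀ z : Rd d × Rd d,
      schwartzNorm m (stftAtom g z.1 z.2) ≤ C * (1 + ‖z‖) ^ N := by
  obtain ⟨C, N, hC, h⟩ := exists_schwartzNorm_tfShift_le m (conjS g)
  refine ⟨C, N, hC, fun z => ?_⟩
  rw [stftAtom_eq]
  exact (h _).trans (le_of_eq (by simp [Prod.norm_def]))

theorem integrable_weight_mul (φ : 𝓢(Rd d, ℂ)) (N : ℕ) :
    Integrable (fun t => (1 + ‖t‖) ^ N * ‖φ t‖) := by
  have h1 : Integrable (fun t : Rd d => 2 ^ (N - 1) * (‖φ t‖ + ‖t‖ ^ N * ‖φ t‖)) :=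
    (φ.integrable.norm.add (SchwartzMap.integrable_pow_mul volume φ N)).const_mul _
  refine h1.mono' (by fun_prop) (.of_forall fun t => ?_)
  rw [Real.norm_of_nonneg (by positivity)]
  have := add_pow_le zero_le_one (norm_nonneg t) N
  calc _ ≤ (2 ^ (N - 1) * (1 ^ N + ‖t‖ ^ N)) * ‖φ t‖ := by gcongr
    _ = _ := by rw [one_pow]; ring

/-- The inequality `1 + ‖x‖ ≤ (1 + ‖t‖)(1 + ‖t - x‖)` distributes the weight over the two factors.
-/
theorem exists_convolution_decay (φ ψ : 𝓢(Rd d, ℂ)) (N : ℕ) :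
    ∃ C : ℝ, 0 ≤ C ∧ ∀ x : Rd d, (1 + ‖x‖) ^ N * ∫ t, ‖ψ (t - x)‖ * ‖φ t‖ ≤ C := by
  refine ⟨2 ^ N * schwartzNorm (N, 0) ψ * ∫ t, (1 + ‖t‖) ^ N * ‖φ t‖, ?_, fun x => ?_⟩
  · have : 0 ≤ schwartzNorm (N, 0) ψ := apply_nonneg _ _
    positivity
  rw [← integral_const_mul, ← integral_const_mul]
  refine integral_mono_of_nonneg (.of_forall fun t => by positivity)
    ((integrable_weight_mul φ N).const_mul _) (.of_forall fun t => ?_)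
  have h1 := weight_le_schwartzNorm_zero N ψ (t - x)
  have h2 : (1 + ‖x‖) ^ N ≤ (1 + ‖t‖) ^ N * (1 + ‖t - x‖) ^ N := by
    rw [← mul_pow]
    gcongr
    have : ‖x‖ ≤ ‖t‖ + ‖t - x‖ := by simpa using norm_sub_le t (t - x)
    nlinarith [norm_nonneg t, norm_nonneg (t - x)]
  calc (1 + ‖x‖) ^ N * (‖ψ (t - x)‖ * ‖φ t‖)
      ≤ ((1 + ‖t‖) ^ N * (1 + ‖t - x‖) ^ N) * (‖ψ (t - x)‖ * ‖φ t‖) := by gcongr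
    _ = ((1 + ‖t - x‖) ^ N * ‖ψ (t - x)‖) * ((1 + ‖t‖) ^ N * ‖φ t‖) := by ring
    _ ≤ _ := mul_le_mul_of_nonneg_right h1 (by positivity)

/-- The (bilinear) pairing of a Schwartz function with the time-frequency shifts of another one. -/
def amb (g φ : 𝓢(Rd d, ℂ)) (z : Rd d × Rd d) : ℂ := ∫ t, tfShift g z t * φ t

theorem continuous_amb (g φ : 𝓢(Rd d, ℂ)) : Continuous (amb g φ) := by
  have h := (map_continuous (φ : 𝓢'(Rd d, ℂ))).comp (continuous_tfShift g)
  exact h.congr fun z => by simp [amb]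

theorem fourier_tfShift (g : 𝓢(Rd d, ℂ)) (z : Rd d × Rd d) (η : Rd d) :
    (𝓕 (tfShift g z) : 𝓢(Rd d, ℂ)) η = phase z.1 ((2 * Real.pi) • η - z.2) *
      (𝓕 g : 𝓢(Rd d, ℂ)) (η - (2 * Real.pi)⁻¹ • z.2) := by
  rw [SchwartzMap.fourier_coe, SchwartzMap.fourier_coe, Real.fourier_eq', Real.fourier_eq',
    ← integral_const_mul, ← integral_add_right_eq_self _ z.1]
  refine integral_congr_ae (.of_forall fun v => ?_)
  simp only [tfShift_apply, smul_eq_mul, add_sub_cancel_right]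
  rw [phase, phase, ← mul_assoc, ← mul_assoc, ← Complex.exp_add, ← Complex.exp_add]
  congr 2
  simp only [inner_sub_right, inner_smul_right, inner_add_left, inner_neg_left, inner_add_right,
    real_inner_comm z.2]
  have : (Real.pi : ℂ) ≠ 0 := by exact_mod_cast Real.pi_ne_zero
  push_cast
  field_simp
  ring

theorem norm_fourier_tfShift (g : 𝓢(Rd d, ℂ)) (z : Rd d × Rd d) (η : Rd d) :
    ‖(𝓕 (tfShift g z) : 𝓢(Rd d, ℂ)) η‖ =
      ‖(𝓕 g : 𝓢(Rd d, ℂ)) (η - (2 * Real.pi)⁻¹ • z.2)‖ := by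
  rw [fourier_tfShift, norm_mul, norm_phase, one_mul]

theorem amb_eq_fourier (g φ : 𝓢(Rd d, ℂ)) (z : Rd d × Rd d) :
    amb g φ z = ∫ η, (𝓕 (tfShift g z) : 𝓢(Rd d, ℂ)) η * (𝓕⁻ φ : 𝓢(Rd d, ℂ)) η := by
  rw [SchwartzMap.integral_fourier_mul_eq, amb, FourierTransform.fourier_fourierInv_eq]

/-- Decay in position is the convolution estimate for `φ` and `g`. Decay in frequency is the same
estimate after Parseval, where the modulation becomes a translation by `y / (2π)`. -/
theorem exists_amb_decay (g φ : 𝓢(Rd d, ℂ)) (N : ℕ) :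
    ∃ C : ℝ, 0 ≤ C ∧ ∀ z, (1 + ‖z‖) ^ N * ‖amb g φ z‖ ≤ C := by
  obtain ⟨C1, hC1, h1⟩ := exists_convolution_decay φ g N
  obtain ⟨C2, hC2, h2⟩ := exists_convolution_decay (𝓕⁻ φ) (𝓕 g) N
  have e1 : ∀ z, (1 + ‖z.1‖) ^ N * ‖amb g φ z‖ ≤ C1 := fun z => by
    refine le_trans ?_ (h1 z.1)
    gcongr
    refine (norm_integral_le_integral_norm _).trans (le_of_eq ?_)
    simp_rw [norm_mul, norm_tfShift_apply]
  have e2 : ∀ z, (1 + ‖z.2‖) ^ N * ‖amb g φ z‖ ≤ (2 * Real.pi) ^ N * C2 := fun z => by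
    have h3 : (1 + ‖z.2‖) ^ N ≤ (2 * Real.pi) ^ N * (1 + ‖(2 * Real.pi)⁻¹ • z.2‖) ^ N := by
      rw [← mul_pow]
      gcongr
      rw [norm_smul, Real.norm_of_nonneg (by positivity), mul_add,
        mul_inv_cancel_left₀ (by positivity)]
      linarith [Real.pi_gt_three]
    calc _ ≤ (2 * Real.pi) ^ N * (1 + ‖(2 * Real.pi)⁻¹ • z.2‖) ^ N * ‖amb g φ z‖ := by gcongr
      _ = (2 * Real.pi) ^ N * ((1 + ‖(2 * Real.pi)⁻¹ • z.2‖) ^ N * ‖amb g φ z‖) := by ring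
      _ ≤ _ := by
        gcongr
        refine le_trans ?_ (h2 ((2 * Real.pi)⁻¹ • z.2))
        gcongr
        rw [amb_eq_fourier]
        refine (norm_integral_le_integral_norm _).trans (le_of_eq ?_)
        simp_rw [norm_mul, norm_fourier_tfShift]
  refine ⟨C1 + (2 * Real.pi) ^ N * C2, by positivity, fun z => ?_⟩
  have h3 : (1 + ‖z‖) ^ N ≤ (1 + ‖z.1‖) ^ N + (1 + ‖z.2‖) ^ N := by
    rcases max_choice ‖z.1‖ ‖z.2‖ with h | h <;> rw [Prod.norm_def, h]
    · exact le_add_of_nonneg_right (by positivity)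
    · exact le_add_of_nonneg_left (by positivity)
  calc _ ≤ ((1 + ‖z.1‖) ^ N + (1 + ‖z.2‖) ^ N) * ‖amb g φ z‖ := by gcongr
    _ ≤ _ := by rw [add_mul]; exact add_le_add (e1 z) (e2 z)

instance isAddHaarMeasure_phaseSpace : (volume : Measure (Rd d × Rd d)).IsAddHaarMeasure :=
  inferInstanceAs (((volume : Measure (Rd d)).prod (volume : Measure (Rd d))).IsAddHaarMeasure)

/-- A function with rapid decay is integrable against any polynomial weight. -/
theorem integrable_weight_mul_amb (g φ : 𝓢(Rd d, ℂ)) (N : ℕ) :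
    Integrable fun z => (1 + ‖z‖) ^ N * ‖amb g φ z‖ := by
  set D := Module.finrank ℝ (Rd d × Rd d)
  -- The surplus `D + 1` exceeds the dimension of phase space, so what remains after the weight is
  -- integrable.
  obtain ⟨C, hC, h⟩ := exists_amb_decay g φ (N + (D + 1))
  have h1 : Integrable (fun z : Rd d × Rd d => C * (1 + ‖z‖) ^ (-((D + 1 : ℕ) : ℝ))) :=
    (integrable_one_add_norm (by push_cast; linarith)).const_mul C
  refine h1.mono' ?_ (.of_forall fun z => ?_)
  · have := continuous_amb g φ
    fun_prop
  · rw [Real.norm_of_nonneg (by positivity), Real.rpow_neg (by positivity), Real.rpow_natCast,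
      ← div_eq_mul_inv, le_div_iff₀ (by positivity)]
    refine le_trans (le_of_eq ?_) (h z)
    rw [pow_add]; ring

theorem integrable_amb (g φ : 𝓢(Rd d, ℂ)) : Integrable (amb g φ) := by
  rw [← integrable_norm_iff (continuous_amb g φ).aestronglyMeasurable]
  simpa using integrable_weight_mul_amb g φ 0

theorem integrable_amb_mul_schwartzNorm (g φ : 𝓢(Rd d, ℂ)) (m : ℕ × ℕ) (h : 𝓢(Rd d, ℂ)) :
    Integrable fun z : Rd d × Rd d => ‖amb g φ z‖ * schwartzNorm m (stftAtom h z.1 z.2) := by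
  obtain ⟨C, N, hC, hb⟩ := exists_schwartzNorm_stftAtom_le m h
  refine ((integrable_weight_mul_amb g φ N).const_mul C).mono' ?_ (.of_forall fun z => ?_)
  · exact ((continuous_amb g φ).norm.mul ((schwartzNorm_continuous m).comp
      (continuous_stftAtom h))).aestronglyMeasurable
  · rw [norm_mul, norm_norm, Real.norm_of_nonneg (apply_nonneg _ _)]
    calc _ ≤ ‖amb g φ z‖ * (C * (1 + ‖z‖) ^ N) := by gcongr; exact hb z
      _ = _ := by ring

/-- The normalization constant of the inversion formula with window `g`. -/
def windowConst (g : 𝓢(Rd d, ℂ)) : ℂ := (((2 * Real.pi) ^ d * ∫ t, ‖g t‖ ^ 2 : ℝ) : ℂ)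

theorem windowConst_ne_zero {g : 𝓢(Rd d, ℂ)} (hg : g ≠ 0) : windowConst g ≠ 0 := by
  have hint : Integrable fun t => ‖g t‖ ^ 2 := by
    have := (memLp_two_iff_integrable_sq_norm g.continuous.aestronglyMeasurable).1 (g.memLp 2)
    exact this
  have h2 : ∫ t, ‖g t‖ ^ 2 ≠ 0 := fun h => hg <| by
    rw [integral_eq_zero_iff_of_nonneg (fun t => by positivity) hint] at h
    have h3 := (Continuous.ae_eq_iff_eq volume (by fun_prop) continuous_const).1 h
    ext t
    have h4 : ‖g t‖ ^ 2 = 0 := congrFun h3 t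
    simpa using h4
  rw [windowConst, Complex.ofReal_ne_zero]
  positivity

/-- For fixed `x` the function `y ↦ amb g φ (x, y)` is the inverse Fourier transform of `g(· - x) φ`
at `y / (2π)`. Fourier inversion in `y` gives `(2π)^d |g(t - x)|² φ(t)`, and the integral over `x`
produces the constant. -/
theorem integral_amb_mul_stftAtom (g φ : 𝓢(Rd d, ℂ)) (t : Rd d) :
    ∫ z : Rd d × Rd d, amb g φ z * stftAtom g z.1 z.2 t = windowConst g * φ t := by
  have hint : Integrable (fun z : Rd d × Rd d => amb g φ z * stftAtom g z.1 z.2 t) := by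
    refine (integrable_amb_mul_schwartzNorm g φ (0, 0) g).mono' ?_ (.of_forall fun z => ?_)
    · exact ((continuous_amb g φ).mul ((continuous_eval_schwartz t).comp
        (continuous_stftAtom g))).aestronglyMeasurable
    · rw [norm_mul]
      gcongr
      exact norm_le_schwartzNorm _ _ _
  have hinner : ∀ x : Rd d, ∫ y, amb g φ (x, y) * stftAtom g x y t =
      (((2 * Real.pi) ^ d * ‖g (t - x)‖ ^ 2 : ℝ) : ℂ) * φ t := fun x => by
    set H : 𝓢(Rd d, ℂ) := SchwartzMap.smulLeftCLM ℂ (translate x g) φ with hH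
    have hHa : ∀ s, H s = g (s - x) * φ s := fun s => by
      rw [hH, SchwartzMap.smulLeftCLM_apply_apply (translate x g).hasTemperateGrowth]; simp
    have hamb : ∀ y, amb g φ (x, y) = (𝓕⁻ H : 𝓢(Rd d, ℂ)) ((2 * Real.pi)⁻¹ • y) := fun y => by
      rw [SchwartzMap.fourierInv_coe, Real.fourierInv_eq', amb]
      refine integral_congr_ae (.of_forall fun s => ?_)
      simp only [tfShift_apply, hHa, smul_eq_mul, phase, ← mul_assoc]
      congr 3
      simp only [inner_neg_left, inner_smul_right, real_inner_comm y]
      have : (Real.pi : ℂ) ≠ 0 := by exact_mod_cast Real.pi_ne_zero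
      push_cast
      field_simp
    have hH2 : H t = 𝓕 (⇑(𝓕⁻ H : 𝓢(Rd d, ℂ))) t := by
      rw [← SchwartzMap.fourier_coe, FourierTransform.fourier_fourierInv_eq]
    have hstep : ∀ y, amb g φ (x, y) * stftAtom g x y t = (starRingEnd ℂ (g (t - x))) *
        (fun η => Complex.exp (((-2 * Real.pi * inner ℝ η t : ℝ) : ℂ) * Complex.I) •
          (𝓕⁻ H : 𝓢(Rd d, ℂ)) η) ((2 * Real.pi)⁻¹ • y) := fun y => by
      simp only [hamb, stftAtom_apply, phase, smul_eq_mul]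
      have : Complex.exp (((-2 * Real.pi * inner ℝ ((2 * Real.pi)⁻¹ • y) t : ℝ) : ℂ) * Complex.I) =
          Complex.exp (-(Complex.I * ((inner ℝ y t : ℝ) : ℂ))) := by
        congr 1
        rw [inner_smul_left]
        have : (Real.pi : ℂ) ≠ 0 := by exact_mod_cast Real.pi_ne_zero
        push_cast
        simp only [conj_trivial]
        push_cast
        field_simp
      rw [this]; ring
    rw [integral_congr_ae (.of_forall hstep), integral_const_mul, Measure.integral_comp_inv_smul_of_nonneg volume
        (fun η => Complex.exp (((-2 * Real.pi * inner ℝ η t : ℝ) : ℂ) * Complex.I) •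
          (𝓕⁻ H : 𝓢(Rd d, ℂ)) η) (by positivity : (0 : ℝ) ≤ 2 * Real.pi),
      ← Real.fourier_eq', ← hH2, hHa, finrank_euclideanSpace_fin]
    have : ((‖g (t - x)‖ ^ 2 : ℝ) : ℂ) = starRingEnd ℂ (g (t - x)) * g (t - x) := by
      rw [Complex.conj_mul']; push_cast; rfl
    rw [Complex.ofReal_mul, this, Complex.real_smul]
    push_cast
    ring
  rw [Measure.volume_eq_prod] at hint ⊢
  rw [integral_prod _ hint]
  simp_rw [hinner]
  rw [integral_mul_const, windowConst, integral_complex_ofReal, integral_const_mul]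
  congr 3
  rw [integral_sub_left_eq_self (fun s => ‖g s‖ ^ 2)]

/-- The inversion formula for the short-time Fourier transform, for tempered distributions. -/
theorem windowConst_mul_apply (g φ : 𝓢(Rd d, ℂ)) (hg : g ≠ 0) (f : 𝓢'(Rd d, ℂ)) :
    windowConst g * f φ = ∫ z : Rd d × Rd d, amb g φ z * f (stftAtom g z.1 z.2) := by
  have h0 := windowConst_ne_zero hg
  have h := distribution_apply_eq_integral (μ := volume) (c := amb g φ)
    (Φ := fun z => stftAtom g z.1 z.2) (φ := windowConst g • φ)
    (continuous_amb g φ).aestronglyMeasurable (continuous_stftAtom g)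
    (fun m => integrable_amb_mul_schwartzNorm g φ m g)
    (fun t => by rw [integral_amb_mul_stftAtom]; simp) f
  rw [← h, map_smul, smul_eq_mul]

/-! ### Gaussian coherent states -/

theorem norm_iteratedFDeriv_ofReal_exp (n : ℕ) (s : ℝ) :
    ‖iteratedFDeriv ℝ n (fun s : ℝ => (Real.exp s : ℂ)) s‖ = Real.exp s := by
  have hit : ∀ n : ℕ, iteratedDeriv n (fun s : ℝ => (Real.exp s : ℂ)) =
      fun s : ℝ => (Real.exp s : ℂ) := by
    intro n
    induction n with
    | zero => simp
    | succ n ih =>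
      rw [iteratedDeriv_succ, ih]
      funext s
      exact ((Real.hasDerivAt_exp s).ofReal_comp).deriv
  rw [norm_iteratedFDeriv_eq_norm_iteratedDeriv, hit, Complex.norm_real,
    Real.norm_of_nonneg (Real.exp_pos s).le]

/-- Here `(1 + r)^M ≤ M! e^{1 + r}`, and `1 + r - r²/2 ≤ 3/2` is the inequality `(r - 1)² ≥ 0`. -/
theorem one_add_pow_mul_exp_le (M : ℕ) (r : ℝ) (hr : 0 ≤ r) :
    (1 + r) ^ M * Real.exp (-r ^ 2 / 2) ≤ M.factorial * Real.exp (3 / 2) := by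
  have h1 := Real.pow_div_factorial_le_exp (1 + r) (by positivity) M
  rw [div_le_iff₀ (by positivity)] at h1
  calc _ ≤ (Real.exp (1 + r) * M.factorial) * Real.exp (-r ^ 2 / 2) := by gcongr
    _ = M.factorial * Real.exp (1 + r + -r ^ 2 / 2) := by rw [Real.exp_add (1 + r)]; ring
    _ ≤ _ := by
      gcongr
      nlinarith [sq_nonneg (r - 1)]

/-- In the chain rule the outer exponential reproduces itself under differentiation, and the inner
quadratic form contributes polynomial factors only. -/
theorem gaussian_decay (k n : ℕ) : ∃ C : ℝ, ∀ x : Rd d,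
    ‖x‖ ^ k * ‖iteratedFDeriv ℝ n (fun t : Rd d => ((Real.exp (-‖t‖ ^ 2 / 2) : ℝ) : ℂ)) x‖ ≤ C := by
  have hf : (fun t : Rd d => -‖t‖ ^ 2 / 2).HasTemperateGrowth := by
    have h := (Function.HasTemperateGrowth.const (E := Rd d) (-(1 / 2 : ℝ))).mul
      (Function.hasTemperateGrowth_norm_sq (Rd d))
    convert! h using 1
    ext t; simp only [Pi.mul_apply]; ring
  obtain ⟨l, C, hC, hb⟩ := hf.norm_iteratedFDeriv_le_uniform n
  refine ⟨n.factorial * (C + 1) ^ n * ((k + l * n).factorial * Real.exp (3 / 2)), fun x => ?_⟩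
  have hg : ContDiff ℝ n (fun s : ℝ => (Real.exp s : ℂ)) :=
    Complex.ofRealCLM.contDiff.comp Real.contDiff_exp
  have hone : (1 : ℝ) ≤ (1 + ‖x‖) ^ l := one_le_pow₀ (by linarith [norm_nonneg x])
  -- With `C + 1` in place of `C` the base `D` is at least `1`, so `D ≤ D ^ i` for `i ≥ 1`, as the
  -- estimate demands.
  have h1 := norm_iteratedFDeriv_comp_le (x := x) hg (hf.1.of_le (by exact_mod_cast le_top)) le_rfl
    (C := Real.exp (-‖x‖ ^ 2 / 2)) (D := (C + 1) * (1 + ‖x‖) ^ l)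
    (fun i _ => (norm_iteratedFDeriv_ofReal_exp i _).le) (fun i hi1 hi => by
      have h2 : 1 ≤ (C + 1) * (1 + ‖x‖) ^ l := by nlinarith
      refine (hb i hi x).trans (le_trans ?_ (le_self_pow₀ h2 (by omega)))
      gcongr
      linarith)
  calc _ ≤ (1 + ‖x‖) ^ k * (n.factorial * Real.exp (-‖x‖ ^ 2 / 2) *
        ((C + 1) * (1 + ‖x‖) ^ l) ^ n) := by
        gcongr
        · linarith
        · exact h1
    _ = n.factorial * (C + 1) ^ n * ((1 + ‖x‖) ^ (k + l * n) * Real.exp (-‖x‖ ^ 2 / 2)) := by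
        rw [mul_pow, ← pow_mul, pow_add]; ring
    _ ≤ _ := by
        exact mul_le_mul_of_nonneg_left (one_add_pow_mul_exp_le _ _ (norm_nonneg x))
          (by positivity)

/-- The Gaussian `e^{-|t|²/2}`. -/
def gauss : 𝓢(Rd d, ℂ) where
  toFun t := ((Real.exp (-‖t‖ ^ 2 / 2) : ℝ) : ℂ)
  smooth' := Complex.ofRealCLM.contDiff.comp
    (Real.contDiff_exp.comp ((contDiff_norm_sq ℝ).neg.div_const 2))
  decay' k n := gaussian_decay k n

theorem gauss_apply (t : Rd d) : gauss t = ((Real.exp (-‖t‖ ^ 2 / 2) : ℝ) : ℂ) := rfl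

theorem gauss_ne_zero : (gauss : 𝓢(Rd d, ℂ)) ≠ 0 := fun h => by
  have := DFunLike.congr_fun h 0
  simp [gauss_apply] at this

/-- The coherent state with centre `z = (x, y)`: the Gaussian `e^{-|t|²/2}`, shifted by the
symmetric time-frequency shift. -/
def coherent (z : Rd d × Rd d) : 𝓢(Rd d, ℂ) :=
  Complex.exp (-(Complex.I * ((inner ℝ z.1 z.2 / 2 : ℝ) : ℂ))) • tfShift gauss z

theorem norm_coherent_factor (z : Rd d × Rd d) :
    ‖Complex.exp (-(Complex.I * ((inner ℝ z.1 z.2 / 2 : ℝ) : ℂ)))‖ = 1 := by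
  rw [Complex.norm_exp]; simp

theorem coherent_apply (z : Rd d × Rd d) (t : Rd d) : coherent z t =
    Complex.exp (Complex.I * ((inner ℝ z.2 t - inner ℝ z.1 z.2 / 2 : ℝ) : ℂ) +
      ((-‖t - z.1‖ ^ 2 / 2 : ℝ) : ℂ)) := by
  rw [coherent, _root_.smul_apply, tfShift_apply, gauss_apply, phase, smul_eq_mul,
    Complex.ofReal_exp, ← Complex.exp_add, ← Complex.exp_add]
  congr 1
  rw [inner_neg_left]
  push_cast
  ring

theorem norm_coherent_apply (z : Rd d × Rd d) (t : Rd d) :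
    ‖coherent z t‖ = Real.exp (-‖t - z.1‖ ^ 2 / 2) := by
  rw [coherent_apply, Complex.norm_exp]
  congr 1
  simp only [Complex.add_re, Complex.mul_re, Complex.I_re, Complex.I_im, Complex.ofReal_re,
    Complex.ofReal_im]
  ring

theorem continuous_coherent : Continuous (coherent (d := d)) := by
  unfold coherent
  have := continuous_tfShift (gauss (d := d))
  fun_prop

/-- The squared `L²` norm of the Gaussian. -/
def gaussMass (d : ℕ) : ℝ := ∫ t : Rd d, ‖gauss t‖ ^ 2

/-- The reproducing kernel. The symmetric phase factor in `coherent` is chosen so that the phase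
here is exactly the symplectic form, which makes the kernel invariant under `rot`. -/
theorem integral_conj_coherent_mul (z w : Rd d × Rd d) :
    ∫ t, (starRingEnd ℂ) (coherent z t) * coherent w t = (gaussMass d : ℂ) *
      Complex.exp (((-(‖z.1 - w.1‖ ^ 2 + ‖z.2 - w.2‖ ^ 2) / 4 : ℝ) : ℂ) +
        Complex.I * (((inner ℝ z.1 w.2 - inner ℝ z.2 w.1) / 2 : ℝ) : ℂ)) := by
  have main : ∀ z w : Rd d × Rd d, ∫ t, (starRingEnd ℂ) (coherent z t) * coherent w t =
      (Real.pi : ℂ) ^ ((d : ℂ) / 2) *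
      Complex.exp (((-(‖z.1 - w.1‖ ^ 2 + ‖z.2 - w.2‖ ^ 2) / 4 : ℝ) : ℂ) +
        Complex.I * (((inner ℝ z.1 w.2 - inner ℝ z.2 w.1) / 2 : ℝ) : ℂ)) := by
    rintro ⟨x, y⟩ ⟨u, v⟩
    -- Recentring at the midpoint turns the product of the two Gaussians into `e^{-|s|²} e^{-|x -
    -- u|²/4}`.
    rw [← integral_add_right_eq_self _ ((1 / 2 : ℝ) • (x + u))]
    have hpt : ∀ s : Rd d, (starRingEnd ℂ) (coherent (x, y) (s + (1 / 2 : ℝ) • (x + u))) *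
        coherent (u, v) (s + (1 / 2 : ℝ) • (x + u)) =
        Complex.exp (((-‖x - u‖ ^ 2 / 4 : ℝ) : ℂ) +
          Complex.I * (((inner ℝ x v - inner ℝ y u) / 2 : ℝ) : ℂ)) *
        Complex.exp (-1 * (‖s‖ : ℂ) ^ 2 + Complex.I * ((inner ℝ (v - y) s : ℝ) : ℂ)) := fun s => by
      rw [coherent_apply, coherent_apply, ← Complex.exp_conj, ← Complex.exp_add, ← Complex.exp_add]
      congr 1
      simp only [map_add, map_mul, Complex.conj_I, Complex.conj_ofReal]
      have e1 : ‖s + (1 / 2 : ℝ) • (x + u) - x‖ ^ 2 + ‖s + (1 / 2 : ℝ) • (x + u) - u‖ ^ 2 =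
          2 * ‖s‖ ^ 2 + ‖x - u‖ ^ 2 / 2 := by
        have h1 : s + (1 / 2 : ℝ) • (x + u) - x = s - (1 / 2 : ℝ) • (x - u) := by module
        have h2 : s + (1 / 2 : ℝ) • (x + u) - u = s + (1 / 2 : ℝ) • (x - u) := by module
        rw [h1, h2, norm_sub_sq_real, norm_add_sq_real, norm_smul, mul_pow]
        norm_num
        ring
      have e2 : (inner ℝ v (s + (1 / 2 : ℝ) • (x + u)) - inner ℝ u v / 2) -
          (inner ℝ y (s + (1 / 2 : ℝ) • (x + u)) - inner ℝ x y / 2) =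
          (inner ℝ x v - inner ℝ y u) / 2 + inner ℝ (v - y) s := by
        simp only [inner_add_right, inner_smul_right, inner_sub_left, real_inner_comm v,
          real_inner_comm y]
        ring
      have e3 := congrArg (fun r : ℝ => Complex.I * (r : ℂ)) e2
      have e4 := congrArg (fun r : ℝ => ((-r / 2 : ℝ) : ℂ)) e1
      push_cast at e3 e4 ⊢
      linear_combination e3 + e4
    simp_rw [hpt]
    rw [integral_const_mul, GaussianFourier.integral_cexp_neg_mul_sq_norm_add (by simp),
      finrank_euclideanSpace_fin, div_one, mul_left_comm, ← Complex.exp_add]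
    congr 2
    rw [norm_sub_rev v y]
    push_cast
    linear_combination ((‖y - v‖ : ℂ) ^ 2 / 4) * Complex.I_sq
  -- The case `z = w = 0` of the formula identifies the constant.
  have hmass : (gaussMass d : ℂ) = (Real.pi : ℂ) ^ ((d : ℂ) / 2) := by
    have h := main 0 0
    simp only [sub_self, norm_zero] at h
    simp only [Prod.fst_zero, Prod.snd_zero, inner_zero_left, sub_self, zero_div,
      ne_eq, OfNat.ofNat_ne_zero, not_false_eq_true, zero_pow, add_zero, neg_zero,
      Complex.ofReal_zero, mul_zero, Complex.exp_zero, mul_one] at h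
    rw [← h, gaussMass, ← integral_complex_ofReal]
    refine integral_congr_ae (.of_forall fun t => ?_)
    simp only [Complex.conj_mul', norm_coherent_apply, gauss_apply, Complex.norm_real, Prod.fst_zero,
      sub_zero, Real.norm_of_nonneg (Real.exp_pos _).le]
    push_cast
    rfl
  rw [main, hmass]

theorem gaussMass_pos : 0 < gaussMass d := by
  have h : windowConst (gauss : 𝓢(Rd d, ℂ)) ≠ 0 := windowConst_ne_zero gauss_ne_zero
  have h0 : 0 ≤ gaussMass d := integral_nonneg fun t => by positivity
  refine h0.lt_of_ne fun h1 => h ?_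
  rw [windowConst]
  change (((2 * Real.pi) ^ d * gaussMass d : ℝ) : ℂ) = 0
  rw [← h1]; simp

/-! ### The Gabor transform on `L²` -/

/-- The constant that makes the Gabor transform an isometry of `L²`. -/
def gaborConst (d : ℕ) : ℝ := (√((2 * Real.pi) ^ d * gaussMass d))⁻¹

theorem gaborConst_pos : 0 < gaborConst d := by
  have := gaussMass_pos (d := d)
  unfold gaborConst
  positivity

theorem gaborConst_sq : gaborConst d ^ 2 * ((2 * Real.pi) ^ d * gaussMass d) = 1 := by
  have := gaussMass_pos (d := d)
  rw [gaborConst, inv_pow, Real.sq_sqrt (by positivity)]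
  exact inv_mul_cancel₀ (by positivity)

/-- The Gabor transform of a function: its pairing with the coherent states. -/
def gabor (f : Rd d → ℂ) (z : Rd d × Rd d) : ℂ :=
  (gaborConst d : ℂ) * ∫ t, (starRingEnd ℂ) (coherent z t) * f t

theorem gabor_congr {f g : Rd d → ℂ} (h : f =ᵐ[volume] g) : gabor f = gabor g := by
  ext z
  rw [gabor, gabor]
  congr 1
  refine integral_congr_ae ?_
  filter_upwards [h] with t ht
  rw [ht]

theorem inner_toLp_eq (φ : 𝓢(Rd d, ℂ)) (F : Lp ℂ 2 (volume : Measure (Rd d))) :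
    inner ℂ (φ.toLp 2) F = ∫ t, (starRingEnd ℂ) (φ t) * F t := by
  rw [L2.inner_def]
  refine integral_congr_ae ?_
  filter_upwards [φ.coeFn_toLp 2 volume] with t ht
  rw [ht, RCLike.inner_apply, mul_comm]

theorem gabor_eq_inner (F : Lp ℂ 2 (volume : Measure (Rd d))) (z : Rd d × Rd d) :
    gabor F z = gaborConst d * inner ℂ ((coherent z).toLp 2) F := by
  rw [inner_toLp_eq, gabor]

theorem continuous_gabor (F : Lp ℂ 2 (volume : Measure (Rd d))) : Continuous (gabor F) := by
  have h1 : Continuous fun z => (coherent (d := d) z).toLp 2 :=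
    SchwartzMap.continuous_toLp.comp continuous_coherent
  have h2 : gabor F = fun z => gaborConst d * inner ℂ ((coherent z).toLp 2) F :=
    funext (gabor_eq_inner F)
  rw [h2]
  exact continuous_const.mul (h1.inner continuous_const)

theorem gabor_add (F G : Lp ℂ 2 (volume : Measure (Rd d))) :
    gabor (F + G : Lp ℂ 2 (volume : Measure (Rd d))) = gabor F + gabor G := by
  ext z; simp only [Pi.add_apply, gabor_eq_inner, inner_add_right, mul_add]

theorem gabor_sub (F G : Lp ℂ 2 (volume : Measure (Rd d))) :
    gabor (F - G : Lp ℂ 2 (volume : Measure (Rd d))) = gabor F - gabor G := by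
  ext z; simp only [Pi.sub_apply, gabor_eq_inner, inner_sub_right, mul_sub]

theorem gabor_smul (c : ℂ) (F : Lp ℂ 2 (volume : Measure (Rd d))) :
    gabor (c • F : Lp ℂ 2 (volume : Measure (Rd d))) = c • gabor F := by
  ext z; simp only [Pi.smul_apply, gabor_eq_inner, inner_smul_right, smul_eq_mul]; ring

theorem conjS_coherent (z : Rd d × Rd d) : conjS (coherent z) =
    Complex.exp (Complex.I * ((inner ℝ z.1 z.2 / 2 : ℝ) : ℂ)) • stftAtom gauss z.1 z.2 := by
  rw [← conjS_tfShift]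
  ext t
  simp only [coherent, conjS_apply, _root_.smul_apply, smul_eq_mul, map_mul]
  rw [← Complex.exp_conj, map_neg, map_mul, Complex.conj_I, Complex.conj_ofReal, neg_mul, neg_neg]

/-- Plancherel is the inversion formula for the distribution `φ`, tested on the conjugate of `φ`. -/
theorem integral_norm_gabor_sq (φ : 𝓢(Rd d, ℂ)) :
    Integrable (fun z => ‖gabor φ z‖ ^ 2) ∧ ∫ z, ‖gabor φ z‖ ^ 2 = ∫ t, ‖φ t‖ ^ 2 := by
  have hB : ∀ z : Rd d × Rd d, ((‖gabor φ z‖ ^ 2 : ℝ) : ℂ) = (gaborConst d : ℂ) ^ 2 *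
      (amb gauss (conjS φ) z * ((φ : 𝓢'(Rd d, ℂ)) (stftAtom gauss z.1 z.2))) := fun z => by
    have h1 : amb gauss (conjS φ) z =
        (starRingEnd ℂ) ((φ : 𝓢'(Rd d, ℂ)) (stftAtom gauss z.1 z.2)) := by
      rw [amb, SchwartzMap.coe_apply]
      refine Eq.trans ?_ (integral_conj (μ := volume)
        (f := fun t => stftAtom gauss z.1 z.2 t • φ t))
      refine integral_congr_ae (.of_forall fun t => ?_)
      simp only [← conjS_tfShift, conjS_apply, smul_eq_mul, map_mul, Complex.conj_conj]
    have h2 : gabor φ z = gaborConst d * (Complex.exp (Complex.I * ((inner ℝ z.1 z.2 / 2 : ℝ) : ℂ)) *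
        ((φ : 𝓢'(Rd d, ℂ)) (stftAtom gauss z.1 z.2))) := by
      rw [gabor, SchwartzMap.coe_apply]
      congr 1
      rw [← integral_const_mul]
      refine integral_congr_ae (.of_forall fun t => ?_)
      have := DFunLike.congr_fun (conjS_coherent z) t
      simp only [conjS_apply, _root_.smul_apply, smul_eq_mul] at this ⊢
      rw [this]; ring
    rw [h1, Complex.conj_mul', h2, norm_mul, norm_mul, Complex.norm_exp]
    have : (Complex.I * ((inner ℝ z.1 z.2 / 2 : ℝ) : ℂ)).re = 0 := by simp
    rw [this, Real.exp_zero, Complex.norm_real, Real.norm_of_nonneg gaborConst_pos.le]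
    push_cast
    ring
  have hint : Integrable fun z : Rd d × Rd d =>
      amb gauss (conjS φ) z * ((φ : 𝓢'(Rd d, ℂ)) (stftAtom gauss z.1 z.2)) := by
    obtain ⟨m, C, hC, hb⟩ := exists_distribution_bound (φ : 𝓢'(Rd d, ℂ))
    refine ((integrable_amb_mul_schwartzNorm gauss (conjS φ) m gauss).const_mul C).mono' ?_
      (.of_forall fun z => ?_)
    · exact ((continuous_amb _ _).mul ((map_continuous (φ : 𝓢'(Rd d, ℂ))).comp
        (continuous_stftAtom _))).aestronglyMeasurable
    · rw [norm_mul]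
      calc _ ≤ ‖amb gauss (conjS φ) z‖ * (C * schwartzNorm m (stftAtom gauss z.1 z.2)) := by
            gcongr; exact hb _
        _ = _ := by ring
  have hint2 : Integrable fun z => ((‖gabor φ z‖ ^ 2 : ℝ) : ℂ) := by
    simp_rw [hB]; exact hint.const_mul _
  refine ⟨hint2.re, ?_⟩
  have h3 : ((∫ z, ‖gabor φ z‖ ^ 2 : ℝ) : ℂ) = ((∫ t, ‖φ t‖ ^ 2 : ℝ) : ℂ) := by
    rw [← integral_complex_ofReal, integral_congr_ae (.of_forall hB), integral_const_mul,
      ← windowConst_mul_apply gauss (conjS φ) gauss_ne_zero, ← mul_assoc]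
    have h4 : (gaborConst d : ℂ) ^ 2 * windowConst (gauss : 𝓢(Rd d, ℂ)) = 1 := by
      rw [windowConst]
      exact_mod_cast gaborConst_sq (d := d)
    rw [h4, one_mul, SchwartzMap.coe_apply, ← integral_complex_ofReal]
    refine integral_congr_ae (.of_forall fun t => ?_)
    simp only [conjS_apply, smul_eq_mul, Complex.conj_mul']
    push_cast; rfl
  exact_mod_cast h3

theorem gabor_toLp (φ : 𝓢(Rd d, ℂ)) : gabor (φ.toLp 2) = gabor φ :=
  gabor_congr (φ.coeFn_toLp 2 volume)

theorem gabor_schwartz_memLp (φ : 𝓢(Rd d, ℂ)) :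
    MemLp (gabor (φ.toLp 2)) 2 ∧ eLpNorm (gabor (φ.toLp 2)) 2 volume = ‖φ.toLp 2‖ₑ := by
  have hm : MemLp (gabor (φ.toLp 2)) 2 := by
    rw [memLp_two_iff_integrable_sq_norm (continuous_gabor _).aestronglyMeasurable, gabor_toLp]
    exact (integral_norm_gabor_sq φ).1
  refine ⟨hm, ?_⟩
  have h1 : MemLp φ 2 volume := φ.memLp 2
  have h2 : ‖φ.toLp 2‖ₑ = eLpNorm φ 2 volume := by
    rw [Lp.enorm_def]
    exact eLpNorm_congr_ae (φ.coeFn_toLp 2 volume)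
  rw [h2, hm.eLpNorm_eq_integral_rpow_norm (by norm_num) (by norm_num),
    h1.eLpNorm_eq_integral_rpow_norm (by norm_num) (by norm_num), gabor_toLp]
  simp only [ENNReal.toReal_ofNat, Real.rpow_ofNat]
  rw [(integral_norm_gabor_sq φ).2]

/-- Approximation by Schwartz functions: their Gabor transforms form a Cauchy sequence in `L²`. They
also converge at every point, as evaluation is an inner product with a coherent state, and this
identifies the `L²` limit with `gabor F`. -/
theorem gabor_memLp_two (F : Lp ℂ 2 (volume : Measure (Rd d))) :
    MemLp (gabor F) 2 ∧ eLpNorm (gabor F) 2 volume = ‖F‖ₑ := by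
  have hd := SchwartzMap.denseRange_toLpCLM (E := Rd d) (F := ℂ) (μ := volume) (p := 2)
    (by norm_num)
  obtain ⟨u, hu, hlim⟩ := mem_closure_iff_seq_limit.1 (hd F)
  choose φ hφ using hu
  have hφ' : ∀ n, (φ n).toLp 2 = u n := hφ
  have hmem : ∀ n, MemLp (gabor (u n)) 2 := fun n => hφ' n ▸ (gabor_schwartz_memLp (φ n)).1
  let G : ℕ → Lp ℂ 2 (volume : Measure (Rd d × Rd d)) := fun n => (hmem n).toLp
  have hdist : ∀ n m, ‖G n - G m‖ = ‖u n - u m‖ := fun n m => by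
    have h1 : u n - u m = (φ n - φ m).toLp 2 := by
      rw [← hφ', ← hφ']
      exact ((SchwartzMap.toLpCLM ℂ ℂ 2 volume).map_sub (φ n) (φ m)).symm
    rw [Lp.norm_def, Lp.norm_def, ← (hmem n).toLp_sub (hmem m), ← Lp.enorm_def (u n - u m), h1,
      ← (gabor_schwartz_memLp (φ n - φ m)).2, ← h1, gabor_sub]
    congr 1
    exact eLpNorm_congr_ae (MemLp.coeFn_toLp _)
  have hcau : CauchySeq G := by
    have h2 := hlim.cauchySeq
    rw [Metric.cauchySeq_iff] at h2 ⊢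
    simpa only [dist_eq_norm, hdist] using h2
  obtain ⟨H, hH⟩ := cauchySeq_tendsto_of_complete hcau
  obtain ⟨ns, hns, hae⟩ := (tendstoInMeasure_of_tendsto_Lp hH).exists_seq_tendsto_ae
  have heq : H =ᵐ[volume] gabor F := by
    have h5 : ∀ z, Tendsto (fun n => gabor (u (ns n)) z) atTop (𝓝 (gabor F z)) := fun z => by
      simp only [gabor_eq_inner]
      exact (((innerSL ℂ ((coherent z).toLp 2)).continuous.tendsto F).comp
        (hlim.comp hns.tendsto_atTop)).const_mul _
    have h3 : ∀ᵐ z, ∀ n, G n z = gabor (u n) z := ae_all_iff.2 fun n => (hmem n).coeFn_toLp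
    filter_upwards [hae, h3] with z h1 h2
    refine tendsto_nhds_unique h1 ?_
    simp_rw [h2]
    exact h5 z
  have hn : ‖H‖ = ‖F‖ := by
    refine tendsto_nhds_unique hH.norm ?_
    have h4 : ∀ n, ‖G n‖ = ‖u n‖ := fun n => by
      rw [Lp.norm_def, ← hφ', ← toReal_enorm, ← (gabor_schwartz_memLp (φ n)).2]
      congr 1
      rw [eLpNorm_congr_ae (MemLp.coeFn_toLp _), hφ']
    simp_rw [h4]
    exact hlim.norm
  refine ⟨(memLp_congr_ae heq).1 (Lp.memLp H), ?_⟩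
  rw [← eLpNorm_congr_ae heq, ← Lp.enorm_def, ← ofReal_norm, hn, ofReal_norm]

/-- The Gabor transform as an isometry of `L²` spaces. -/
def gaborL2 : Lp ℂ 2 (volume : Measure (Rd d)) →ₗᵢ[ℂ] Lp ℂ 2 (volume : Measure (Rd d × Rd d)) where
  toFun F := (gabor_memLp_two F).1.toLp
  map_add' F G := by
    rw [← MemLp.toLp_add]
    exact (MemLp.toLp_eq_toLp_iff _ _).2 (by rw [gabor_add])
  map_smul' c F := by
    rw [RingHom.id_apply, ← MemLp.toLp_const_smul]
    exact (MemLp.toLp_eq_toLp_iff _ _).2 (by rw [gabor_smul])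
  norm_map' F := by
    change ‖(gabor_memLp_two F).1.toLp‖ = ‖F‖
    rw [Lp.norm_toLp, (gabor_memLp_two F).2, toReal_enorm]

theorem coeFn_gaborL2 (F : Lp ℂ 2 (volume : Measure (Rd d))) : gaborL2 F =ᵐ[volume] gabor F :=
  (gabor_memLp_two F).1.coeFn_toLp

theorem inner_eq_integral_gabor (F H : Lp ℂ 2 (volume : Measure (Rd d))) :
    inner ℂ F H = ∫ z, (starRingEnd ℂ) (gabor F z) * gabor H z := by
  rw [← gaborL2.inner_map_map, L2.inner_def]
  refine integral_congr_ae ?_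
  filter_upwards [coeFn_gaborL2 F, coeFn_gaborL2 H] with z h1 h2
  rw [h1, h2, RCLike.inner_apply, mul_comm]

theorem gabor_injective {F H : Lp ℂ 2 (volume : Measure (Rd d))} (h : gabor F =ᵐ[volume] gabor H) :
    F = H := by
  refine gaborL2.injective (Lp.ext ?_)
  exact (coeFn_gaborL2 F).trans (h.trans (coeFn_gaborL2 H).symm)

/-- The modulus of the reproducing kernel of the Gabor transform. -/
def gaborKernel (z w : Rd d × Rd d) : ℝ := gaborConst d ^ 2 * gaussMass d *
  (Real.exp (-‖z.1 - w.1‖ ^ 2 / 4) * Real.exp (-‖z.2 - w.2‖ ^ 2 / 4))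

theorem gabor_coherent (z w : Rd d × Rd d) : gabor (coherent z) w = gaborConst d * gaussMass d *
    Complex.exp (((-(‖w.1 - z.1‖ ^ 2 + ‖w.2 - z.2‖ ^ 2) / 4 : ℝ) : ℂ) +
        Complex.I * (((inner ℝ w.1 z.2 - inner ℝ w.2 z.1) / 2 : ℝ) : ℂ)) := by
  rw [gabor, integral_conj_coherent_mul, mul_assoc]

theorem norm_gabor_coherent (z w : Rd d × Rd d) :
    gaborConst d * ‖gabor (coherent z) w‖ = gaborKernel z w := by
  rw [gabor_coherent, norm_mul, norm_mul, Complex.norm_exp, Complex.norm_real, Complex.norm_real,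
    Real.norm_of_nonneg gaborConst_pos.le, Real.norm_of_nonneg gaussMass_pos.le, gaborKernel,
    ← Real.exp_add, norm_sub_rev w.1, norm_sub_rev w.2]
  have : ((((-(‖z.1 - w.1‖ ^ 2 + ‖z.2 - w.2‖ ^ 2) / 4 : ℝ) : ℂ) +
        Complex.I * (((inner ℝ w.1 z.2 - inner ℝ w.2 z.1) / 2 : ℝ) : ℂ)) : ℂ).re =
        -‖z.1 - w.1‖ ^ 2 / 4 + -‖z.2 - w.2‖ ^ 2 / 4 := by
    simp only [Complex.add_re, Complex.mul_re, Complex.I_re, Complex.I_im, Complex.ofReal_re,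
      Complex.ofReal_im]
    ring
  rw [this]; ring

/-- By the isometry, evaluation at `z` is integration against the transform of a coherent state. So
a Gabor transform is dominated by its own convolution with a Gaussian, the source of the embeddings
between different exponents. -/
theorem enorm_gabor_le (F : Lp ℂ 2 (volume : Measure (Rd d))) (z : Rd d × Rd d) :
    ‖gabor F z‖ₑ ≤ ∫⁻ w, ENNReal.ofReal (gaborKernel z w) * ‖gabor F w‖ₑ := by
  rw [gabor_eq_inner, inner_eq_integral_gabor, ← integral_const_mul]
  refine (enorm_integral_le_lintegral_enorm _).trans (lintegral_mono fun w => ?_)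
  rw [gabor_toLp, ← mul_assoc, enorm_mul, ← norm_gabor_coherent]
  gcongr
  rw [enorm_mul, ENNReal.ofReal_mul gaborConst_pos.le, ofReal_norm,
    ← ofReal_norm, Complex.norm_real, Real.norm_of_nonneg gaborConst_pos.le]
  simp [← ofReal_norm]

/-! ### The rotation of phase space and the propagator -/

/-- The Hamiltonian flow of `|x|² + |y|²` on phase space. -/
def rot (θ : ℝ) (z : Rd d × Rd d) : Rd d × Rd d :=
  (Real.cos (2 * θ) • z.1 + Real.sin (2 * θ) • z.2,
    Real.cos (2 * θ) • z.2 - Real.sin (2 * θ) • z.1)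

@[simp] theorem rot_zero (z : Rd d × Rd d) : rot 0 z = z := by simp [rot]

theorem rot_add (a b : ℝ) (z : Rd d × Rd d) : rot (a + b) z = rot a (rot b z) := by
  simp only [rot, mul_add, Real.cos_add, Real.sin_add]
  ext1 <;> module

@[simp] theorem rot_neg_rot (θ : ℝ) (z : Rd d × Rd d) : rot (-θ) (rot θ z) = z := by
  rw [← rot_add]; simp

@[simp] theorem rot_rot_neg (θ : ℝ) (z : Rd d × Rd d) : rot θ (rot (-θ) z) = z := by
  rw [← rot_add]; simp

theorem continuous_rot_const (θ : ℝ) : Continuous (rot (d := d) θ) := by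
  unfold rot; fun_prop

theorem norm_sq_rot (θ : ℝ) (z : Rd d × Rd d) :
    ‖(rot θ z).1‖ ^ 2 + ‖(rot θ z).2‖ ^ 2 = ‖z.1‖ ^ 2 + ‖z.2‖ ^ 2 := by
  simp only [rot]
  rw [norm_add_sq_real, norm_sub_sq_real]
  simp only [norm_smul, mul_pow, inner_smul_left, inner_smul_right, Real.norm_eq_abs, sq_abs,
    conj_trivial, real_inner_comm z.1]
  linear_combination (‖z.1‖ ^ 2 + ‖z.2‖ ^ 2) * Real.sin_sq_add_cos_sq (2 * θ)

theorem rot_sub (θ : ℝ) (z w : Rd d × Rd d) : rot θ z - rot θ w = rot θ (z - w) := by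
  simp only [rot, Prod.fst_sub, Prod.snd_sub]
  ext1 <;> simp only [Prod.fst_sub, Prod.snd_sub] <;> module

theorem symplectic_rot (θ : ℝ) (z w : Rd d × Rd d) :
    inner ℝ (rot θ z).1 (rot θ w).2 - inner ℝ (rot θ z).2 (rot θ w).1 =
      (inner ℝ z.1 w.2 - inner ℝ z.2 w.1 : ℝ) := by
  simp only [rot, inner_add_left, inner_sub_left, inner_add_right, inner_sub_right,
    inner_smul_left, inner_smul_right, conj_trivial]
  linear_combination (inner ℝ z.1 w.2 - inner ℝ z.2 w.1) * Real.sin_sq_add_cos_sq (2 * θ)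

/-- The kernel involves only the Euclidean distance and the symplectic form on phase space, and a
rotation by `rot` preserves both. -/
theorem gabor_coherent_rot (θ : ℝ) (z w : Rd d × Rd d) :
    gabor (coherent (rot θ z)) (rot θ w) = gabor (coherent z) w := by
  rw [gabor_coherent, gabor_coherent, symplectic_rot]
  have h := norm_sq_rot θ (w - z)
  rw [← rot_sub] at h
  simp only [Prod.fst_sub, Prod.snd_sub] at h
  rw [h]

theorem rot_vec_add (θ : ℝ) (z w : Rd d × Rd d) : rot θ (z + w) = rot θ z + rot θ w := by
  simp only [rot, Prod.fst_add, Prod.snd_add]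
  ext1 <;> simp only [Prod.fst_add, Prod.snd_add] <;> module

theorem rot_smul (θ c : ℝ) (z : Rd d × Rd d) : rot θ (c • z) = c • rot θ z := by
  simp only [rot, Prod.smul_fst, Prod.smul_snd]
  ext1 <;> simp only [Prod.smul_fst, Prod.smul_snd] <;> module

/-- The rotation of phase space as a linear map of the Hilbert space `L²`-sum. -/
def rotLin (θ : ℝ) : WithLp 2 (Rd d × Rd d) →ₗᵢ[ℝ] WithLp 2 (Rd d × Rd d) where
  toFun z := WithLp.toLp 2 (rot θ (WithLp.ofLp z))
  map_add' z w := congrArg (WithLp.toLp 2) (rot_vec_add θ (WithLp.ofLp z) (WithLp.ofLp w))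
  map_smul' c z := congrArg (WithLp.toLp 2) (rot_smul θ c (WithLp.ofLp z))
  norm_map' z := by
    have h := norm_sq_rot θ (WithLp.ofLp z)
    have h1 := WithLp.prod_norm_sq_eq_of_L2 (WithLp.toLp 2 (rot θ (WithLp.ofLp z)))
    have h2 := WithLp.prod_norm_sq_eq_of_L2 z
    refine (pow_left_inj₀ (norm_nonneg _) (norm_nonneg _) two_ne_zero).1 ?_
    exact h1.trans (h.trans h2.symm)

/-- The product carries the maximum norm, for which `rot` is in general not isometric; it becomes a
linear isometry in the `L²` product, and the identification of the two preserves the measure. -/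
theorem measurePreserving_rot (θ : ℝ) :
    MeasurePreserving (rot (d := d) θ) volume volume := by
  have h := ((rotLin (d := d) θ).toLinearIsometryEquiv rfl).measurePreserving
  have h1 := WithLp.volume_preserving_ofLp (Rd d) (Rd d)
  have h2 := WithLp.volume_preserving_toLp (Rd d) (Rd d)
  exact h1.comp (h.comp h2)

variable {p : ℝ≥0∞} [Fact (1 ≤ p)]

/-- The propagator on the phase space side. -/
def evolve (p : ℝ≥0∞) [Fact (1 ≤ p)] (θ : ℝ) :
    Lp ℂ p (volume : Measure (Rd d × Rd d)) →L[ℂ] Lp ℂ p (volume : Measure (Rd d × Rd d)) :=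
  Complex.exp (-(Complex.I * ((d * θ : ℝ) : ℂ))) •
    (Lp.compMeasurePreservingₗᵢ ℂ (rot (-θ)) (measurePreserving_rot (-θ))).toContinuousLinearMap

theorem norm_evolve_factor (θ : ℝ) : ‖Complex.exp (-(Complex.I * ((d * θ : ℝ) : ℂ)))‖ = 1 := by
  rw [Complex.norm_exp]; simp

theorem coeFn_evolve (θ : ℝ) (G : Lp ℂ p (volume : Measure (Rd d × Rd d))) :
    evolve p θ G =ᵐ[volume] fun z =>
      Complex.exp (-(Complex.I * ((d * θ : ℝ) : ℂ))) * G (rot (-θ) z) := by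
  have h1 := Lp.coeFn_compMeasurePreserving G (measurePreserving_rot (d := d) (-θ))
  have h2 := Lp.coeFn_smul (Complex.exp (-(Complex.I * ((d * θ : ℝ) : ℂ))))
    (Lp.compMeasurePreserving (rot (-θ)) (measurePreserving_rot (-θ)) G)
  filter_upwards [h1, h2] with z h1 h2
  change (Complex.exp (-(Complex.I * ((d * θ : ℝ) : ℂ))) •
    (Lp.compMeasurePreserving (rot (-θ)) (measurePreserving_rot (-θ)) G)) z = _
  rw [h2, Pi.smul_apply, h1, smul_eq_mul, Function.comp_apply]

theorem norm_evolve (θ : ℝ) (G : Lp ℂ p (volume : Measure (Rd d × Rd d))) :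
    ‖evolve p θ G‖ = ‖G‖ := by
  change ‖Complex.exp (-(Complex.I * ((d * θ : ℝ) : ℂ))) •
    (Lp.compMeasurePreservingₗᵢ ℂ (rot (-θ)) (measurePreserving_rot (-θ))) G‖ = _
  rw [norm_smul, norm_evolve_factor, one_mul, LinearIsometry.norm_map]

/-- Only strong continuity is claimed, and it needs a finite exponent: rotations do not act strongly
continuously on `L^∞`. -/
theorem continuous_evolve (hp : p ≠ ∞) (G : Lp ℂ p (volume : Measure (Rd d × Rd d))) :
    Continuous fun θ => evolve p θ G := by
  let R : ℝ → C(Rd d × Rd d, Rd d × Rd d) := fun θ => ⟨rot (-θ), continuous_rot_const (-θ)⟩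
  have hu : Continuous (Function.uncurry fun θ z => R θ z) := by
    change Continuous fun q : ℝ × (Rd d × Rd d) => rot (-q.1) q.2
    unfold rot
    fun_prop
  have hc : Continuous R := ContinuousMap.continuous_of_continuous_uncurry R hu
  have h := Continuous.compMeasurePreservingLp (μ := volume) (ν := volume)
    (f := fun _ : ℝ => G) continuous_const hc (fun θ => measurePreserving_rot (-θ)) hp
  have h2 : Continuous fun θ : ℝ => Complex.exp (-(Complex.I * ((d * θ : ℝ) : ℂ))) := by fun_prop
  change Continuous fun θ : ℝ => Complex.exp (-(Complex.I * ((d * θ : ℝ) : ℂ))) •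
    Lp.compMeasurePreserving (rot (-θ)) (measurePreserving_rot (-θ)) G
  exact Continuous.smul h2 h

/-- The propagator `e^{-iθH}` on `L²`. -/
def prop (θ : ℝ) : Lp ℂ 2 (volume : Measure (Rd d)) →L[ℂ] Lp ℂ 2 (volume : Measure (Rd d)) :=
  (ContinuousLinearMap.adjoint gaborL2.toContinuousLinearMap) ∘L (evolve 2 θ) ∘L
    gaborL2.toContinuousLinearMap

/-- The adjoint in `prop` projects onto the range of the Gabor transform. Rotation invariance of the
kernel and of the measure shows that the rotated transform already lies in that range, so nothing is
lost. -/
theorem gabor_prop (θ : ℝ) (F : Lp ℂ 2 (volume : Measure (Rd d))) (z : Rd d × Rd d) :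
    gabor (prop θ F) z =
      Complex.exp (-(Complex.I * ((d * θ : ℝ) : ℂ))) * gabor F (rot (-θ) z) := by
  set e := Complex.exp (-(Complex.I * ((d * θ : ℝ) : ℂ))) with he
  have h1 : inner ℂ ((coherent z).toLp 2) (prop θ F) =
      inner ℂ (gaborL2 ((coherent z).toLp 2)) (evolve 2 θ (gaborL2 F)) :=
    ContinuousLinearMap.adjoint_inner_right gaborL2.toContinuousLinearMap _ _
  have h2 : inner ℂ (gaborL2 ((coherent z).toLp 2)) (evolve 2 θ (gaborL2 F)) =
      ∫ w, e * ((starRingEnd ℂ) (gabor (coherent (rot (-θ) z)) (rot (-θ) w)) *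
        gabor F (rot (-θ) w)) := by
    rw [L2.inner_def]
    refine integral_congr_ae ?_
    have h3 := (measurePreserving_rot (d := d) (-θ)).quasiMeasurePreserving.ae
      (coeFn_gaborL2 F)
    filter_upwards [coeFn_gaborL2 ((coherent z).toLp 2), coeFn_evolve θ (gaborL2 F), h3]
      with w a1 a2 a3
    rw [a1, a2, a3, gabor_toLp, RCLike.inner_apply, gabor_coherent_rot, ← he]
    ring
  have h4 : ∫ w, (starRingEnd ℂ) (gabor (coherent (rot (-θ) z)) (rot (-θ) w)) *
        gabor F (rot (-θ) w) =
      ∫ w, (starRingEnd ℂ) (gabor (coherent (rot (-θ) z)) w) * gabor F w := by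
    have hemb : MeasurableEmbedding (rot (d := d) (-θ)) :=
      (Homeomorph.mk ⟨rot (-θ), rot θ, fun z => by simp, fun z => by simp⟩
        (continuous_rot_const _) (continuous_rot_const _)).measurableEmbedding
    exact (measurePreserving_rot (d := d) (-θ)).integral_comp hemb
      (fun w => (starRingEnd ℂ) (gabor (coherent (rot (-θ) z)) w) * gabor F w)
  rw [gabor_eq_inner, gabor_eq_inner, h1, h2, integral_const_mul, h4, inner_eq_integral_gabor,
    gabor_toLp]
  ring

theorem gabor_ext {F H : Lp ℂ 2 (volume : Measure (Rd d))} (h : ∀ z, gabor F z = gabor H z) :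
    F = H :=
  gabor_injective (.of_forall h)

@[simp] theorem prop_zero (F : Lp ℂ 2 (volume : Measure (Rd d))) : prop 0 F = F :=
  gabor_ext fun z => by simp [gabor_prop]

theorem prop_add (a b : ℝ) (F : Lp ℂ 2 (volume : Measure (Rd d))) :
    prop (a + b) F = prop a (prop b F) := by
  refine gabor_ext fun z => ?_
  rw [gabor_prop, gabor_prop, gabor_prop, ← mul_assoc, ← Complex.exp_add, neg_add_rev, rot_add]
  congr 2
  push_cast
  ring

theorem prop_neg_prop (a : ℝ) (F : Lp ℂ 2 (volume : Measure (Rd d))) :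
    prop (-a) (prop a F) = F := by
  rw [← prop_add]; simp

theorem gaborL2_prop (θ : ℝ) (F : Lp ℂ 2 (volume : Measure (Rd d))) :
    gaborL2 (prop θ F) = evolve 2 θ (gaborL2 F) := by
  refine Lp.ext ?_
  have h3 := (measurePreserving_rot (d := d) (-θ)).quasiMeasurePreserving.ae (coeFn_gaborL2 F)
  filter_upwards [coeFn_gaborL2 (prop θ F), coeFn_evolve θ (gaborL2 F), h3] with w a1 a2 a3
  rw [a1, a2, a3, gabor_prop]

theorem norm_prop (θ : ℝ) (F : Lp ℂ 2 (volume : Measure (Rd d))) : ‖prop θ F‖ = ‖F‖ := by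
  rw [← gaborL2.norm_map, gaborL2_prop, norm_evolve, gaborL2.norm_map]

theorem inner_prop_prop (θ : ℝ) (F H : Lp ℂ 2 (volume : Measure (Rd d))) :
    inner ℂ (prop θ F) (prop θ H) = inner ℂ F H := by
  let L : Lp ℂ 2 (volume : Measure (Rd d)) →ₗᵢ[ℂ] Lp ℂ 2 (volume : Measure (Rd d)) :=
    ⟨(prop θ).toLinearMap, norm_prop θ⟩
  exact L.inner_map_map F H

theorem inner_prop_left (θ : ℝ) (F H : Lp ℂ 2 (volume : Measure (Rd d))) :
    inner ℂ (prop θ F) H = inner ℂ F (prop (-θ) H) := by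
  rw [← inner_prop_prop (-θ), prop_neg_prop]

theorem continuous_prop (F : Lp ℂ 2 (volume : Measure (Rd d))) :
    Continuous fun θ => prop θ F :=
  (ContinuousLinearMap.adjoint gaborL2.toContinuousLinearMap).continuous.comp
    (continuous_evolve (by norm_num) (gaborL2 F))

/-- Coherent states follow the classical trajectories. In particular they stay Schwartz functions,
which makes them usable as moving test functions for distributional solutions. -/
theorem prop_coherent (θ : ℝ) (z : Rd d × Rd d) : prop θ ((coherent z).toLp 2 volume) =
    Complex.exp (-(Complex.I * ((d * θ : ℝ) : ℂ))) • (coherent (rot θ z)).toLp 2 volume := by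
  refine gabor_ext fun w => ?_
  rw [gabor_prop, gabor_smul, Pi.smul_apply, smul_eq_mul, gabor_toLp, gabor_toLp,
    ← gabor_coherent_rot θ, rot_rot_neg]

/-! ### The harmonic oscillator as the generator of the propagator -/

open LineDeriv in
theorem lineDerivOp_conjS (m : Rd d) (φ : 𝓢(Rd d, ℂ)) :
    ∂_{m} (conjS φ) = conjS (∂_{m} φ) := by
  ext t
  rw [conjS_apply, SchwartzMap.lineDerivOp_apply_eq_fderiv, SchwartzMap.lineDerivOp_apply_eq_fderiv]
  have h : (conjS φ : Rd d → ℂ) = Complex.conjCLE ∘ φ := by ext s; simp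
  rw [h, ContinuousLinearEquiv.comp_fderiv]
  simp

theorem laplacian_conjS (φ : 𝓢(Rd d, ℂ)) : Δ (conjS φ) = conjS (Δ φ) := by
  rw [SchwartzMap.laplacian_eq_sum (EuclideanSpace.basisFun (Fin d) ℝ),
    SchwartzMap.laplacian_eq_sum (EuclideanSpace.basisFun (Fin d) ℝ)]
  simp only [lineDerivOp_conjS]
  ext t
  simp

/-- The harmonic oscillator on Schwartz functions. -/
def hermite (φ : 𝓢(Rd d, ℂ)) : 𝓢(Rd d, ℂ) :=
  -(Δ φ) + SchwartzMap.smulLeftCLM ℂ (fun x : Rd d => ((‖x‖ ^ 2 : ℝ) : ℂ)) φ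

theorem hermite_apply (φ : 𝓢(Rd d, ℂ)) (t : Rd d) :
    hermite φ t = -(Δ φ) t + ((‖t‖ ^ 2 : ℝ) : ℂ) * φ t := by
  rw [hermite, _root_.add_apply, normSq_smul_apply]
  rfl

theorem oscillator_eq_hermite (w : 𝓢'(Rd d, ℂ)) (φ : 𝓢(Rd d, ℂ)) :
    oscillator w φ = w (hermite φ) := oscillator_apply w φ

theorem hermite_conjS (φ : 𝓢(Rd d, ℂ)) : hermite (conjS φ) = conjS (hermite φ) := by
  ext t
  rw [conjS_apply, hermite_apply, hermite_apply, laplacian_conjS]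
  simp

theorem integrable_schwartz_mul (φ ψ : 𝓢(Rd d, ℂ)) : Integrable fun t => φ t * ψ t :=
  (φ.memLp 2 volume).integrable_mul (ψ.memLp 2 volume)

theorem integral_hermite_mul (φ ψ : 𝓢(Rd d, ℂ)) :
    ∫ t, hermite φ t * ψ t = ∫ t, φ t * hermite ψ t := by
  have h := SchwartzMap.integral_mul_laplacian_right_eq_left (μ := volume) φ ψ
  let Q := SchwartzMap.smulLeftCLM ℂ (fun x : Rd d => ((‖x‖ ^ 2 : ℝ) : ℂ)) φ
  have i1 := integrable_schwartz_mul (Δ φ) ψ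
  have i2 := integrable_schwartz_mul φ (Δ ψ)
  have i3 := integrable_schwartz_mul Q ψ
  simp only [Q, normSq_smul_apply] at i3
  have e1 : ∀ t, hermite φ t * ψ t = ((‖t‖ ^ 2 : ℝ) : ℂ) * φ t * ψ t - (Δ φ) t * ψ t := by
    intro t; rw [hermite_apply]; ring
  have e2 : ∀ t, φ t * hermite ψ t = ((‖t‖ ^ 2 : ℝ) : ℂ) * φ t * ψ t - φ t * (Δ ψ) t := by
    intro t; rw [hermite_apply]; ring
  simp only [e1, e2]
  rw [integral_sub i3 i1, integral_sub i3 i2, h]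

theorem hasLineDerivAt_coherent (z : Rd d × Rd d) (t m : Rd d) :
    HasLineDerivAt ℝ (coherent z)
      ((((inner ℝ (z.1 - t) m : ℝ) : ℂ) + Complex.I * ((inner ℝ z.2 m : ℝ) : ℂ)) * coherent z t)
      t m := by
  have h1 : ∀ s : ℝ, coherent z (t + s • m) = coherent z t *
      Complex.exp (((s * inner ℝ (z.1 - t) m - s ^ 2 * (‖m‖ ^ 2 / 2) : ℝ) : ℂ) +
        Complex.I * ((s * inner ℝ z.2 m : ℝ) : ℂ)) := by
    intro s
    rw [coherent_apply, coherent_apply, ← Complex.exp_add]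
    congr 1
    have e : ‖t + s • m - z.1‖ ^ 2 = ‖t - z.1‖ ^ 2 - 2 * (s * inner ℝ (z.1 - t) m) +
        s ^ 2 * ‖m‖ ^ 2 := by
      rw [show t + s • m - z.1 = (t - z.1) + s • m by abel, norm_add_sq_real, norm_smul, mul_pow,
        inner_smul_right, Real.norm_eq_abs, sq_abs, ← neg_sub z.1 t, inner_neg_left, norm_neg]
      ring
    rw [neg_div, e, inner_add_right, inner_smul_right]
    push_cast
    ring
  have h2 : HasDerivAt (fun s : ℝ => ((s * inner ℝ (z.1 - t) m - s ^ 2 * (‖m‖ ^ 2 / 2) : ℝ) : ℂ) +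
      Complex.I * ((s * inner ℝ z.2 m : ℝ) : ℂ))
      (((inner ℝ (z.1 - t) m : ℝ) : ℂ) + Complex.I * ((inner ℝ z.2 m : ℝ) : ℂ)) 0 := by
    have a1 : HasDerivAt (fun s : ℝ => s * inner ℝ (z.1 - t) m - s ^ 2 * (‖m‖ ^ 2 / 2))
        (inner ℝ (z.1 - t) m) 0 := by
      convert! ((hasDerivAt_id (0 : ℝ)).mul_const (inner ℝ (z.1 - t) m)).sub
        (((hasDerivAt_id (0 : ℝ)).pow 2).mul_const (‖m‖ ^ 2 / 2)) using 1
      simp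
    have a2 : HasDerivAt (fun s : ℝ => s * inner ℝ z.2 m) (inner ℝ z.2 m) 0 := by
      simpa using (hasDerivAt_id (0 : ℝ)).mul_const (inner ℝ z.2 m)
    exact a1.ofReal_comp.add (a2.ofReal_comp.const_mul Complex.I)
  have h3 := (h2.cexp).const_mul (coherent z t)
  have h4 := h3.congr_of_eventuallyEq (f₁ := fun s : ℝ => coherent z (t + s • m)) (.of_forall h1)
  unfold HasLineDerivAt
  convert! h4 using 1
  simp
  ring

open LineDeriv in
theorem lineDerivOp_coherent (z : Rd d × Rd d) (m t : Rd d) :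
    ∂_{m} (coherent z) t =
      (((inner ℝ (z.1 - t) m : ℝ) : ℂ) + Complex.I * ((inner ℝ z.2 m : ℝ) : ℂ)) *
        coherent z t := by
  rw [SchwartzMap.lineDerivOp_apply]
  exact (hasLineDerivAt_coherent z t m).lineDeriv

open LineDeriv in
theorem lineDerivOp_lineDerivOp_coherent (z : Rd d × Rd d) (m t : Rd d) :
    ∂_{m} (∂_{m} (coherent z)) t =
      ((((inner ℝ (z.1 - t) m : ℝ) : ℂ) + Complex.I * ((inner ℝ z.2 m : ℝ) : ℂ)) ^ 2 -
        ((‖m‖ ^ 2 : ℝ) : ℂ)) * coherent z t := by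
  rw [SchwartzMap.lineDerivOp_apply]
  refine HasLineDerivAt.lineDeriv ?_
  have h1 := hasLineDerivAt_coherent z t m
  change HasDerivAt (fun s : ℝ => coherent z (t + s • m)) _ 0 at h1
  have h2 : HasDerivAt (fun s : ℝ => ((inner ℝ (z.1 - (t + s • m)) m : ℝ) : ℂ) +
      Complex.I * ((inner ℝ z.2 m : ℝ) : ℂ)) ((-‖m‖ ^ 2 : ℝ) : ℂ) 0 := by
    refine HasDerivAt.add_const _ (HasDerivAt.ofReal_comp ?_)
    have e : ∀ s : ℝ, inner ℝ (z.1 - (t + s • m)) m = inner ℝ (z.1 - t) m - s * ‖m‖ ^ 2 := by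
      intro s
      rw [← sub_sub, inner_sub_left (z.1 - t), inner_smul_left, real_inner_self_eq_norm_sq]
      rfl
    simp only [e]
    simpa using ((hasDerivAt_id (0 : ℝ)).mul_const (‖m‖ ^ 2)).const_sub (inner ℝ (z.1 - t) m)
  have h4 := (h2.mul h1).congr_of_eventuallyEq (f₁ := fun s : ℝ => ∂_{m} (coherent z) (t + s • m))
    (.of_forall fun s => lineDerivOp_coherent z m _)
  unfold HasLineDerivAt
  convert! h4 using 1
  simp
  ring

/-- Summing second derivatives over an orthonormal basis turns the coordinate products into inner
products. The quadratic terms in `t` cancel against `|t|²`, so the multiplier is affine in `t`. -/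
theorem hermite_coherent (z : Rd d × Rd d) (t : Rd d) :
    hermite (coherent z) t = (((d + ‖t‖ ^ 2 - ‖t - z.1‖ ^ 2 + ‖z.2‖ ^ 2 : ℝ) : ℂ) +
      2 * Complex.I * ((inner ℝ (t - z.1) z.2 : ℝ) : ℂ)) * coherent z t := by
  let b := EuclideanSpace.basisFun (Fin d) ℝ
  have h1 := b.sum_inner_mul_inner (z.1 - t) (z.1 - t)
  have h2 := b.sum_inner_mul_inner z.2 z.2
  have h3 := b.sum_inner_mul_inner (z.1 - t) z.2
  simp only [real_inner_comm _ (b _)] at h1 h2 h3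
  rw [real_inner_self_eq_norm_sq] at h1 h2
  rw [hermite_apply, SchwartzMap.laplacian_eq_sum b, _root_.sum_apply]
  have h4 : ∑ i, (LineDeriv.lineDerivOp (b i) (LineDeriv.lineDerivOp (b i) (coherent z))) t =
      ((((∑ i, inner ℝ (z.1 - t) (b i) * inner ℝ (z.1 - t) (b i) : ℝ) : ℂ) -
        ((∑ i, inner ℝ z.2 (b i) * inner ℝ z.2 (b i) : ℝ) : ℂ) +
        2 * Complex.I * ((∑ i, inner ℝ (z.1 - t) (b i) * inner ℝ z.2 (b i) : ℝ) : ℂ)) - d) *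
        coherent z t := by
    simp only [lineDerivOp_lineDerivOp_coherent, b.norm_eq_one]
    rw [← Finset.sum_mul]
    congr 1
    simp only [add_sq, mul_pow, Complex.I_sq, Finset.sum_sub_distrib, Finset.sum_add_distrib]
    push_cast
    simp only [Finset.mul_sum, Finset.sum_const, Finset.card_univ, Fintype.card_fin, ← sub_eq_add_neg,
      neg_mul, one_mul, Finset.sum_neg_distrib, one_pow, nsmul_eq_mul, mul_one]
    have : ∀ i, 2 * Complex.I * (((inner ℝ (z.1 - t) (b i) : ℝ) : ℂ) * ((inner ℝ z.2 (b i) : ℝ) : ℂ)) =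
      2 * ((inner ℝ (z.1 - t) (b i) : ℝ) : ℂ) * (Complex.I * ((inner ℝ z.2 (b i) : ℝ) : ℂ)) := by
      intro i; ring
    simp only [this, ← pow_two]
    ring
  rw [h4, h1, h2, h3, ← neg_sub t z.1, norm_neg, inner_neg_left]
  push_cast
  ring

/-- The coherent state `e^{-idθ} ρ_{R_θ z}` satisfies the Schrödinger equation pointwise. -/
theorem hasDerivAt_coherent_rot (z : Rd d × Rd d) (t : Rd d) (θ : ℝ) :
    HasDerivAt (fun θ : ℝ => Complex.exp (-(Complex.I * ((d * θ : ℝ) : ℂ))) *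
        coherent (rot θ z) t)
      (-Complex.I * (Complex.exp (-(Complex.I * ((d * θ : ℝ) : ℂ))) *
        hermite (coherent (rot θ z)) t)) θ := by
  -- Hamilton's equations `x' = 2y`, `y' = -2x` for the Hamiltonian `|x|² + |y|²`.
  have hx : HasDerivAt (fun θ : ℝ => (rot θ z).1) ((2 : ℝ) • (rot θ z).2) θ := by
    have c := ((hasDerivAt_id θ).const_mul 2).cos.smul_const z.1
    have s := ((hasDerivAt_id θ).const_mul 2).sin.smul_const z.2
    convert! c.add s using 1
    simp only [rot, id]; module
  have hy : HasDerivAt (fun θ : ℝ => (rot θ z).2) (-(2 : ℝ) • (rot θ z).1) θ := by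
    have c := ((hasDerivAt_id θ).const_mul 2).cos.smul_const z.2
    have s := ((hasDerivAt_id θ).const_mul 2).sin.smul_const z.1
    convert! c.sub s using 1
    simp only [rot, id]; module
  have h1 : HasDerivAt (fun θ : ℝ => inner ℝ (rot θ z).2 t - inner ℝ (rot θ z).1 (rot θ z).2 / 2)
      (-2 * inner ℝ (rot θ z).1 t - (‖(rot θ z).2‖ ^ 2 - ‖(rot θ z).1‖ ^ 2)) θ := by
    have a := hy.inner ℝ (hasDerivAt_const θ t)
    have b := (hx.inner ℝ hy).div_const 2
    convert! a.sub b using 1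
    simp only [inner_smul_left, inner_smul_right, inner_zero_right, conj_trivial,
      real_inner_self_eq_norm_sq]
    ring
  have h2 : HasDerivAt (fun θ : ℝ => -‖t - (rot θ z).1‖ ^ 2 / 2)
      (2 * inner ℝ (t - (rot θ z).1) (rot θ z).2) θ := by
    have a := ((hx.const_sub t).norm_sq.fun_neg.div_const 2)
    convert! a using 1
    simp only [inner_neg_right, inner_smul_right]
    ring
  have h0 : HasDerivAt (fun θ : ℝ => (d * θ : ℝ)) d θ := by
    simpa using (hasDerivAt_id θ).const_mul (d : ℝ)
  have h3 := (((h0.ofReal_comp.const_mul Complex.I).fun_neg).add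
    ((h1.ofReal_comp.const_mul Complex.I).add h2.ofReal_comp)).cexp
  have e : ∀ θ : ℝ, Complex.exp (-(Complex.I * ((d * θ : ℝ) : ℂ))) * coherent (rot θ z) t =
      Complex.exp (-(Complex.I * ((d * θ : ℝ) : ℂ)) + (Complex.I *
        ((inner ℝ (rot θ z).2 t - inner ℝ (rot θ z).1 (rot θ z).2 / 2 : ℝ) : ℂ) +
        ((-‖t - (rot θ z).1‖ ^ 2 / 2 : ℝ) : ℂ))) := by
    intro θ; rw [coherent_apply, ← Complex.exp_add]
  rw [hermite_coherent]
  simp only [e]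
  convert! h3 using 1
  simp only [Pi.add_apply]
  rw [← e θ]
  have e3 : ‖t - (rot θ z).1‖ ^ 2 = ‖t‖ ^ 2 - 2 * inner ℝ (rot θ z).1 t + ‖(rot θ z).1‖ ^ 2 := by
    rw [norm_sub_sq_real, real_inner_comm]
  have e4 := congrArg (fun a : ℝ => (a : ℂ)) e3
  push_cast at e4 ⊢
  linear_combination (Complex.I * (Complex.exp (-(Complex.I * (d * θ))) * coherent (rot θ z) t)) * e4
    - 2 * (Complex.exp (-(Complex.I * (d * θ))) * coherent (rot θ z) t) *
      ((inner ℝ (t - (rot θ z).1) (rot θ z).2 : ℝ) : ℂ) * Complex.I_sq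

theorem norm_rot_fst_le (θ : ℝ) (z : Rd d × Rd d) : ‖(rot θ z).1‖ ≤ ‖z.1‖ + ‖z.2‖ := by
  refine (norm_add_le _ _).trans ?_
  rw [norm_smul, norm_smul]
  have h1 := Real.abs_cos_le_one (2 * θ)
  have h2 := Real.abs_sin_le_one (2 * θ)
  exact add_le_add (mul_le_of_le_one_left (norm_nonneg _) h1)
    (mul_le_of_le_one_left (norm_nonneg _) h2)

theorem norm_rot_snd_le (θ : ℝ) (z : Rd d × Rd d) : ‖(rot θ z).2‖ ≤ ‖z.1‖ + ‖z.2‖ := by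
  refine (norm_sub_le _ _).trans ?_
  rw [norm_smul, norm_smul, add_comm]
  have h1 := Real.abs_cos_le_one (2 * θ)
  have h2 := Real.abs_sin_le_one (2 * θ)
  exact add_le_add (mul_le_of_le_one_left (norm_nonneg _) h2)
    (mul_le_of_le_one_left (norm_nonneg _) h1)

/-- A bound through the size `r` of the centre only, hence uniform along a rotation orbit: the
dominating function for differentiation under the integral. -/
theorem norm_hermite_coherent_le (z : Rd d × Rd d) (r : ℝ) (h1 : ‖z.1‖ ≤ r) (h2 : ‖z.2‖ ≤ r)
    (t : Rd d) : ‖hermite (coherent z) t‖ ≤ (d + 5) * (1 + r) ^ 2 * (1 + ‖t‖) ^ 2 := by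
  have hr : 0 ≤ r := (norm_nonneg _).trans h1
  have hT := norm_nonneg t
  have h3 : ‖t - z.1‖ ≤ ‖t‖ + r := (norm_sub_le _ _).trans (by linarith)
  have h4 : ‖coherent z t‖ ≤ 1 := by
    rw [norm_coherent_apply, Real.exp_le_one_iff]
    have := sq_nonneg ‖t - z.1‖
    linarith
  rw [hermite_coherent, norm_mul]
  have h5 : ‖(((d + ‖t‖ ^ 2 - ‖t - z.1‖ ^ 2 + ‖z.2‖ ^ 2 : ℝ) : ℂ) +
      2 * Complex.I * ((inner ℝ (t - z.1) z.2 : ℝ) : ℂ))‖ ≤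
      (d + ‖t‖ ^ 2 + (‖t‖ + r) ^ 2 + r ^ 2) + 2 * ((‖t‖ + r) * r) := by
    refine (norm_add_le _ _).trans (add_le_add ?_ ?_)
    · rw [Complex.norm_real, Real.norm_eq_abs, abs_le]
      have a1 : ‖t - z.1‖ ^ 2 ≤ (‖t‖ + r) ^ 2 := by gcongr
      have a2 : ‖z.2‖ ^ 2 ≤ r ^ 2 := by gcongr
      constructor <;> nlinarith [sq_nonneg ‖t - z.1‖, sq_nonneg ‖z.2‖, sq_nonneg ‖t‖,
        Nat.cast_nonneg (α := ℝ) d]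
    · rw [norm_mul, norm_mul, Complex.norm_I, Complex.norm_real, Complex.norm_two, mul_one]
      gcongr
      exact (abs_real_inner_le_norm _ _).trans (by gcongr)
  refine (mul_le_of_le_one_right (norm_nonneg _) h4).trans (h5.trans ?_)
  have b0 : (1 : ℝ) ≤ (1 + r) ^ 2 * (1 + ‖t‖) ^ 2 :=
    one_le_mul_of_one_le_of_one_le (one_le_pow₀ (by linarith)) (one_le_pow₀ (by linarith))
  have b1 : (d : ℝ) ≤ d * ((1 + r) ^ 2 * (1 + ‖t‖) ^ 2) :=
    le_mul_of_one_le_right (Nat.cast_nonneg d) b0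
  have c1 : ‖t‖ ≤ (1 + r) * (1 + ‖t‖) := by nlinarith
  have c2 : ‖t‖ + r ≤ (1 + r) * (1 + ‖t‖) := by nlinarith
  have c3 : r ≤ (1 + r) * (1 + ‖t‖) := by nlinarith
  have b2 : ‖t‖ ^ 2 ≤ ((1 + r) * (1 + ‖t‖)) ^ 2 := by gcongr
  have b3 : (‖t‖ + r) ^ 2 ≤ ((1 + r) * (1 + ‖t‖)) ^ 2 := by gcongr
  have b4 : r ^ 2 ≤ ((1 + r) * (1 + ‖t‖)) ^ 2 := by gcongr
  have b5 : (‖t‖ + r) * r ≤ ((1 + r) * (1 + ‖t‖)) * ((1 + r) * (1 + ‖t‖)) := by gcongr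
  linarith

theorem hasDerivAt_integral_conj_coherent_mul (z : Rd d × Rd d) (φ : 𝓢(Rd d, ℂ)) (θ : ℝ) :
    HasDerivAt (fun θ : ℝ => ∫ t, (starRingEnd ℂ) (Complex.exp (-(Complex.I * ((d * θ : ℝ) : ℂ))) *
        coherent (rot θ z) t) * φ t)
      (∫ t, (starRingEnd ℂ) (-Complex.I * (Complex.exp (-(Complex.I * ((d * θ : ℝ) : ℂ))) *
        hermite (coherent (rot θ z)) t)) * φ t) θ := by
  refine (hasDerivAt_integral_of_dominated_loc_of_deriv_le (𝕜 := ℝ) (μ := volume) (s := univ)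
    (F := fun θ t => (starRingEnd ℂ) (Complex.exp (-(Complex.I * ((d * θ : ℝ) : ℂ))) *
        coherent (rot θ z) t) * φ t)
    (F' := fun θ t => (starRingEnd ℂ) (-Complex.I * (Complex.exp (-(Complex.I * ((d * θ : ℝ) : ℂ))) *
        hermite (coherent (rot θ z)) t)) * φ t)
    (bound := fun t => (d + 5) * (1 + (‖z.1‖ + ‖z.2‖)) ^ 2 * ((1 + ‖t‖) ^ 2 * ‖φ t‖)) univ_mem
    (.of_forall fun θ => ?_) ?_ ?_ (.of_forall fun t θ _ => ?_) ?_ (.of_forall fun t θ _ => ?_)).2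
  · exact (by fun_prop : Continuous fun t => (starRingEnd ℂ) (Complex.exp
      (-(Complex.I * ((d * θ : ℝ) : ℂ))) * coherent (rot θ z) t) * φ t).aestronglyMeasurable
  · simp only [map_mul, mul_assoc]
    refine Integrable.const_mul ?_ _
    simpa using integrable_schwartz_mul (conjS (coherent (rot θ z))) φ
  · exact (by fun_prop : Continuous fun t => (starRingEnd ℂ) (-Complex.I * (Complex.exp
      (-(Complex.I * ((d * θ : ℝ) : ℂ))) * hermite (coherent (rot θ z)) t)) * φ t).aestronglyMeasurable
  · rw [norm_mul, RCLike.norm_conj, norm_mul, norm_mul, norm_neg, Complex.norm_I,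
      norm_evolve_factor, one_mul, one_mul, ← mul_assoc]
    exact mul_le_mul_of_nonneg_right (norm_hermite_coherent_le _ _ (norm_rot_fst_le θ z)
      (norm_rot_snd_le θ z) t) (norm_nonneg _)
  · exact (integrable_weight_mul φ 2).const_mul _
  · exact ((Complex.conjCLE : ℂ →L[ℝ] ℂ).hasFDerivAt.comp_hasDerivAt θ
      (hasDerivAt_coherent_rot z t θ)).mul_const (φ t)

theorem inner_coherent_prop (z : Rd d × Rd d) (φ : 𝓢(Rd d, ℂ)) (θ : ℝ) :
    inner ℂ ((coherent z).toLp 2 volume) (prop θ (φ.toLp 2 volume)) =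
      ∫ t, (starRingEnd ℂ) (Complex.exp (-(Complex.I * ((d * (-θ) : ℝ) : ℂ))) *
        coherent (rot (-θ) z) t) * φ t := by
  have h := inner_prop_left (-θ) ((coherent z).toLp 2 volume) (φ.toLp 2 volume)
  rw [neg_neg] at h
  rw [← h, prop_coherent, inner_smul_left, inner_toLp_eq, ← integral_const_mul]
  refine integral_congr_ae ?_
  filter_upwards [φ.coeFn_toLp 2 volume] with t ht
  rw [ht, map_mul, mul_assoc]

/-- The propagator is moved to the coherent state, whose evolution is explicit; after
differentiating, symmetry of the oscillator returns it to `φ`. -/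
theorem hasDerivAt_inner_coherent_prop (z : Rd d × Rd d) (φ : 𝓢(Rd d, ℂ)) (θ : ℝ) :
    HasDerivAt (fun θ => inner ℂ ((coherent z).toLp 2 volume) (prop θ (φ.toLp 2 volume)))
      (inner ℂ ((coherent z).toLp 2 volume)
        (prop θ (-Complex.I • (hermite φ).toLp 2 volume))) θ := by
  simp only [inner_coherent_prop]
  have h := (hasDerivAt_integral_conj_coherent_mul z φ (-θ)).scomp θ (hasDerivAt_neg θ)
  convert! h using 1
  rw [map_smul, inner_smul_right, inner_coherent_prop, neg_smul, one_smul, ← integral_const_mul,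
    ← integral_neg]
  have h2 := integral_hermite_mul (conjS (coherent (rot (-θ) z))) φ
  rw [hermite_conjS] at h2
  simp only [conjS_apply] at h2
  simp only [map_mul, mul_assoc, map_neg, Complex.conj_I]
  simp only [neg_neg, neg_mul, integral_neg, integral_const_mul, h2]

/-- Schwartz functions are in the domain of the generator of the propagator. -/
theorem hasDerivAt_prop (φ : 𝓢(Rd d, ℂ)) (θ : ℝ) :
    HasDerivAt (fun θ => prop θ (φ.toLp 2 volume))
      (prop θ (-Complex.I • (hermite φ).toLp 2 volume)) θ := by
  set H := -Complex.I • (hermite φ).toLp 2 volume with hH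
  have hc : Continuous fun s => prop s H := continuous_prop H
  have hd : HasDerivAt (fun θ => φ.toLp 2 volume + ∫ s in (0 : ℝ)..θ, prop s H) (prop θ H) θ :=
    (intervalIntegral.integral_hasDerivAt_right (hc.intervalIntegrable _ _)
      (hc.stronglyMeasurableAtFilter _ _) hc.continuousAt).const_add _
  -- Against each coherent state this is the scalar fundamental theorem of calculus, and coherent
  -- states separate the points of `L²`. The integral form upgrades weak to norm differentiability.
  have he : ∀ θ, prop θ (φ.toLp 2 volume) =
      φ.toLp 2 volume + ∫ s in (0 : ℝ)..θ, prop s H := by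
    intro θ
    refine gabor_ext fun z => ?_
    rw [gabor_eq_inner, gabor_eq_inner, inner_add_right]
    congr 1
    have h1 := ContinuousLinearMap.intervalIntegral_comp_comm
      (innerSL ℂ ((coherent z).toLp 2 volume)) (hc.intervalIntegrable (μ := volume) 0 θ)
    simp only [innerSL_apply_apply] at h1
    rw [← h1, intervalIntegral.integral_eq_sub_of_hasDerivAt
      (fun s _ => hasDerivAt_inner_coherent_prop z φ s)
      ((continuous_const.inner hc).intervalIntegrable _ _), prop_zero]
    ring
  exact hd.congr_of_eventuallyEq (.of_forall he)

/-! ### Integral inequalities -/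

section Inequalities

variable {α β : Type*} [MeasurableSpace α] [MeasurableSpace β]

/-- Jensen's inequality for a weight. -/
theorem lintegral_mul_rpow_le {μ : Measure α} {s : ℝ} (hs : 1 ≤ s) {a G : α → ℝ≥0∞}
    (ha : AEMeasurable a μ) (hG : AEMeasurable G μ) :
    (∫⁻ w, a w * G w ∂μ) ^ s ≤ (∫⁻ w, a w ∂μ) ^ (s - 1) * ∫⁻ w, a w * G w ^ s ∂μ := by
  rcases hs.eq_or_lt with rfl | hs
  · simp
  have hs0 : 0 < s := by linarith
  have hc := (Real.HolderConjugate.conjExponent hs).symm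
  set q := s.conjExponent
  have hq : 0 < q := hc.pos
  have h1 : 1 / q + 1 / s = 1 := by rw [one_div, one_div]; exact hc.inv_add_inv_eq_one
  -- Hölder's inequality for the splitting `a G = a^{1/q} · (a^{1/s} G)`, with `q` conjugate to `s`.
  have h := ENNReal.lintegral_mul_le_Lp_mul_Lq μ hc (f := fun w => a w ^ (1 / q))
    (g := fun w => a w ^ (1 / s) * G w) (ha.pow_const _) ((ha.pow_const _).mul hG)
  have e1 : ∀ w, ((fun w => a w ^ (1 / q)) * fun w => a w ^ (1 / s) * G w) w = a w * G w := by
    intro w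
    rw [Pi.mul_apply, ← mul_assoc, ← ENNReal.rpow_add_of_nonneg _ _ (by positivity) (by positivity),
      h1, ENNReal.rpow_one]
  have e2 : ∀ w, (a w ^ (1 / q)) ^ q = a w := by
    intro w; rw [← ENNReal.rpow_mul, one_div_mul_cancel hq.ne', ENNReal.rpow_one]
  have e3 : ∀ w, (a w ^ (1 / s) * G w) ^ s = a w * G w ^ s := by
    intro w
    rw [ENNReal.mul_rpow_of_nonneg _ _ hs0.le, ← ENNReal.rpow_mul, one_div_mul_cancel hs0.ne',
      ENNReal.rpow_one]
  simp only [e1, e2, e3] at h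
  calc _ ≤ ((∫⁻ w, a w ∂μ) ^ (1 / q) * (∫⁻ w, a w * G w ^ s ∂μ) ^ (1 / s)) ^ s := by gcongr
    _ = _ := by
      rw [ENNReal.mul_rpow_of_nonneg _ _ hs0.le, ← ENNReal.rpow_mul, ← ENNReal.rpow_mul,
        one_div_mul_cancel hs0.ne', ENNReal.rpow_one]
      congr 2
      have : 1 / q = 1 - 1 / s := by linarith
      rw [this]; field_simp

/-- Schur's test. -/
theorem lintegral_kernel_rpow_le {μ : Measure α} {ν : Measure β} [SFinite μ] [SFinite ν] {s : ℝ}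
    (hs : 1 ≤ s) {A : α → β → ℝ≥0∞} {G : β → ℝ≥0∞} (hA : Measurable (Function.uncurry A))
    (hG : Measurable G) {C₁ C₂ : ℝ≥0∞} (h₁ : ∀ z, ∫⁻ w, A z w ∂ν ≤ C₁)
    (h₂ : ∀ w, ∫⁻ z, A z w ∂μ ≤ C₂) :
    ∫⁻ z, (∫⁻ w, A z w * G w ∂ν) ^ s ∂μ ≤ C₁ ^ (s - 1) * C₂ * ∫⁻ w, G w ^ s ∂ν := by
  have hA₁ : ∀ z, Measurable (A z) := fun z => hA.comp measurable_prodMk_left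
  have hA₂ : ∀ w, Measurable fun z => A z w := fun w => hA.comp measurable_prodMk_right
  have hm : Measurable fun q : α × β => A q.1 q.2 * G q.2 ^ s :=
    hA.mul ((hG.comp measurable_snd).pow_const _)
  calc _ ≤ ∫⁻ z, C₁ ^ (s - 1) * ∫⁻ w, A z w * G w ^ s ∂ν ∂μ := by
        refine lintegral_mono fun z => (lintegral_mul_rpow_le hs
          (hA₁ z).aemeasurable hG.aemeasurable).trans ?_
        exact mul_le_mul_left (ENNReal.rpow_le_rpow (h₁ z) (by linarith)) _
    _ = C₁ ^ (s - 1) * ∫⁻ w, ∫⁻ z, A z w * G w ^ s ∂μ ∂ν := by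
        rw [lintegral_const_mul _ hm.lintegral_prod_right, lintegral_lintegral_swap hm.aemeasurable]
    _ ≤ C₁ ^ (s - 1) * ∫⁻ w, C₂ * G w ^ s ∂ν := by
        gcongr with w
        rw [lintegral_mul_const _ (hA₂ w)]
        gcongr
        exact h₂ w
    _ = _ := by rw [lintegral_const_mul _ (hG.pow_const _), mul_assoc]

/-- Minkowski's inequality for an average over a family of measure preserving maps. -/
theorem lintegral_average_rpow_le {μ : Measure α} {ν : Measure β} [SFinite μ] [SFinite ν] {s : ℝ}
    (hs : 1 ≤ s) {a : β → ℝ≥0∞} {G : α → ℝ≥0∞} {T : β → α → α} (ha : AEMeasurable a ν)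
    (hG : Measurable G) (hT : Measurable (Function.uncurry T))
    (hp : ∀ w, MeasurePreserving (T w) μ μ) :
    ∫⁻ z, (∫⁻ w, a w * G (T w z) ∂ν) ^ s ∂μ ≤ (∫⁻ w, a w ∂ν) ^ s * ∫⁻ z, G z ^ s ∂μ := by
  have hGT : Measurable fun q : α × β => G (T q.2 q.1) := hG.comp (hT.comp measurable_swap)
  have hm : AEMeasurable (fun q : α × β => a q.2 * G (T q.2 q.1) ^ s) (μ.prod ν) :=
    (ha.comp_quasiMeasurePreserving Measure.quasiMeasurePreserving_snd).mul
      (hGT.pow_const _).aemeasurable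
  calc _ ≤ ∫⁻ z, (∫⁻ w, a w ∂ν) ^ (s - 1) * ∫⁻ w, a w * G (T w z) ^ s ∂ν ∂μ :=
        lintegral_mono fun z => lintegral_mul_rpow_le hs ha
          (hGT.comp measurable_prodMk_left).aemeasurable
    _ = (∫⁻ w, a w ∂ν) ^ (s - 1) * ∫⁻ w, ∫⁻ z, a w * G (T w z) ^ s ∂μ ∂ν := by
        rw [lintegral_const_mul'' _ hm.lintegral_prod_right', lintegral_lintegral_swap hm]
    _ = (∫⁻ w, a w ∂ν) ^ (s - 1) * ((∫⁻ w, a w ∂ν) * ∫⁻ z, G z ^ s ∂μ) := by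
        rw [← lintegral_mul_const'' _ ha]
        congr 1
        refine lintegral_congr fun w => ?_
        have hw : Measurable fun z => G (T w z) := hG.comp (hp w).measurable
        rw [lintegral_const_mul _ (hw.pow_const _), (hp w).lintegral_comp (hG.pow_const s)]
    _ = _ := by
        rw [← mul_assoc]
        congr 1
        nth_rewrite 2 [← ENNReal.rpow_one (∫⁻ w, a w ∂ν)]
        rw [← ENNReal.rpow_add_of_nonneg _ _ (by linarith) zero_le_one]
        congr 1
        ring

/-- The trilinear form of Young's inequality: `κ` defines a bounded form on `L^s × L^s`. -/
def YoungBound (κ : Rd d → ℝ≥0∞) (s : ℝ) (C : ℝ≥0∞) : Prop :=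
  ∀ a b : Rd d → ℝ≥0∞, Measurable a → Measurable b →
    ∫⁻ ξ, κ ξ * ∫⁻ y, b y * a (y + (2 * Real.pi) • ξ) ≤
      C * (∫⁻ y, a y ^ s) ^ (1 / s) * (∫⁻ y, b y ^ s) ^ (1 / s)

theorem lintegral_comp_add_smul (a : Rd d → ℝ≥0∞) (y : Rd d) :
    ∫⁻ ξ, a (y + (2 * Real.pi) • ξ) = ENNReal.ofReal ((2 * Real.pi) ^ d)⁻¹ * ∫⁻ ξ, a ξ := by
  have hpi := Real.pi_pos
  have hm : Measurable fun ξ : Rd d => (2 * Real.pi) • ξ := by fun_prop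
  calc _ = ∫⁻ ξ, a (y + ξ) ∂(Measure.map (fun ξ : Rd d => (2 * Real.pi) • ξ) volume) :=
        ((Homeomorph.smulOfNeZero (2 * Real.pi) (by positivity)).measurableEmbedding.lintegral_map
          (fun ξ => a (y + ξ))).symm
    _ = _ := by
        rw [Measure.map_addHaar_smul _ (by positivity), lintegral_smul_measure,
          lintegral_add_left_eq_self, abs_of_pos (by positivity), finrank_euclideanSpace_fin,
          smul_eq_mul]

/-- The endpoint `q = ∞`: the kernel is replaced by its bound, and Tonelli's theorem factors the
rest. -/
theorem youngBound_one {κ : Rd d → ℝ≥0∞} {M : ℝ≥0∞} (hκ : ∀ᵐ ξ, κ ξ ≤ M) :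
    YoungBound κ 1 (M * ENNReal.ofReal ((2 * Real.pi) ^ d)⁻¹) := by
  intro a b ha hb
  have hm : Measurable fun q : Rd d × Rd d => b q.2 * a (q.2 + (2 * Real.pi) • q.1) := by fun_prop
  simp only [ENNReal.rpow_one, div_one]
  calc _ ≤ ∫⁻ ξ, M * ∫⁻ y, b y * a (y + (2 * Real.pi) • ξ) := by
        refine lintegral_mono_ae ?_
        filter_upwards [hκ] with ξ h
        gcongr
    _ = M * ∫⁻ y, ∫⁻ ξ, b y * a (y + (2 * Real.pi) • ξ) := by
        rw [lintegral_const_mul _ hm.lintegral_prod_right', lintegral_lintegral_swap hm.aemeasurable]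
    _ = _ := by
        have : ∀ y, ∫⁻ ξ, b y * a (y + (2 * Real.pi) • ξ) =
            b y * (ENNReal.ofReal ((2 * Real.pi) ^ d)⁻¹ * ∫⁻ ξ, a ξ) := by
          intro y
          rw [lintegral_const_mul _ (by fun_prop), lintegral_comp_add_smul]
        simp only [this]
        rw [lintegral_mul_const _ hb]
        ring

/-- Hölder's inequality for the three functions `κ^q b^s`, `κ^q a^s`, `b^s a^s` with exponents
`1/(2q)`, `1/(2q)`, `1 - 1/q`, whose sum is `1`. As `1/s = 1/(2q) + (1 - 1/q)`, their weighted
product is the integrand, and the integral of each function factors by translation invariance. -/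
theorem youngBound_of_lintegral_rpow {κ : Rd d → ℝ≥0∞} (hκ : AEMeasurable κ) {q s : ℝ} (hq : 1 < q)
    (hs : 2 / s = 2 - 1 / q) : 
    YoungBound κ s (ENNReal.ofReal ((2 * Real.pi) ^ d)⁻¹ ^ (1 - 1 / q) *
      (∫⁻ ξ, κ ξ ^ q) ^ (1 / q)) := by
  intro a b ha hb
  set c := ENNReal.ofReal ((2 * Real.pi) ^ d)⁻¹
  have hq0 : 0 < q := by linarith
  have hq1 : 0 < 1 - 1 / q := by
    rw [sub_pos, div_lt_one hq0]; exact hq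
  have hs0 : 0 < s := by
    have : 0 < 2 / s := by rw [hs]; linarith
    exact (div_pos_iff_of_pos_left two_pos).1 this
  have hse : 1 / s = 1 / (2 * q) + (1 - 1 / q) := by
    have e : 1 / s = (2 / s) / 2 := by ring
    rw [e, hs]; field_simp; ring
  have hs1 : s * (1 / (2 * q) + (1 - 1 / q)) = 1 := by rw [← hse]; field_simp
  let f : Fin 3 → Rd d × Rd d → ℝ≥0∞ := ![fun z => κ z.1 ^ q * b z.2 ^ s,
    fun z => κ z.1 ^ q * a (z.2 + (2 * Real.pi) • z.1) ^ s,
    fun z => b z.2 ^ s * a (z.2 + (2 * Real.pi) • z.1) ^ s]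
  let e : Fin 3 → ℝ := ![1 / (2 * q), 1 / (2 * q), 1 - 1 / q]
  have hκ1 : AEMeasurable (fun z : Rd d × Rd d => κ z.1) :=
    hκ.comp_quasiMeasurePreserving Measure.quasiMeasurePreserving_fst
  have ha1 : Measurable fun z : Rd d × Rd d => a (z.2 + (2 * Real.pi) • z.1) := by fun_prop
  have hb1 : Measurable fun z : Rd d × Rd d => b z.2 := by fun_prop
  have hf0 : AEMeasurable (f 0) := (hκ1.pow_const q).mul (hb1.pow_const s).aemeasurable
  have hf1 : AEMeasurable (f 1) := (hκ1.pow_const q).mul (ha1.pow_const s).aemeasurable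
  have hf2 : AEMeasurable (f 2) := ((hb1.pow_const s).mul (ha1.pow_const s)).aemeasurable
  have h := ENNReal.lintegral_prod_norm_pow_le (μ := (volume : Measure (Rd d × Rd d)))
    Finset.univ (f := f) (fun i _ => by fin_cases i <;> assumption) (p := e)
    (by simp only [e, Fin.sum_univ_three, Matrix.cons_val]; field_simp; ring)
    (fun i _ => by
      fin_cases i
      · change 0 ≤ 1 / (2 * q); positivity
      · change 0 ≤ 1 / (2 * q); positivity
      · exact hq1.le)
  simp only [Fin.prod_univ_three] at h
  have split : ∀ x : ℝ≥0∞, x = (x ^ s) ^ (1 / (2 * q)) * (x ^ s) ^ (1 - 1 / q) := by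
    intro x
    rw [← ENNReal.rpow_mul, ← ENNReal.rpow_mul,
      ← ENNReal.rpow_add_of_nonneg _ _ (by positivity) (by positivity), ← mul_add, hs1,
      ENNReal.rpow_one]
  have splitκ : ∀ x : ℝ≥0∞, x = (x ^ q) ^ (1 / (2 * q)) * (x ^ q) ^ (1 / (2 * q)) := by
    intro x
    rw [← ENNReal.rpow_mul, ← ENNReal.rpow_add_of_nonneg _ _ (by positivity) (by positivity)]
    nth_rewrite 1 [← ENNReal.rpow_one x]
    congr 1
    field_simp; ring
  have hpt : ∀ z : Rd d × Rd d, f 0 z ^ e 0 * f 1 z ^ e 1 * f 2 z ^ e 2 =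
      κ z.1 * (b z.2 * a (z.2 + (2 * Real.pi) • z.1)) := by
    intro z
    change (κ z.1 ^ q * b z.2 ^ s) ^ (1 / (2 * q)) *
      (κ z.1 ^ q * a (z.2 + (2 * Real.pi) • z.1) ^ s) ^ (1 / (2 * q)) *
      (b z.2 ^ s * a (z.2 + (2 * Real.pi) • z.1) ^ s) ^ (1 - 1 / q) = _
    rw [ENNReal.mul_rpow_of_nonneg _ _ (by positivity),
      ENNReal.mul_rpow_of_nonneg _ _ (by positivity),
      ENNReal.mul_rpow_of_nonneg _ _ hq1.le]
    conv_rhs => rw [splitκ (κ z.1), split (b z.2), split (a (z.2 + (2 * Real.pi) • z.1))]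
    ring
  have i0 : ∫⁻ z, f 0 z = (∫⁻ ξ, κ ξ ^ q) * ∫⁻ y, b y ^ s :=
    lintegral_prod_mul (hκ.pow_const q) (hb.pow_const s).aemeasurable
  have i1 : ∫⁻ z, f 1 z = (∫⁻ ξ, κ ξ ^ q) * ∫⁻ y, a y ^ s := by
    rw [Measure.volume_eq_prod, lintegral_prod _ hf1, ← lintegral_mul_const'' _ (hκ.pow_const q)]
    refine lintegral_congr fun ξ => ?_
    change ∫⁻ y, κ ξ ^ q * a (y + (2 * Real.pi) • ξ) ^ s = _
    rw [lintegral_const_mul _ (by fun_prop), lintegral_add_right_eq_self fun y => a y ^ s]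
  have i2 : ∫⁻ z, f 2 z = (∫⁻ y, b y ^ s) * (c * ∫⁻ y, a y ^ s) := by
    rw [Measure.volume_eq_prod, lintegral_prod_symm _ hf2, ← lintegral_mul_const _ (hb.pow_const s)]
    refine lintegral_congr fun y => ?_
    change ∫⁻ ξ, b y ^ s * a (y + (2 * Real.pi) • ξ) ^ s = _
    rw [lintegral_const_mul _ (by fun_prop), lintegral_comp_add_smul fun y => a y ^ s]
  have hl : ∫⁻ ξ, κ ξ * ∫⁻ y, b y * a (y + (2 * Real.pi) • ξ) =
      ∫⁻ z : Rd d × Rd d, κ z.1 * (b z.2 * a (z.2 + (2 * Real.pi) • z.1)) := by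
    have hm : AEMeasurable (fun z : Rd d × Rd d =>
      κ z.1 * (b z.2 * a (z.2 + (2 * Real.pi) • z.1))) := hκ1.mul (hb1.mul ha1).aemeasurable
    rw [Measure.volume_eq_prod, lintegral_prod _ hm]
    refine lintegral_congr fun ξ => (lintegral_const_mul _ ?_).symm
    fun_prop
  rw [hl]
  simp only [hpt, i0, i1, i2] at h
  refine h.trans_eq ?_
  change (_ * _) ^ (1 / (2 * q)) * (_ * _) ^ (1 / (2 * q)) * (_ * (_ * _)) ^ (1 - 1 / q) = _
  have h2q : 1 / q = 1 / (2 * q) + 1 / (2 * q) := by field_simp; ring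
  rw [ENNReal.mul_rpow_of_nonneg _ _ (by positivity), ENNReal.mul_rpow_of_nonneg _ _ (by positivity),
    ENNReal.mul_rpow_of_nonneg _ _ hq1.le, ENNReal.mul_rpow_of_nonneg _ _ hq1.le, hse,
    ENNReal.rpow_add_of_nonneg _ _ (by positivity) hq1.le,
    ENNReal.rpow_add_of_nonneg _ _ (by positivity) hq1.le]
  have hk : (∫⁻ ξ, κ ξ ^ q) ^ (1 / q) = (∫⁻ ξ, κ ξ ^ q) ^ (1 / (2 * q)) *
      (∫⁻ ξ, κ ξ ^ q) ^ (1 / (2 * q)) := by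
    conv_lhs => rw [h2q]
    exact ENNReal.rpow_add_of_nonneg _ _ (by positivity) (by positivity)
  rw [hk]
  ring

end Inequalities

/-! ### Pointwise and sectional bounds for the Gabor transform -/

theorem norm_toLp_coherent (z : Rd d × Rd d) : ‖(coherent z).toLp 2 volume‖ ^ 2 = gaussMass d := by
  have h1 : ((‖(coherent z).toLp 2 volume‖ ^ 2 : ℝ) : ℂ) =
      inner ℂ ((coherent z).toLp 2 volume) ((coherent z).toLp 2 volume) := by
    rw [inner_self_eq_norm_sq_to_K]; push_cast; rfl
  have h2 : inner ℂ ((coherent z).toLp 2 volume) ((coherent z).toLp 2 volume) =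
      ∫ t, (starRingEnd ℂ) (coherent z t) * coherent z t := by
    rw [inner_toLp_eq]
    refine integral_congr_ae ?_
    filter_upwards [(coherent z).coeFn_toLp 2 volume] with t ht
    rw [ht]
  rw [h2, integral_conj_coherent_mul] at h1
  simp only [sub_self, norm_zero] at h1
  rw [real_inner_comm] at h1
  simp only [sub_self] at h1
  norm_num at h1
  exact_mod_cast h1

theorem norm_gabor_le (F : Lp ℂ 2 (volume : Measure (Rd d))) (z : Rd d × Rd d) :
    ‖gabor F z‖ ≤ gaborConst d * √(gaussMass d) * ‖F‖ := by
  rw [gabor_eq_inner, norm_mul, Complex.norm_real, Real.norm_of_nonneg gaborConst_pos.le, mul_assoc,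
    ← norm_toLp_coherent z, Real.sqrt_sq (norm_nonneg _)]
  exact mul_le_mul_of_nonneg_left (norm_inner_le_norm _ _) gaborConst_pos.le

/-- The Gaussian profile of the reproducing kernel. -/
def gaussProfile (x : Rd d) : ℝ≥0∞ := ENNReal.ofReal (Real.exp (-‖x‖ ^ 2 / 4))

theorem measurable_gaussProfile : Measurable (gaussProfile (d := d)) := by
  unfold gaussProfile; fun_prop

theorem gaussProfile_le_one (x : Rd d) : gaussProfile x ≤ 1 := by
  rw [gaussProfile, ENNReal.ofReal_le_one, Real.exp_le_one_iff]
  have := sq_nonneg ‖x‖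
  linarith

theorem lintegral_gaussProfile_lt_top : ∫⁻ x : Rd d, gaussProfile x < ∞ := by
  have h := GaussianFourier.integrable_cexp_neg_mul_sq_norm_add (V := Rd d) (b := 1 / 4)
    (by norm_num) 0 0
  have h2 : Integrable fun x : Rd d => Real.exp (-‖x‖ ^ 2 / 4) := by
    refine h.norm.congr (.of_forall fun x => ?_)
    simp only [Complex.norm_exp]
    congr 1
    simp [← Complex.ofReal_pow]
    ring
  exact (ofReal_integral_eq_lintegral_ofReal h2 (.of_forall fun x => (Real.exp_pos _).le)).symm ▸
    ENNReal.ofReal_lt_top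

theorem ofReal_gaborKernel (z w : Rd d × Rd d) : ENNReal.ofReal (gaborKernel z w) =
    ENNReal.ofReal (gaborConst d ^ 2 * gaussMass d) *
      (gaussProfile (z.1 - w.1) * gaussProfile (z.2 - w.2)) := by
  have := gaussMass_pos (d := d)
  rw [gaborKernel, ENNReal.ofReal_mul (by positivity), ENNReal.ofReal_mul (Real.exp_pos _).le]
  rfl

theorem lintegral_gaborKernel (z : Rd d × Rd d) : ∫⁻ w, ENNReal.ofReal (gaborKernel z w) =
    ENNReal.ofReal (gaborConst d ^ 2 * gaussMass d) *
      ((∫⁻ x : Rd d, gaussProfile x) * ∫⁻ x : Rd d, gaussProfile x) := by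
  have hm := measurable_gaussProfile (d := d)
  simp only [ofReal_gaborKernel]
  rw [lintegral_const_mul _ (by fun_prop), Measure.volume_eq_prod,
    lintegral_prod_mul (f := fun x => gaussProfile (z.1 - x)) (g := fun y => gaussProfile (z.2 - y))
      (by fun_prop) (by fun_prop), lintegral_sub_left_eq_self, lintegral_sub_left_eq_self]

/-- Schur's test from phase space to the frequency slice over `x`. The position factor of the kernel
is at most `1`, so integrating over `y` alone gives a bound independent of `x`. -/
theorem exists_lintegral_section_le {s : ℝ} (hs : 1 ≤ s) : ∃ C : ℝ≥0∞, C ≠ ∞ ∧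
    ∀ (F : Lp ℂ 2 (volume : Measure (Rd d))) (x : Rd d),
      ∫⁻ y, ‖gabor F (x, y)‖ₑ ^ s ≤ C * ∫⁻ z, ‖gabor F z‖ₑ ^ s := by
  have hm := measurable_gaussProfile (d := d)
  set c := ENNReal.ofReal (gaborConst d ^ 2 * gaussMass d)
  set I := ∫⁻ x : Rd d, gaussProfile x
  have hI : I ≠ ∞ := lintegral_gaussProfile_lt_top.ne
  refine ⟨(c * (I * I)) ^ (s - 1) * (c * I), by finiteness, fun F x => ?_⟩
  have hk : Measurable (Function.uncurry fun (y : Rd d) (w : Rd d × Rd d) =>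
      ENNReal.ofReal (gaborKernel (x, y) w)) := by
    simp only [ofReal_gaborKernel]
    fun_prop
  refine (lintegral_mono fun y => ENNReal.rpow_le_rpow (enorm_gabor_le F (x, y))
    (by linarith)).trans (lintegral_kernel_rpow_le hs hk
      (continuous_gabor F).enorm.measurable (fun y => (lintegral_gaborKernel (x, y)).le) fun w => ?_)
  simp only [ofReal_gaborKernel]
  rw [lintegral_const_mul _ (by fun_prop), lintegral_const_mul _ (by fun_prop),
    lintegral_sub_right_eq_self]
  gcongr
  exact mul_le_of_le_one_left' (gaussProfile_le_one _)

/-- The mixed norm `L²_x L^s_y` of a Gabor transform is controlled by its `L^s` norm. -/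
theorem exists_lintegral_section_sq_le {s : ℝ} (hs : 1 ≤ s) (hs2 : s ≤ 2) : ∃ C : ℝ≥0∞, C ≠ ∞ ∧
    ∀ F : Lp ℂ 2 (volume : Measure (Rd d)),
      (∫⁻ x, ((∫⁻ y, ‖gabor F (x, y)‖ₑ ^ s) ^ (1 / s)) ^ (2 : ℝ)) ^ (1 / 2 : ℝ) ≤
        C * (∫⁻ z, ‖gabor F z‖ₑ ^ s) ^ (1 / s) := by
  obtain ⟨C, hC, h⟩ := exists_lintegral_section_le (d := d) hs
  have hs0 : 0 < s := by linarith
  have he : 0 ≤ 2 / s - 1 := by rw [sub_nonneg, one_le_div hs0]; exact hs2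
  refine ⟨(C ^ (2 / s - 1)) ^ (1 / 2 : ℝ), by finiteness, fun F => ?_⟩
  set S := ∫⁻ z, ‖gabor F z‖ₑ ^ s with hS
  have hmeas : Measurable fun z => ‖gabor F z‖ₑ ^ s :=
    (continuous_gabor F).enorm.measurable.pow_const s
  -- The section integral appears to the power `2/s = (2/s - 1) + 1`: the first part is bounded
  -- uniformly in `x`, and the remaining first power integrates to the full `L^s` integral.
  have h1 : ∫⁻ x, ((∫⁻ y, ‖gabor F (x, y)‖ₑ ^ s) ^ (1 / s)) ^ (2 : ℝ) ≤
      C ^ (2 / s - 1) * S ^ (2 / s) := by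
    calc _ ≤ ∫⁻ x, (C * S) ^ (2 / s - 1) * ∫⁻ y, ‖gabor F (x, y)‖ₑ ^ s := by
          refine lintegral_mono fun x => ?_
          rw [← ENNReal.rpow_mul, show 1 / s * 2 = (2 / s - 1) + 1 by ring,
            ENNReal.rpow_add_of_nonneg _ _ he zero_le_one, ENNReal.rpow_one]
          gcongr
          exact h F x
      _ = (C * S) ^ (2 / s - 1) * S := by
          rw [lintegral_const_mul _ hmeas.lintegral_prod_right', hS, Measure.volume_eq_prod,
            lintegral_prod _ hmeas.aemeasurable]
      _ = _ := by
          rw [ENNReal.mul_rpow_of_nonneg _ _ he, mul_assoc]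
          nth_rewrite 2 [← ENNReal.rpow_one S]
          rw [← ENNReal.rpow_add_of_nonneg _ _ he zero_le_one, sub_add_cancel]
  refine (ENNReal.rpow_le_rpow h1 (by norm_num)).trans_eq ?_
  rw [ENNReal.mul_rpow_of_nonneg _ _ (by norm_num), ← ENNReal.rpow_mul S]
  congr 2
  ring

/-! ### Modulations and the Fourier transform of a product -/

/-- Multiplication by the character `e^{i η·t}` on `L²`. -/
def modL2 (η : Rd d) (F : Lp ℂ 2 (volume : Measure (Rd d))) : Lp ℂ 2 (volume : Measure (Rd d)) :=
  MemLp.toLp (fun t => phase (-η) t * F t) (by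
    refine (Lp.memLp F).of_le_mul (c := 1) ?_ (.of_forall fun t => ?_)
    · exact (by unfold phase; fun_prop : Continuous (phase (-η))).aestronglyMeasurable.mul (Lp.aestronglyMeasurable F)
    · rw [norm_mul, norm_phase])

theorem coeFn_modL2 (η : Rd d) (F : Lp ℂ 2 (volume : Measure (Rd d))) :
    modL2 η F =ᵐ[volume] fun t => phase (-η) t * F t := MemLp.coeFn_toLp _

theorem norm_gabor_phase_mul (η : Rd d) (f : Rd d → ℂ) (z : Rd d × Rd d) :
    ‖gabor (fun t => phase (-η) t * f t) z‖ = ‖gabor f (z.1, z.2 - η)‖ := by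
  have h : ∀ t, (starRingEnd ℂ) (coherent z t) * (phase (-η) t * f t) =
      Complex.exp (Complex.I * ((inner ℝ z.1 η / 2 : ℝ) : ℂ)) *
        ((starRingEnd ℂ) (coherent (z.1, z.2 - η) t) * f t) := by
    intro t
    rw [coherent_apply, coherent_apply, phase, ← Complex.exp_conj, ← Complex.exp_conj, ← mul_assoc,
      ← mul_assoc, ← Complex.exp_add, ← Complex.exp_add]
    congr 2
    simp only [map_add, map_mul, Complex.conj_I, Complex.conj_ofReal, inner_sub_left,
      inner_sub_right, inner_neg_left]
    push_cast
    ring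
  rw [gabor, gabor, norm_mul, norm_mul]
  simp only [h]
  rw [integral_const_mul, norm_mul, Complex.norm_exp]
  simp

theorem norm_gabor_modL2 (η : Rd d) (F : Lp ℂ 2 (volume : Measure (Rd d))) (z : Rd d × Rd d) :
    ‖gabor (modL2 η F) z‖ = ‖gabor F (z.1, z.2 - η)‖ := by
  rw [gabor_congr (coeFn_modL2 η F), norm_gabor_phase_mul]

/-! ### The Banach space of square integrable functions with Gabor transform in `L^p` -/

section GaborSpace

variable {p : ℝ≥0∞} [Fact (1 ≤ p)]

/-- The pairs of a function in `L²` and its Gabor transform, required to be in `L^p`. -/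
def gaborSubmodule (d : ℕ) (p : ℝ≥0∞) [Fact (1 ≤ p)] :
    Submodule ℂ (Lp ℂ 2 (volume : Measure (Rd d)) × Lp ℂ p (volume : Measure (Rd d × Rd d))) where
  carrier := {x | x.2 =ᵐ[volume] gabor x.1}
  zero_mem' := by
    have h : gabor (0 : Lp ℂ 2 (volume : Measure (Rd d))) = 0 := by
      ext z
      rw [gabor_eq_inner, inner_zero_right, mul_zero, Pi.zero_apply]
    change (0 : Lp ℂ p (volume : Measure (Rd d × Rd d))) =ᵐ[volume]
      gabor (0 : Lp ℂ 2 (volume : Measure (Rd d)))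
    rw [h]
    exact Lp.coeFn_zero _ _ _
  add_mem' {x y} hx hy := by
    change (x.2 + y.2 : Lp ℂ p (volume : Measure (Rd d × Rd d))) =ᵐ[volume]
      gabor (x.1 + y.1 : Lp ℂ 2 (volume : Measure (Rd d)))
    rw [gabor_add]
    filter_upwards [Lp.coeFn_add x.2 y.2, hx, hy] with z h1 h2 h3
    rw [h1, Pi.add_apply, Pi.add_apply, h2, h3]
  smul_mem' c x hx := by
    change (c • x.2 : Lp ℂ p (volume : Measure (Rd d × Rd d))) =ᵐ[volume]
      gabor (c • x.1 : Lp ℂ 2 (volume : Measure (Rd d)))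
    rw [gabor_smul]
    filter_upwards [Lp.coeFn_smul c x.2, hx] with z h1 h2
    rw [h1, Pi.smul_apply, Pi.smul_apply, h2]

/-- The space of all `F ∈ L²` with `gabor F ∈ L^p`, a concrete form of `M^{p,p}` for `p ≤ 2`. -/
abbrev GaborSpace (d : ℕ) (p : ℝ≥0∞) [Fact (1 ≤ p)] : Type := ↥(gaborSubmodule d p)

instance : NormedAddCommGroup (GaborSpace d p) := Submodule.normedAddCommGroup _

instance : NormedSpace ℂ (GaborSpace d p) := Submodule.normedSpace _

/-- Convergence in `L²` forces convergence of the Gabor transforms at every point, which must agree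
with the almost everywhere limit of a subsequence of the second components. -/
theorem isClosed_gaborSubmodule :
    IsClosed (gaborSubmodule d p : Set (Lp ℂ 2 (volume : Measure (Rd d)) ×
      Lp ℂ p (volume : Measure (Rd d × Rd d)))) := by
  refine IsSeqClosed.isClosed fun x a hx ha => ?_
  have h1 : Tendsto (fun n => (x n).1) atTop (𝓝 a.1) := (continuous_fst.tendsto a).comp ha
  have h2 : Tendsto (fun n => (x n).2) atTop (𝓝 a.2) := (continuous_snd.tendsto a).comp ha
  obtain ⟨ns, hns, hlim⟩ := (tendstoInMeasure_of_tendsto_Lp h2).exists_seq_tendsto_ae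
  change a.2 =ᵐ[volume] gabor a.1
  filter_upwards [hlim, ae_all_iff.2 hx] with z h3 h4
  refine tendsto_nhds_unique h3 ?_
  simp only [h4, gabor_eq_inner]
  exact ((continuous_const.mul (continuous_const.inner continuous_id)).tendsto a.1).comp
    (h1.comp hns.tendsto_atTop)

instance : CompleteSpace (GaborSpace d p) := isClosed_gaborSubmodule.completeSpace_coe

namespace GaborSpace

/-- The underlying square integrable function. -/
def fn : GaborSpace d p →L[ℂ] Lp ℂ 2 (volume : Measure (Rd d)) :=
  (ContinuousLinearMap.fst ℂ _ _).comp (gaborSubmodule d p).subtypeL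

theorem snd_ae_eq (x : GaborSpace d p) : x.1.2 =ᵐ[volume] gabor (fn x) := x.2

theorem ext_fn {x y : GaborSpace d p} (h : fn x = fn y) : x = y := by
  refine Subtype.ext (Prod.ext h (Lp.ext ?_))
  exact (snd_ae_eq x).trans (h ▸ (snd_ae_eq y).symm)

theorem norm_fn_le (x : GaborSpace d p) : ‖fn x‖ ≤ ‖x‖ := norm_fst_le x.1

theorem enorm_fn_le (x : GaborSpace d p) : ‖fn x‖ₑ ≤ ‖x‖ₑ := by
  rw [enorm_le_iff_norm_le]; exact norm_fn_le x

theorem memLp_gabor (x : GaborSpace d p) : MemLp (gabor (fn x)) p :=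
  (memLp_congr_ae (snd_ae_eq x)).1 (Lp.memLp x.1.2)

theorem eLpNorm_gabor_le (x : GaborSpace d p) : eLpNorm (gabor (fn x)) p volume ≤ ‖x‖ₑ := by
  rw [← eLpNorm_congr_ae (snd_ae_eq x), ← Lp.enorm_def, enorm_le_iff_norm_le]
  exact norm_snd_le x.1

/-- The element of the Gabor space that is given by a square integrable function. -/
def ofFn (F : Lp ℂ 2 (volume : Measure (Rd d))) (h : MemLp (gabor F) p) : GaborSpace d p :=
  ⟨(F, h.toLp), h.coeFn_toLp⟩

@[simp] theorem fn_ofFn (F : Lp ℂ 2 (volume : Measure (Rd d))) (h : MemLp (gabor F) p) :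
    fn (ofFn F h) = F := rfl

theorem enorm_le_of {x : GaborSpace d p} {C : ℝ≥0∞} (h1 : ‖fn x‖ₑ ≤ C)
    (h2 : eLpNorm (gabor (fn x)) p volume ≤ C) : ‖x‖ₑ ≤ C := by
  rw [← eLpNorm_congr_ae (snd_ae_eq x), ← Lp.enorm_def] at h2
  change ‖x.1‖ₑ ≤ C
  have : ‖x.1‖ₑ = max ‖x.1.1‖ₑ ‖x.1.2‖ₑ := by
    rw [← ofReal_norm, Prod.norm_def, ENNReal.ofReal_max, ofReal_norm, ofReal_norm]
  rw [this]
  exact max_le h1 h2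

theorem enorm_le_add (x : GaborSpace d p) :
    ‖x‖ₑ ≤ ‖fn x‖ₑ + eLpNorm (gabor (fn x)) p volume :=
  enorm_le_of le_self_add le_add_self

/-- The propagator `e^{-iθH}` on the Gabor space. -/
def flow (θ : ℝ) : GaborSpace d p →L[ℂ] GaborSpace d p :=
  (((prop θ).prodMap (evolve p θ)).comp (gaborSubmodule d p).subtypeL).codRestrict
    (gaborSubmodule d p) fun x => by
      have h3 := (measurePreserving_rot (d := d) (-θ)).quasiMeasurePreserving.ae (snd_ae_eq x)
      change evolve p θ x.1.2 =ᵐ[volume] gabor (prop θ (fn x))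
      filter_upwards [coeFn_evolve θ x.1.2, h3] with z h1 h2
      rw [h1, h2, gabor_prop]

@[simp] theorem fn_flow (θ : ℝ) (x : GaborSpace d p) : fn (flow θ x) = prop θ (fn x) := rfl

@[simp] theorem flow_zero (x : GaborSpace d p) : flow 0 x = x := ext_fn (by simp)

theorem flow_add (a b : ℝ) (x : GaborSpace d p) : flow (a + b) x = flow a (flow b x) :=
  ext_fn (by simp [prop_add])

@[simp] theorem flow_flow_neg (a : ℝ) (x : GaborSpace d p) : flow a (flow (-a) x) = x := by
  rw [← flow_add]; simp

@[simp] theorem norm_flow (θ : ℝ) (x : GaborSpace d p) : ‖flow θ x‖ = ‖x‖ := by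
  change ‖(prop θ x.1.1, evolve p θ x.1.2)‖ = ‖x.1‖
  rw [Prod.norm_def, norm_prop, norm_evolve, ← Prod.norm_def]

theorem continuous_flow (hp : p ≠ ∞) (x : GaborSpace d p) : Continuous fun θ => flow θ x :=
  Continuous.subtype_mk ((continuous_prop x.1.1).prodMk (continuous_evolve hp x.1.2)) _

/-- Since the group is isometric, strong continuity extends to moving arguments: `U(a τ)(u τ - u t)`
is as small as `u τ - u t`. -/
theorem continuousOn_flow_apply (hp : p ≠ ∞) {s : Set ℝ} {a : ℝ → ℝ} {u : ℝ → GaborSpace d p}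
    (ha : ContinuousOn a s) (hu : ContinuousOn u s) : ContinuousOn (fun t => flow (a t) (u t)) s := by
  intro t ht
  have h1 : Tendsto (fun τ => flow (a τ) (u t)) (𝓝[s] t) (𝓝 (flow (a t) (u t))) :=
    ((continuous_flow hp (u t)).tendsto (a t)).comp (ha t ht)
  have h2 : Tendsto (fun τ => flow (a τ) (u τ - u t)) (𝓝[s] t) (𝓝 0) := by
    rw [tendsto_zero_iff_norm_tendsto_zero]
    simp only [norm_flow]
    exact tendsto_iff_norm_sub_tendsto_zero.1 (hu t ht)
  have h3 := h2.add h1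
  simp only [map_sub, sub_add_cancel, zero_add] at h3
  exact h3

end GaborSpace

end GaborSpace

/-! ### Multiplication by the Fourier transform of an integrable function -/

theorem fourierInv_eq_phase (m : Rd d → ℂ) (t : Rd d) :
    (𝓕⁻ m) t = ∫ ξ, m ξ * phase (-((2 * Real.pi) • ξ)) t := by
  rw [Real.fourierInv_eq']
  refine integral_congr_ae (.of_forall fun ξ => ?_)
  dsimp only
  rw [smul_eq_mul, mul_comm, phase, inner_neg_left, inner_smul_left, conj_trivial]
  congr 2
  push_cast
  ring

theorem fourier_eq_phase (h : Rd d → ℂ) (ξ : Rd d) :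
    (𝓕 h) ξ = ∫ t, phase ((2 * Real.pi) • ξ) t * h t := by
  rw [Real.fourier_eq']
  refine integral_congr_ae (.of_forall fun t => ?_)
  dsimp only
  rw [smul_eq_mul, phase, inner_smul_left, real_inner_comm, conj_trivial]
  congr 2
  push_cast
  ring

theorem continuous_phase_const (y : Rd d) : Continuous (phase y) := by
  unfold phase; fun_prop

theorem continuous_fourierInv_of_integrable {m : Rd d → ℂ} (hm : Integrable m) :
    Continuous (𝓕⁻ m) := by
  have h : (𝓕⁻ m) = fun t => ∫ ξ, m ξ * phase (-((2 * Real.pi) • ξ)) t :=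
    funext (fourierInv_eq_phase m)
  rw [h]
  refine continuous_of_dominated (bound := fun ξ => ‖m ξ‖) (fun t => ?_)
    (fun t => .of_forall fun ξ => ?_) hm.norm (.of_forall fun ξ => ?_)
  · exact hm.1.mul (by unfold phase; fun_prop :
      Continuous fun ξ : Rd d => phase (-((2 * Real.pi) • ξ)) t).aestronglyMeasurable
  · rw [norm_mul, norm_phase, mul_one]
  · exact continuous_const.mul (continuous_phase_const _)

theorem continuous_fourier_of_integrable {m : Rd d → ℂ} (hm : Integrable m) :
    Continuous (𝓕 m) := by
  have h : (𝓕 m) = fun ξ => ∫ t, phase ((2 * Real.pi) • ξ) t * m t :=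
    funext (fourier_eq_phase m)
  rw [h]
  refine continuous_of_dominated (bound := fun ξ => ‖m ξ‖) (fun ξ => ?_)
    (fun t => .of_forall fun ξ => ?_) hm.norm (.of_forall fun ξ => ?_)
  · exact (continuous_phase_const _).aestronglyMeasurable.mul hm.1
  · rw [norm_mul, norm_phase, one_mul]
  · exact (by unfold phase; fun_prop :
      Continuous fun η : Rd d => phase ((2 * Real.pi) • η) ξ).mul continuous_const

theorem norm_fourierInv_le (m : Rd d → ℂ) (t : Rd d) : ‖(𝓕⁻ m) t‖ ≤ ∫ ξ, ‖m ξ‖ := by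
  rw [fourierInv_eq_phase]
  refine (norm_integral_le_integral_norm _).trans_eq (integral_congr_ae (.of_forall fun ξ => ?_))
  dsimp only
  rw [norm_mul, norm_phase, mul_one]

/-- Fubini: `𝓕⁻ m` is a superposition of characters with weight `m`. -/
theorem gabor_fourierInv_mul {m : Rd d → ℂ} (hm : Integrable m)
    (F : Lp ℂ 2 (volume : Measure (Rd d))) (z : Rd d × Rd d) :
    gabor (fun t => (𝓕⁻ m) t * F t) z =
      ∫ ξ, m ξ * gabor (fun t => phase (-((2 * Real.pi) • ξ)) t * F t) z := by
  have h1 : Integrable fun t => (starRingEnd ℂ) (coherent z t) * F t := by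
    refine (((conjS (coherent z)).memLp 2 volume).integrable_mul (Lp.memLp F)).congr
      (.of_forall fun t => ?_)
    rw [Pi.mul_apply, conjS_apply]
  have h2 : Integrable (fun q : Rd d × Rd d => phase (-((2 * Real.pi) • q.2)) q.1 *
      (((starRingEnd ℂ) (coherent z q.1) * F q.1) * m q.2)) (volume.prod volume) := by
    refine (h1.mul_prod hm).bdd_mul (c := 1) ?_ (.of_forall fun q => (norm_phase _ _).le)
    exact (by unfold phase; fun_prop : Continuous fun q : Rd d × Rd d =>
      phase (-((2 * Real.pi) • q.2)) q.1).aestronglyMeasurable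
  have e1 : ∀ t, (starRingEnd ℂ) (coherent z t) * ((𝓕⁻ m) t * F t) =
      ∫ ξ, phase (-((2 * Real.pi) • ξ)) t * (((starRingEnd ℂ) (coherent z t) * F t) * m ξ) := by
    intro t
    rw [fourierInv_eq_phase, ← integral_mul_const, ← integral_const_mul]
    refine integral_congr_ae (.of_forall fun ξ => ?_)
    ring
  have e2 : ∀ ξ, m ξ * gabor (fun t => phase (-((2 * Real.pi) • ξ)) t * F t) z =
      gaborConst d * ∫ t, phase (-((2 * Real.pi) • ξ)) t *
        (((starRingEnd ℂ) (coherent z t) * F t) * m ξ) := by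
    intro ξ
    rw [gabor, mul_left_comm, ← integral_const_mul]
    congr 1
    refine integral_congr_ae (.of_forall fun t => ?_)
    ring
  rw [gabor]
  simp only [e1, e2]
  rw [integral_const_mul, integral_integral_swap h2]

theorem eLpNorm_eq_rpow {α : Type*} [MeasurableSpace α] {μ : Measure α} {p : ℝ≥0∞}
    [Fact (1 ≤ p)] [hp : Fact (p ≠ ∞)] (G : α → ℂ) :
    eLpNorm G p μ ^ p.toReal = ∫⁻ z, ‖G z‖ₑ ^ p.toReal ∂μ := by
  have h0 : p ≠ 0 := (zero_lt_one.trans_le Fact.out).ne'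
  rw [eLpNorm_eq_lintegral_rpow_enorm_toReal h0 hp.out, ← ENNReal.rpow_mul,
    one_div_mul_cancel (ENNReal.toReal_pos h0 hp.out).ne', ENNReal.rpow_one]

theorem eLpNorm_le_of_rpow_le {α : Type*} [MeasurableSpace α] {μ : Measure α} {p : ℝ≥0∞}
    [Fact (1 ≤ p)] [hp : Fact (p ≠ ∞)] {G : α → ℂ} {C : ℝ≥0∞}
    (h : ∫⁻ z, ‖G z‖ₑ ^ p.toReal ∂μ ≤ C ^ p.toReal) : eLpNorm G p μ ≤ C := by
  have h0 : p ≠ 0 := (zero_lt_one.trans_le Fact.out).ne'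
  rw [← eLpNorm_eq_rpow] at h
  exact (ENNReal.rpow_le_rpow_iff (ENNReal.toReal_pos h0 hp.out)).1 h

theorem one_le_toReal (p : ℝ≥0∞) [h : Fact (1 ≤ p)] [hp : Fact (p ≠ ∞)] : 1 ≤ p.toReal := by
  rw [← ENNReal.toReal_one]
  exact (ENNReal.toReal_le_toReal (by simp) hp.out).2 h.out

section Multiplication

variable {p : ℝ≥0∞} [Fact (1 ≤ p)] [Fact (p ≠ ∞)]

/-- Each character translates the Gabor transform in frequency, which preserves the `L^p` norm.
Multiplication by `𝓕⁻ m` averages such translations, and Minkowski's inequality applies. -/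
theorem eLpNorm_gabor_fourierInv_mul_le {m : Rd d → ℂ} (hm : Integrable m)
    (F : Lp ℂ 2 (volume : Measure (Rd d))) :
    eLpNorm (gabor (fun t => (𝓕⁻ m) t * F t)) p volume ≤
      (∫⁻ ξ, ‖m ξ‖ₑ) * eLpNorm (gabor F) p volume := by
  have hs := one_le_toReal p
  refine eLpNorm_le_of_rpow_le ?_
  rw [ENNReal.mul_rpow_of_nonneg _ _ (by linarith), eLpNorm_eq_rpow]
  have hT : ∀ η : Rd d, MeasurePreserving (fun z : Rd d × Rd d => (z.1, z.2 - η)) volume volume :=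
    fun η => (MeasurePreserving.id volume).prod (measurePreserving_sub_right volume η)
  refine (lintegral_mono fun z => ENNReal.rpow_le_rpow ?_ (by linarith)).trans
    (lintegral_average_rpow_le (T := fun (ξ : Rd d) z => (z.1, z.2 - (2 * Real.pi) • ξ)) hs
      hm.1.enorm (continuous_gabor F).enorm.measurable
      (by simp only [Function.uncurry_def]; fun_prop) fun ξ => hT _)
  rw [gabor_fourierInv_mul hm]
  refine (enorm_integral_le_lintegral_enorm _).trans_eq (lintegral_congr fun ξ => ?_)
  rw [enorm_mul]
  congr 1
  rw [← ofReal_norm, norm_gabor_phase_mul, ofReal_norm]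

theorem memLp_fourierInv_mul {m : Rd d → ℂ} (hm : Integrable m)
    (F : Lp ℂ 2 (volume : Measure (Rd d))) : MemLp (fun t => (𝓕⁻ m) t * F t) 2 volume :=
  (Lp.memLp F).of_le_mul (c := ∫ ξ, ‖m ξ‖)
    ((continuous_fourierInv_of_integrable hm).aestronglyMeasurable.mul (Lp.aestronglyMeasurable F))
    (.of_forall fun t => by
      rw [norm_mul]; exact mul_le_mul_of_nonneg_right (norm_fourierInv_le m t) (norm_nonneg _))

namespace GaborSpace

/-- Multiplication of elements of the Gabor space by `𝓕⁻ m` for an integrable function `m`. -/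
def mulFourier (m : Lp ℂ 1 (volume : Measure (Rd d))) (x : GaborSpace d p) : GaborSpace d p :=
  ofFn (MemLp.toLp _ (memLp_fourierInv_mul (L1.integrable_coeFn m) (fn x))) (by
    refine ⟨(continuous_gabor _).aestronglyMeasurable, ?_⟩
    rw [gabor_congr (memLp_fourierInv_mul (L1.integrable_coeFn m) (fn x)).coeFn_toLp]
    refine (eLpNorm_gabor_fourierInv_mul_le (L1.integrable_coeFn m) (fn x)).trans_lt
      (ENNReal.mul_lt_top (L1.integrable_coeFn m).2 (memLp_gabor x).2))

theorem coeFn_mulFourier (m : Lp ℂ 1 (volume : Measure (Rd d))) (x : GaborSpace d p) :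
    fn (mulFourier m x) =ᵐ[volume] fun t => (𝓕⁻ (m : Rd d → ℂ)) t * fn x t :=
  (memLp_fourierInv_mul (L1.integrable_coeFn m) (fn x)).coeFn_toLp

theorem norm_mulFourier_le (m : Lp ℂ 1 (volume : Measure (Rd d))) (x : GaborSpace d p) :
    ‖mulFourier m x‖ ≤ ‖m‖ * ‖x‖ := by
  have hm := L1.integrable_coeFn m
  have e : ‖m‖ₑ = ∫⁻ ξ, ‖m ξ‖ₑ := by rw [Lp.enorm_def, eLpNorm_one_eq_lintegral_enorm]
  have h : ‖mulFourier m x‖ₑ ≤ ‖m‖ₑ * ‖x‖ₑ := by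
    refine enorm_le_of ?_ ?_
    · have h1 : ‖fn (mulFourier m x)‖ ≤ ‖m‖ * ‖fn x‖ := by
        refine Lp.norm_le_mul_norm_of_ae_le_mul ?_
        filter_upwards [coeFn_mulFourier m x] with t ht
        rw [ht, norm_mul, L1.norm_eq_integral_norm]
        exact mul_le_mul_of_nonneg_right (norm_fourierInv_le _ t) (norm_nonneg _)
      have h2 : ‖fn (mulFourier m x)‖ₑ ≤ ‖m‖ₑ * ‖fn x‖ₑ := by
        rw [← ofReal_norm, ← ofReal_norm, ← ofReal_norm, ← ENNReal.ofReal_mul (norm_nonneg _)]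
        exact ENNReal.ofReal_le_ofReal h1
      exact h2.trans (by gcongr; exact enorm_fn_le x)
    · rw [gabor_congr (coeFn_mulFourier m x), e]
      exact (eLpNorm_gabor_fourierInv_mul_le hm (fn x)).trans (by gcongr; exact eLpNorm_gabor_le x)
  rw [← ofReal_norm, ← ofReal_norm, ← ofReal_norm, ← ENNReal.ofReal_mul (norm_nonneg _)] at h
  exact (ENNReal.ofReal_le_ofReal_iff (by positivity)).1 h

theorem mulFourier_sub_right (m : Lp ℂ 1 (volume : Measure (Rd d))) (x y : GaborSpace d p) :
    mulFourier m (x - y) = mulFourier m x - mulFourier m y := by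
  refine ext_fn (Lp.ext ?_)
  rw [map_sub]
  filter_upwards [coeFn_mulFourier m x, coeFn_mulFourier m y, coeFn_mulFourier m (x - y),
    Lp.coeFn_sub (fn (mulFourier m x)) (fn (mulFourier m y)), Lp.coeFn_sub (fn x) (fn y)]
    with t h1 h2 h3 h4 h5
  rw [h3, h4, Pi.sub_apply, h1, h2, map_sub, h5, Pi.sub_apply, mul_sub]

theorem mulFourier_sub_left (m n : Lp ℂ 1 (volume : Measure (Rd d))) (x : GaborSpace d p) :
    mulFourier (m - n) x = mulFourier m x - mulFourier n x := by
  refine ext_fn (Lp.ext ?_)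
  rw [map_sub]
  have hF : ∀ t, (𝓕⁻ (↑(m - n) : Rd d → ℂ)) t =
      (𝓕⁻ (m : Rd d → ℂ)) t - (𝓕⁻ (n : Rd d → ℂ)) t := by
    intro t
    have hb : ∀ l : Lp ℂ 1 (volume : Measure (Rd d)),
        Integrable fun ξ => l ξ * phase (-((2 * Real.pi) • ξ)) t := fun l =>
      (L1.integrable_coeFn l).mul_bdd (c := 1)
        (by unfold phase; fun_prop : Continuous fun ξ : Rd d =>
          phase (-((2 * Real.pi) • ξ)) t).aestronglyMeasurable
        (.of_forall fun ξ => (norm_phase _ _).le)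
    rw [fourierInv_eq_phase, fourierInv_eq_phase, fourierInv_eq_phase, ← integral_sub (hb m) (hb n)]
    refine integral_congr_ae ?_
    filter_upwards [Lp.coeFn_sub m n] with ξ h
    rw [h, Pi.sub_apply, sub_mul]
  filter_upwards [coeFn_mulFourier m x, coeFn_mulFourier n x, coeFn_mulFourier (m - n) x,
    Lp.coeFn_sub (fn (mulFourier m x)) (fn (mulFourier n x))] with t h1 h2 h3 h4
  rw [h3, h4, Pi.sub_apply, h1, h2, hF, sub_mul]

end GaborSpace

end Multiplication

/-! ### The Fourier transform of a product and the Hartree potential -/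

/-- The function `ξ ↦ 𝓕(a b̄)(ξ)`. -/
def productFourier (a b : Lp ℂ 2 (volume : Measure (Rd d))) : Rd d → ℂ :=
  𝓕 fun t => a t * (starRingEnd ℂ) (b t)

theorem integrable_mul_conj (a b : Lp ℂ 2 (volume : Measure (Rd d))) :
    Integrable fun t => a t * (starRingEnd ℂ) (b t) :=
  (Lp.memLp a).integrable_mul (Lp.memLp b).star

theorem continuous_productFourier (a b : Lp ℂ 2 (volume : Measure (Rd d))) :
    Continuous (productFourier a b) := continuous_fourier_of_integrable (integrable_mul_conj a b)

theorem productFourier_eq_inner (a b : Lp ℂ 2 (volume : Measure (Rd d))) (ξ : Rd d) :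
    productFourier a b ξ = inner ℂ b (modL2 (-((2 * Real.pi) • ξ)) a) := by
  rw [productFourier, fourier_eq_phase, L2.inner_def]
  refine integral_congr_ae ?_
  filter_upwards [coeFn_modL2 (-((2 * Real.pi) • ξ)) a] with t ht
  rw [ht, neg_neg, RCLike.inner_apply, mul_assoc]

theorem productFourier_sub_left (a a' b : Lp ℂ 2 (volume : Measure (Rd d))) (ξ : Rd d) :
    productFourier (a - a') b ξ = productFourier a b ξ - productFourier a' b ξ := by
  have h : modL2 (-((2 * Real.pi) • ξ)) (a - a') =
      modL2 (-((2 * Real.pi) • ξ)) a - modL2 (-((2 * Real.pi) • ξ)) a' := by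
    refine Lp.ext ?_
    filter_upwards [coeFn_modL2 (-((2 * Real.pi) • ξ)) (a - a'), coeFn_modL2 (-((2 * Real.pi) • ξ)) a,
      coeFn_modL2 (-((2 * Real.pi) • ξ)) a', Lp.coeFn_sub a a',
      Lp.coeFn_sub (modL2 (-((2 * Real.pi) • ξ)) a) (modL2 (-((2 * Real.pi) • ξ)) a')]
      with t h1 h2 h3 h4 h5
    rw [h1, h5, Pi.sub_apply, h2, h3, h4, Pi.sub_apply, mul_sub]
  simp only [productFourier_eq_inner, h, inner_sub_right]

theorem productFourier_sub_right (a b b' : Lp ℂ 2 (volume : Measure (Rd d))) (ξ : Rd d) :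
    productFourier a (b - b') ξ = productFourier a b ξ - productFourier a b' ξ := by
  simp only [productFourier_eq_inner, inner_sub_left]

/-- The Fourier coefficient is the inner product of `b` with a modulation of `a`; Parseval in phase
space turns the modulation into a frequency shift by `2πξ`. -/
theorem enorm_productFourier_le (a b : Lp ℂ 2 (volume : Measure (Rd d))) (ξ : Rd d) :
    ‖productFourier a b ξ‖ₑ ≤
      ∫⁻ x, ∫⁻ y, ‖gabor b (x, y)‖ₑ * ‖gabor a (x, y + (2 * Real.pi) • ξ)‖ₑ := by
  have hm : Measurable fun z : Rd d × Rd d =>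
      ‖gabor b z‖ₑ * ‖gabor a (z.1, z.2 + (2 * Real.pi) • ξ)‖ₑ := by
    have h1 := (continuous_gabor b).enorm.measurable
    have h2 := (continuous_gabor a).enorm.measurable
    exact h1.mul (h2.comp (by fun_prop))
  rw [productFourier_eq_inner, inner_eq_integral_gabor]
  refine (enorm_integral_le_lintegral_enorm _).trans_eq ?_
  rw [← lintegral_prod _ hm.aemeasurable, ← Measure.volume_eq_prod]
  refine lintegral_congr fun z => ?_
  rw [enorm_mul, RCLike.enorm_conj]
  congr 1
  rw [← ofReal_norm, norm_gabor_modL2, ofReal_norm, sub_neg_eq_add]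

/-- The bilinear estimate behind the Hartree nonlinearity. -/
theorem exists_lintegral_symbol_mul_le {κ : Rd d → ℂ} (hκ : AEStronglyMeasurable κ) {s : ℝ}
    (hs : 1 ≤ s) (hs2 : s ≤ 2) {C₀ : ℝ≥0∞} (hC₀ : C₀ ≠ ∞)
    (hY : YoungBound (fun ξ => ‖κ ξ‖ₑ) s C₀) : ∃ C : ℝ≥0∞, C ≠ ∞ ∧
      ∀ a b : Lp ℂ 2 (volume : Measure (Rd d)), ∫⁻ ξ, ‖κ ξ * productFourier a b ξ‖ₑ ≤
        C * (∫⁻ z, ‖gabor a z‖ₑ ^ s) ^ (1 / s) * (∫⁻ z, ‖gabor b z‖ₑ ^ s) ^ (1 / s) := by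
  obtain ⟨C, hC, hn⟩ := exists_lintegral_section_sq_le (d := d) hs hs2
  refine ⟨C₀ * (C * C), by finiteness, fun a b => ?_⟩
  have ha := (continuous_gabor a).enorm.measurable
  have hb := (continuous_gabor b).enorm.measurable
  have hmeas : ∀ F : Lp ℂ 2 (volume : Measure (Rd d)),
      Measurable fun x => (∫⁻ y, ‖gabor F (x, y)‖ₑ ^ s) ^ (1 / s) := fun F =>
    (((continuous_gabor F).enorm.measurable.pow_const s).lintegral_prod_right').pow_const _
  have hm3 : Measurable fun q : (Rd d × Rd d) × Rd d =>
      ‖gabor b (q.1.2, q.2)‖ₑ * ‖gabor a (q.1.2, q.2 + (2 * Real.pi) • q.1.1)‖ₑ :=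
    (hb.comp (by fun_prop)).mul (ha.comp (by fun_prop))
  have hm1 : ∀ ξ : Rd d, Measurable fun x : Rd d =>
      ∫⁻ y, ‖gabor b (x, y)‖ₑ * ‖gabor a (x, y + (2 * Real.pi) • ξ)‖ₑ := by
    intro ξ
    have : Measurable fun q : Rd d × Rd d =>
        ‖gabor b (q.1, q.2)‖ₑ * ‖gabor a (q.1, q.2 + (2 * Real.pi) • ξ)‖ₑ :=
      (hb.comp (by fun_prop)).mul (ha.comp (by fun_prop))
    exact this.lintegral_prod_right'
  have hm2 : AEMeasurable (fun q : Rd d × Rd d => ‖κ q.1‖ₑ *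
      ∫⁻ y, ‖gabor b (q.2, y)‖ₑ * ‖gabor a (q.2, y + (2 * Real.pi) • q.1)‖ₑ)
      (volume.prod volume) :=
    (hκ.enorm.comp_quasiMeasurePreserving Measure.quasiMeasurePreserving_fst).mul
      hm3.lintegral_prod_right'.aemeasurable
  -- Young's inequality acts in the frequency variables for each fixed position `x`; Cauchy–Schwarz
  -- in `x` then calls for the mixed norm `L²_x L^s_y`.
  calc _ ≤ ∫⁻ ξ, ∫⁻ x, ‖κ ξ‖ₑ *
        ∫⁻ y, ‖gabor b (x, y)‖ₑ * ‖gabor a (x, y + (2 * Real.pi) • ξ)‖ₑ := by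
        refine lintegral_mono fun ξ => ?_
        rw [enorm_mul, lintegral_const_mul _ (hm1 ξ)]
        gcongr
        exact enorm_productFourier_le a b ξ
    _ = ∫⁻ x, ∫⁻ ξ, ‖κ ξ‖ₑ *
        ∫⁻ y, ‖gabor b (x, y)‖ₑ * ‖gabor a (x, y + (2 * Real.pi) • ξ)‖ₑ :=
        lintegral_lintegral_swap hm2
    _ ≤ ∫⁻ x, C₀ * ((∫⁻ y, ‖gabor a (x, y)‖ₑ ^ s) ^ (1 / s) *
          (∫⁻ y, ‖gabor b (x, y)‖ₑ ^ s) ^ (1 / s)) := by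
        refine lintegral_mono fun x => ?_
        rw [← mul_assoc]
        exact hY (fun y => ‖gabor a (x, y)‖ₑ) (fun y => ‖gabor b (x, y)‖ₑ)
          (ha.comp measurable_prodMk_left) (hb.comp measurable_prodMk_left)
    _ = C₀ * ∫⁻ x, ((∫⁻ y, ‖gabor a (x, y)‖ₑ ^ s) ^ (1 / s) *
          (∫⁻ y, ‖gabor b (x, y)‖ₑ ^ s) ^ (1 / s)) :=
        lintegral_const_mul _ ((hmeas a).mul (hmeas b))
    _ ≤ C₀ * ((C * (∫⁻ z, ‖gabor a z‖ₑ ^ s) ^ (1 / s)) *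
          (C * (∫⁻ z, ‖gabor b z‖ₑ ^ s) ^ (1 / s))) := by
        gcongr
        refine (ENNReal.lintegral_mul_le_Lp_mul_Lq volume Real.HolderConjugate.two_two
          (hmeas a).aemeasurable (hmeas b).aemeasurable).trans ?_
        gcongr
        · exact hn a
        · exact hn b
    _ = _ := by ring

section Symbol

variable {p : ℝ≥0∞} [Fact (1 ≤ p)] [Fact (p ≠ ∞)]

open GaborSpace

/-- Gabor transforms are bounded by the `L²` norm, so the surplus power `s - p` can be estimated in
the supremum norm. This is the inclusion of `M^{p,p}` in `M^{s,s}`. -/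
theorem exists_lintegral_gabor_rpow_le {s : ℝ} (hps : p.toReal ≤ s) : ∃ C : ℝ≥0∞, C ≠ ∞ ∧
    ∀ x : GaborSpace d p, (∫⁻ z, ‖gabor (fn x) z‖ₑ ^ s) ^ (1 / s) ≤ C * ‖x‖ₑ := by
  have hp := one_le_toReal p
  have hs0 : 0 < s := by linarith
  set M := ENNReal.ofReal (gaborConst d * √(gaussMass d))
  refine ⟨(M ^ (s - p.toReal)) ^ (1 / s), by
    have : M ≠ ∞ := ENNReal.ofReal_ne_top
    have : 0 ≤ s - p.toReal := by linarith
    finiteness, fun x => ?_⟩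
  have hsup : ∀ z, ‖gabor (fn x) z‖ₑ ≤ M * ‖x‖ₑ := by
    intro z
    refine le_trans ?_ (mul_le_mul_right (enorm_fn_le x) M)
    rw [← ofReal_norm, ← ofReal_norm, ← ENNReal.ofReal_mul
      (mul_nonneg gaborConst_pos.le (Real.sqrt_nonneg _))]
    exact ENNReal.ofReal_le_ofReal (norm_gabor_le _ z)
  have h1 : ∫⁻ z, ‖gabor (fn x) z‖ₑ ^ s ≤ M ^ (s - p.toReal) * ‖x‖ₑ ^ s := by
    calc _ ≤ ∫⁻ z, (M * ‖x‖ₑ) ^ (s - p.toReal) * ‖gabor (fn x) z‖ₑ ^ p.toReal := by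
          refine lintegral_mono fun z => ?_
          dsimp only
          nth_rewrite 1 [show s = (s - p.toReal) + p.toReal by ring]
          rw [ENNReal.rpow_add_of_nonneg _ _ (by linarith) (by linarith)]
          gcongr
          exact hsup z
      _ = (M * ‖x‖ₑ) ^ (s - p.toReal) * eLpNorm (gabor (fn x)) p volume ^ p.toReal := by
          rw [lintegral_const_mul _ ((continuous_gabor _).enorm.measurable.pow_const _),
            eLpNorm_eq_rpow]
      _ ≤ (M * ‖x‖ₑ) ^ (s - p.toReal) * ‖x‖ₑ ^ p.toReal := by
          gcongr
          exact eLpNorm_gabor_le x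
      _ = _ := by
          rw [ENNReal.mul_rpow_of_nonneg _ _ (by linarith), mul_assoc,
            ← ENNReal.rpow_add_of_nonneg _ _ (by linarith) (by linarith), sub_add_cancel]
  refine (ENNReal.rpow_le_rpow h1 (by positivity)).trans_eq ?_
  rw [ENNReal.mul_rpow_of_nonneg _ _ (by positivity), ← ENNReal.rpow_mul ‖x‖ₑ,
    mul_one_div_cancel hs0.ne', ENNReal.rpow_one]

/-- The function `κ` acts boundedly: `‖κ 𝓕(a b̄)‖_1 ≤ C ‖a‖ ‖b‖` on the Gabor space. -/
def IsAdmissible (p : ℝ≥0∞) [Fact (1 ≤ p)] (κ : Rd d → ℂ) : Prop :=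
  AEStronglyMeasurable κ ∧ ∃ C : ℝ, 0 ≤ C ∧ ∀ a b : GaborSpace d p,
    ∫⁻ ξ, ‖κ ξ * productFourier (fn a) (fn b) ξ‖ₑ ≤ ENNReal.ofReal (C * ‖a‖ * ‖b‖)

theorem isAdmissible_of_youngBound {κ : Rd d → ℂ} (hκ : AEStronglyMeasurable κ) {s : ℝ}
    (hps : p.toReal ≤ s) (hs2 : s ≤ 2) {C₀ : ℝ≥0∞} (hC₀ : C₀ ≠ ∞)
    (hY : YoungBound (fun ξ => ‖κ ξ‖ₑ) s C₀) : IsAdmissible p κ := by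
  obtain ⟨C₁, hC₁, h1⟩ := exists_lintegral_symbol_mul_le hκ ((one_le_toReal p).trans hps) hs2 hC₀ hY
  obtain ⟨C₂, hC₂, h2⟩ := exists_lintegral_gabor_rpow_le (d := d) hps
  refine ⟨hκ, (C₁ * C₂ * C₂).toReal, ENNReal.toReal_nonneg, fun a b => ?_⟩
  rw [ENNReal.ofReal_mul (by positivity), ENNReal.ofReal_mul (by positivity),
    ENNReal.ofReal_toReal (by finiteness), ofReal_norm, ofReal_norm]
  calc _ ≤ _ := h1 (fn a) (fn b)
    _ ≤ C₁ * (C₂ * ‖a‖ₑ) * (C₂ * ‖b‖ₑ) := by gcongr; exacts [h2 a, h2 b]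
    _ = _ := by ring

theorem isAdmissible_of_bounded [Fact ((1 : ℝ≥0∞) ≠ ∞)] {κ : Rd d → ℂ}
    (hκ : AEStronglyMeasurable κ) {M : ℝ} (hM : ∀ᵐ ξ, ‖κ ξ‖ ≤ M) : IsAdmissible 1 κ := by
  refine isAdmissible_of_youngBound hκ (s := 1) (by simp) (by norm_num) ?_
    (youngBound_one (M := ENNReal.ofReal M) (hM.mono fun ξ h => ?_))
  · finiteness
  · rw [← ofReal_norm]; exact ENNReal.ofReal_le_ofReal h

/-- The exponent `s = 2q/(2q-1)` is the solution of `2/s = 2 - 1/q`, and it does not exceed `2`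
because `q > 1`. -/
theorem isAdmissible_of_memLp {κ : Rd d → ℂ} {q : ℝ} (hq : 1 < q)
    (hκ : MemLp κ (ENNReal.ofReal q) volume) (hpq : p.toReal ≤ 2 * q / (2 * q - 1)) :
    IsAdmissible p κ := by
  have hq1 : 0 < 2 * q - 1 := by linarith
  have hq0 : 0 < q := by linarith
  refine isAdmissible_of_youngBound hκ.1 (s := 2 * q / (2 * q - 1)) hpq ?_ ?_
    (youngBound_of_lintegral_rpow hκ.1.enorm hq (by field_simp))
  · rw [div_le_iff₀ hq1]; linarith
  · have h1 : 0 ≤ 1 - 1 / q := by rw [sub_nonneg, div_le_one hq0]; exact hq.le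
    have h2 := lintegral_rpow_enorm_lt_top_of_eLpNorm_lt_top (by simpa using hq0)
      ENNReal.ofReal_ne_top hκ.2
    rw [ENNReal.toReal_ofReal hq0.le] at h2
    have h3 : 0 ≤ 1 / q := by positivity
    have := h2.ne
    finiteness

end Symbol

/-! ### Functions that represent a tempered distribution -/

theorem ae_eq_of_integral_schwartz_mul_eq {f f' : Rd d → ℂ} (hf : LocallyIntegrable f)
    (hf' : LocallyIntegrable f') (h : ∀ φ : 𝓢(Rd d, ℂ), ∫ t, φ t * f t = ∫ t, φ t * f' t) :
    f =ᵐ[volume] f' := by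
  refine ae_eq_of_integral_contDiff_smul_eq hf hf' fun g hg hs => ?_
  have hs' : HasCompactSupport fun t => (g t : ℂ) := hs.comp_left Complex.ofReal_zero
  have : ∫ t, (g t : ℂ) * f t = ∫ t, (g t : ℂ) * f' t :=
    h (hs'.toSchwartzMap (Complex.ofRealCLM.contDiff.comp hg))
  simpa [Complex.real_smul] using this

/-- The Gaussian test function has no zeros and a continuous reciprocal, so integrability against it
gives local integrability of `f`. Almost everywhere uniqueness of representatives rests on this. -/
theorem IsRepresentedBy.locallyIntegrable {w : 𝓢'(Rd d, ℂ)} {f : Rd d → ℂ}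
    (h : IsRepresentedBy w f) : LocallyIntegrable f := by
  have h1 := (h gauss).1.locallyIntegrable
  have hg : ∀ t : Rd d, (gauss t : ℂ) ≠ 0 := fun t => by
    rw [gauss_apply]; exact_mod_cast (Real.exp_pos _).ne'
  have hc : Continuous fun t : Rd d => (gauss t)⁻¹ :=
    (SchwartzMap.continuous gauss).inv₀ hg
  have h2 := (locallyIntegrableOn_univ.2 h1).continuousOn_mul hc.continuousOn
    isOpen_univ.isLocallyClosed
  refine (locallyIntegrableOn_univ.1 h2).congr (.of_forall fun t => ?_)
  exact inv_mul_cancel_left₀ (hg t) _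

theorem IsRepresentedBy.ae_eq {w : 𝓢'(Rd d, ℂ)} {f f' : Rd d → ℂ} (h : IsRepresentedBy w f)
    (h' : IsRepresentedBy w f') : f =ᵐ[volume] f' :=
  ae_eq_of_integral_schwartz_mul_eq h.locallyIntegrable h'.locallyIntegrable fun φ => by
    rw [← (h φ).2, ← (h' φ).2]

theorem IsRepresentedBy.congr {w : 𝓢'(Rd d, ℂ)} {f f' : Rd d → ℂ} (h : IsRepresentedBy w f)
    (hf : f =ᵐ[volume] f') : IsRepresentedBy w f' := fun φ => by
  have e : (fun t => φ t * f t) =ᵐ[volume] fun t => φ t * f' t := by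
    filter_upwards [hf] with t ht
    rw [ht]
  exact ⟨(h φ).1.congr e, (h φ).2.trans (integral_congr_ae e)⟩

theorem IsRepresentedBy.unique {w w' : 𝓢'(Rd d, ℂ)} {f : Rd d → ℂ} (h : IsRepresentedBy w f)
    (h' : IsRepresentedBy w' f) : w = w' := by
  ext φ
  rw [(h φ).2, (h' φ).2]

theorem isRepresentedBy_coe (F : Lp ℂ 2 (volume : Measure (Rd d))) :
    IsRepresentedBy (F : 𝓢'(Rd d, ℂ)) F := fun φ =>
  ⟨(φ.memLp 2 volume).integrable_mul (Lp.memLp F), by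
    rw [Lp.toTemperedDistribution_apply]; simp only [smul_eq_mul]⟩

theorem coe_apply_eq_inner (F : Lp ℂ 2 (volume : Measure (Rd d))) (φ : 𝓢(Rd d, ℂ)) :
    (F : 𝓢'(Rd d, ℂ)) φ = inner ℂ ((conjS φ).toLp 2 volume) F := by
  rw [(isRepresentedBy_coe F φ).2, inner_toLp_eq]
  simp

/-! ### Elements of `M^{1,1}` as Fourier transforms of integrable functions -/

theorem continuous_fourier_coherent :
    Continuous fun q : (Rd d × Rd d) × Rd d => (𝓕 (coherent q.1) : 𝓢(Rd d, ℂ)) q.2 := by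
  have h : ∀ q : (Rd d × Rd d) × Rd d, (𝓕 (coherent q.1) : 𝓢(Rd d, ℂ)) q.2 =
      Complex.exp (-(Complex.I * ((inner ℝ q.1.1 q.1.2 / 2 : ℝ) : ℂ))) *
        (phase q.1.1 ((2 * Real.pi) • q.2 - q.1.2) *
          (𝓕 (gauss (d := d)) : 𝓢(Rd d, ℂ)) (q.2 - (2 * Real.pi)⁻¹ • q.1.2)) := by
    intro q
    rw [coherent, FourierTransform.fourier_smul, _root_.smul_apply, fourier_tfShift, smul_eq_mul]
  simp only [h]
  unfold phase
  fun_prop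

theorem norm_fourier_coherent (z : Rd d × Rd d) (η : Rd d) :
    ‖(𝓕 (coherent z) : 𝓢(Rd d, ℂ)) η‖ =
      ‖(𝓕 (gauss (d := d)) : 𝓢(Rd d, ℂ)) (η - (2 * Real.pi)⁻¹ • z.2)‖ := by
  rw [coherent, FourierTransform.fourier_smul, _root_.smul_apply, norm_smul, norm_coherent_factor,
    one_mul, norm_fourier_tfShift]

section FourierOne

/-- The modulus of the Fourier transform of a coherent state is a translate of that of the Gaussian,
so its `L¹` norm does not depend on the centre. -/
theorem integrable_gabor_mul_fourier_coherent {G : Rd d × Rd d → ℂ} (hG : Integrable G) :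
    Integrable (fun q : (Rd d × Rd d) × Rd d => G q.1 * (𝓕 (coherent q.1) : 𝓢(Rd d, ℂ)) q.2)
      (volume.prod volume) := by
  refine (integrable_prod_iff ?_).2 ⟨.of_forall fun z => ?_, ?_⟩
  · exact (hG.1.comp_quasiMeasurePreserving Measure.quasiMeasurePreserving_fst).mul
      continuous_fourier_coherent.aestronglyMeasurable
  · exact ((𝓕 (coherent z) : 𝓢(Rd d, ℂ)).integrable (μ := volume)).const_mul (G z)
  · have : ∀ z, ∫ η, ‖G z * (𝓕 (coherent z) : 𝓢(Rd d, ℂ)) η‖ =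
        ‖G z‖ * ∫ η, ‖(𝓕 (gauss (d := d)) : 𝓢(Rd d, ℂ)) η‖ := by
      intro z
      simp only [norm_mul, norm_fourier_coherent]
      rw [integral_const_mul,
        integral_sub_right_eq_self fun η => ‖(𝓕 (gauss (d := d)) : 𝓢(Rd d, ℂ)) η‖]
    simp only [this]
    exact hG.norm.mul_const _

/-- The function whose inverse Fourier transform has the given integrable Gabor transform. -/
def fourierSynthesis (G : Rd d × Rd d → ℂ) (η : Rd d) : ℂ :=
  gaborConst d * ∫ z, G z * (𝓕 (coherent z) : 𝓢(Rd d, ℂ)) η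

theorem integrable_fourierSynthesis {G : Rd d × Rd d → ℂ} (hG : Integrable G) :
    Integrable (fourierSynthesis G) :=
  ((integrable_gabor_mul_fourier_coherent hG).integral_prod_right).const_mul _

theorem integral_norm_fourierSynthesis_le {G : Rd d × Rd d → ℂ} (hG : Integrable G) :
    ∫ η, ‖fourierSynthesis G η‖ ≤
      (gaborConst d * ∫ η, ‖(𝓕 (gauss (d := d)) : 𝓢(Rd d, ℂ)) η‖) * ∫ z, ‖G z‖ := by
  have hI := integrable_gabor_mul_fourier_coherent hG
  calc _ ≤ ∫ η, gaborConst d * ∫ z, ‖G z * (𝓕 (coherent z) : 𝓢(Rd d, ℂ)) η‖ := by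
        refine integral_mono (integrable_fourierSynthesis hG).norm
          ((hI.norm.integral_prod_right).const_mul _) fun η => ?_
        dsimp only
        rw [fourierSynthesis, norm_mul, Complex.norm_real, Real.norm_of_nonneg gaborConst_pos.le]
        exact mul_le_mul_of_nonneg_left (norm_integral_le_integral_norm _) gaborConst_pos.le
    _ = gaborConst d * ∫ z, ∫ η, ‖G z * (𝓕 (coherent z) : 𝓢(Rd d, ℂ)) η‖ := by
        rw [integral_const_mul]
        congr 1
        exact (integral_integral_swap hI.norm).symm
    _ = gaborConst d * ∫ z, ‖G z‖ * ∫ η, ‖(𝓕 (gauss (d := d)) : 𝓢(Rd d, ℂ)) η‖ := by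
        congr 1
        refine integral_congr_ae (.of_forall fun z => ?_)
        simp only [norm_mul, norm_fourier_coherent]
        rw [integral_const_mul,
          integral_sub_right_eq_self fun η => ‖(𝓕 (gauss (d := d)) : 𝓢(Rd d, ℂ)) η‖]
    _ = _ := by rw [integral_mul_const]; ring

theorem fourierInv_fourierSynthesis {G : Rd d × Rd d → ℂ} (hG : Integrable G) (t : Rd d) :
    (𝓕⁻ (fourierSynthesis G)) t = gaborConst d * ∫ z, G z * coherent z t := by
  have hI := integrable_gabor_mul_fourier_coherent hG
  have hI2 : Integrable (fun q : (Rd d × Rd d) × Rd d => phase (-((2 * Real.pi) • q.2)) t *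
      (G q.1 * (𝓕 (coherent q.1) : 𝓢(Rd d, ℂ)) q.2)) (volume.prod volume) :=
    hI.bdd_mul (c := 1) (by unfold phase; fun_prop : Continuous fun q : (Rd d × Rd d) × Rd d =>
      phase (-((2 * Real.pi) • q.2)) t).aestronglyMeasurable (.of_forall fun q => (norm_phase _ _).le)
  have e : ∀ z, G z * coherent z t = ∫ η, phase (-((2 * Real.pi) • η)) t *
      (G z * (𝓕 (coherent z) : 𝓢(Rd d, ℂ)) η) := by
    intro z
    have h1 : coherent z t = (𝓕⁻ (⇑(𝓕 (coherent z) : 𝓢(Rd d, ℂ)))) t := by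
      rw [← SchwartzMap.fourierInv_coe, FourierTransform.fourierInv_fourier_eq]
    rw [h1, fourierInv_eq_phase, ← integral_const_mul]
    refine integral_congr_ae (.of_forall fun η => ?_)
    ring
  simp only [e]
  rw [integral_integral_swap hI2, fourierInv_eq_phase, ← integral_const_mul]
  refine integral_congr_ae (.of_forall fun η => ?_)
  dsimp only
  rw [fourierSynthesis, integral_const_mul]
  ring

/-- A square integrable function with integrable Gabor transform is an inverse Fourier transform. -/
theorem fourierInv_fourierSynthesis_gabor {F : Lp ℂ 2 (volume : Measure (Rd d))}
    (hG : Integrable (gabor F)) : (𝓕⁻ (fourierSynthesis (gabor F))) =ᵐ[volume] F := by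
  have hL : LocallyIntegrable F volume := (Lp.memLp F).locallyIntegrable (by norm_num)
  have hI := continuous_fourierInv_of_integrable (integrable_fourierSynthesis hG)
  refine ae_eq_of_integral_schwartz_mul_eq hI.locallyIntegrable hL fun φ => ?_
  -- Parseval moves the pairing with a test function to phase space; by Fubini it then becomes the
  -- pairing with the superposition of coherent states.
  have h1 : ∫ t, φ t * F t = ∫ z, gabor F z * (gaborConst d * ∫ t, coherent z t * φ t) := by
    rw [← (isRepresentedBy_coe F φ).2, coe_apply_eq_inner, inner_eq_integral_gabor, gabor_toLp]
    refine integral_congr_ae (.of_forall fun z => ?_)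
    dsimp only
    have hc : (starRingEnd ℂ) (gabor (conjS φ) z) = gaborConst d * ∫ t, coherent z t * φ t := by
      rw [gabor, map_mul, Complex.conj_ofReal, ← integral_conj]
      simp
    rw [hc, mul_comm]
  have hm : Integrable (fun q : Rd d × (Rd d × Rd d) => coherent q.2 q.1 * (φ q.1 * gabor F q.2))
      (volume.prod volume) := by
    refine ((φ.integrable).mul_prod hG).bdd_mul (c := 1) ?_ (.of_forall fun q => ?_)
    · simp only [coherent_apply]
      exact (by fun_prop : Continuous _).aestronglyMeasurable
    · rw [norm_coherent_apply, Real.exp_le_one_iff]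
      have := sq_nonneg ‖q.1 - q.2.1‖
      linarith
  have e1 : ∀ t, φ t * (𝓕⁻ (fourierSynthesis (gabor F))) t =
      gaborConst d * ∫ z, coherent z t * (φ t * gabor F z) := by
    intro t
    rw [fourierInv_fourierSynthesis hG, mul_left_comm, ← integral_const_mul]
    congr 1
    refine integral_congr_ae (.of_forall fun z => ?_)
    ring
  have e2 : ∀ z, gabor F z * (gaborConst d * ∫ t, coherent z t * φ t) =
      gaborConst d * ∫ t, coherent z t * (φ t * gabor F z) := by
    intro z
    rw [mul_left_comm, ← integral_const_mul]
    congr 1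
    refine integral_congr_ae (.of_forall fun t => ?_)
    ring
  rw [h1]
  simp only [e1, e2]
  rw [integral_const_mul, integral_const_mul, integral_integral_swap hm]

end FourierOne

/-! ### Maps that are Lipschitz on balls -/

section Lipschitz

variable {X E F G : Type*} [SeminormedAddCommGroup X] [SeminormedAddCommGroup E]
  [SeminormedAddCommGroup F] [SeminormedAddCommGroup G]

/-- The map is Lipschitz continuous on every ball around the origin. -/
def LipschitzOnBalls (f : X → E) : Prop :=
  ∀ R : ℝ, ∃ L : NNReal, LipschitzOnWith L f (Metric.closedBall 0 R)

theorem LipschitzOnBalls.of_le {f : X → E}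
    (h : ∀ R : ℝ, 0 ≤ R → ∃ L : ℝ, 0 ≤ L ∧ ∀ x y, ‖x‖ ≤ R → ‖y‖ ≤ R → ‖f x - f y‖ ≤ L * ‖x - y‖) :
    LipschitzOnBalls f := by
  intro R
  -- `LipschitzOnBalls` quantifies over negative radii as well; the maximum with `0` covers them.
  obtain ⟨L, hL, h⟩ := h (max R 0) (le_max_right _ _)
  refine ⟨⟨L, hL⟩, LipschitzOnWith.of_dist_le_mul fun x hx y hy => ?_⟩
  rw [mem_closedBall_zero_iff] at hx hy
  rw [dist_eq_norm, dist_eq_norm]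
  exact h x y (hx.trans (le_max_left _ _)) (hy.trans (le_max_left _ _))

theorem LipschitzOnBalls.exists_bound {f : X → E} (hf : LipschitzOnBalls f) (R : ℝ) (hR : 0 ≤ R) :
    ∃ L B : ℝ, 0 ≤ L ∧ 0 ≤ B ∧ (∀ x, ‖x‖ ≤ R → ‖f x‖ ≤ B) ∧
      ∀ x y, ‖x‖ ≤ R → ‖y‖ ≤ R → ‖f x - f y‖ ≤ L * ‖x - y‖ := by
  obtain ⟨L, hL⟩ := hf R
  have h1 : ∀ x y, ‖x‖ ≤ R → ‖y‖ ≤ R → ‖f x - f y‖ ≤ L * ‖x - y‖ := fun x y hx hy => by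
    rw [← dist_eq_norm, ← dist_eq_norm]
    exact hL.dist_le_mul x (mem_closedBall_zero_iff.2 hx) y (mem_closedBall_zero_iff.2 hy)
  refine ⟨L, ‖f 0‖ + L * R, L.2, by positivity, fun x hx => ?_, h1⟩
  have h2 := h1 x 0 hx (by simpa using hR)
  rw [sub_zero] at h2
  calc ‖f x‖ ≤ ‖f 0‖ + ‖f x - f 0‖ := norm_le_insert' _ _
    _ ≤ _ := by gcongr; exact h2.trans (by gcongr)

theorem LipschitzOnBalls.continuous {f : X → E} (hf : LipschitzOnBalls f) : Continuous f := by
  refine continuous_iff_continuousAt.2 fun x => ?_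
  obtain ⟨L, hL⟩ := hf (‖x‖ + 1)
  exact hL.continuousOn.continuousAt (Metric.closedBall_mem_nhds_of_mem (by simp))

/-- Only compatibility with differences is asked for, which admits maps that are conjugate linear in
one variable, such as `potentialSymbol`. -/
theorem LipschitzOnBalls.bilinear {B : E → F → G} {C : ℝ} (hC : 0 ≤ C)
    (hb : ∀ x y, ‖B x y‖ ≤ C * ‖x‖ * ‖y‖) (hl : ∀ x x' y, B (x - x') y = B x y - B x' y)
    (hr : ∀ x y y', B x (y - y') = B x y - B x y') {f : X → E} {g : X → F}
    (hf : LipschitzOnBalls f) (hg : LipschitzOnBalls g) :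
    LipschitzOnBalls fun x => B (f x) (g x) := by
  refine LipschitzOnBalls.of_le fun R hR => ?_
  obtain ⟨Lf, Bf, hLf, hBf, hf1, hf2⟩ := hf.exists_bound R hR
  obtain ⟨Lg, Bg, hLg, hBg, hg1, hg2⟩ := hg.exists_bound R hR
  refine ⟨C * Lf * Bg + C * Bf * Lg, by positivity, fun x y hx hy => ?_⟩
  have e : B (f x) (g x) - B (f y) (g y) = B (f x - f y) (g x) + B (f y) (g x - g y) := by
    rw [hl, hr]; abel
  rw [e]
  calc _ ≤ C * ‖f x - f y‖ * ‖g x‖ + C * ‖f y‖ * ‖g x - g y‖ :=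
        (norm_add_le _ _).trans (add_le_add (hb _ _) (hb _ _))
    _ ≤ C * (Lf * ‖x - y‖) * Bg + C * Bf * (Lg * ‖x - y‖) := by
        gcongr
        exacts [hf2 x y hx hy, hg1 x hx, hf1 y hy, hg2 x y hx hy]
    _ = _ := by ring

theorem lipschitzOnBalls_id : LipschitzOnBalls (id : X → X) :=
  .of_le fun _ _ => ⟨1, zero_le_one, fun x y _ _ => by simp⟩

end Lipschitz

/-! ### Powers and the Hartree nonlinearity on the Gabor space -/

instance : Fact ((1 : ℝ≥0∞) ≠ ∞) := ⟨ENNReal.one_ne_top⟩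

namespace GaborSpace

theorem lipschitzOnBalls_mulFourier {p : ℝ≥0∞} [Fact (1 ≤ p)] [Fact (p ≠ ∞)]
    {m : GaborSpace d p → Lp ℂ 1 (volume : Measure (Rd d))}
    {f : GaborSpace d p → GaborSpace d p} (hm : LipschitzOnBalls m) (hf : LipschitzOnBalls f) :
    LipschitzOnBalls fun x => mulFourier (m x) (f x) :=
  LipschitzOnBalls.bilinear
    (B := fun (m : Lp ℂ 1 (volume : Measure (Rd d))) (x : GaborSpace d p) => mulFourier m x)
    zero_le_one (fun m x => by rw [one_mul]; exact norm_mulFourier_le m x)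
    mulFourier_sub_left mulFourier_sub_right hm hf

theorem integrable_gabor (x : GaborSpace d 1) : Integrable (gabor (fn x)) :=
  memLp_one_iff_integrable.1 (memLp_gabor x)

/-- The integrable function whose inverse Fourier transform is `x`. -/
def symbol (x : GaborSpace d 1) : Lp ℂ 1 (volume : Measure (Rd d)) :=
  (integrable_fourierSynthesis (integrable_gabor x)).toL1

theorem coeFn_symbol (x : GaborSpace d 1) :
    symbol x =ᵐ[volume] fourierSynthesis (gabor (fn x)) :=
  Integrable.coeFn_toL1 _

theorem fourierInv_congr {m n : Rd d → ℂ} (h : m =ᵐ[volume] n) : 𝓕⁻ m = 𝓕⁻ n := by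
  ext t
  rw [fourierInv_eq_phase, fourierInv_eq_phase]
  refine integral_congr_ae ?_
  filter_upwards [h] with ξ hξ
  rw [hξ]

theorem fourier_congr {m n : Rd d → ℂ} (h : m =ᵐ[volume] n) : 𝓕 m = 𝓕 n := by
  ext t
  rw [fourier_eq_phase, fourier_eq_phase]
  refine integral_congr_ae ?_
  filter_upwards [h] with ξ hξ
  rw [hξ]

theorem fourierInv_symbol (x : GaborSpace d 1) : 𝓕⁻ (symbol x : Rd d → ℂ) =ᵐ[volume] fn x := by
  rw [fourierInv_congr (coeFn_symbol x)]
  exact fourierInv_fourierSynthesis_gabor (integrable_gabor x)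

theorem symbol_sub (x y : GaborSpace d 1) : symbol (x - y) = symbol x - symbol y := by
  refine Lp.ext ?_
  filter_upwards [coeFn_symbol x, coeFn_symbol y, coeFn_symbol (x - y),
    Lp.coeFn_sub (symbol x) (symbol y),
    (integrable_gabor_mul_fourier_coherent (integrable_gabor x)).prod_left_ae,
    (integrable_gabor_mul_fourier_coherent (integrable_gabor y)).prod_left_ae]
    with η h1 h2 h3 h4 i1 i2
  rw [h3, h4, Pi.sub_apply, h1, h2, fourierSynthesis, fourierSynthesis, fourierSynthesis, map_sub,
    gabor_sub, ← mul_sub, ← integral_sub i1 i2]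
  simp only [Pi.sub_apply, sub_mul]

theorem exists_norm_symbol_le : ∃ C : ℝ, 0 ≤ C ∧ ∀ x : GaborSpace d 1, ‖symbol x‖ ≤ C * ‖x‖ := by
  have hc := gaborConst_pos (d := d)
  refine ⟨gaborConst d * ∫ η, ‖(𝓕 (gauss (d := d)) : 𝓢(Rd d, ℂ)) η‖, by positivity, fun x => ?_⟩
  rw [L1.norm_eq_integral_norm]
  calc _ = ∫ η, ‖fourierSynthesis (gabor (fn x)) η‖ := by
        refine integral_congr_ae ?_
        filter_upwards [coeFn_symbol x] with η h
        rw [h]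
    _ ≤ _ := integral_norm_fourierSynthesis_le (integrable_gabor x)
    _ ≤ _ := by
        refine mul_le_mul_of_nonneg_left ?_ (by positivity)
        have h := eLpNorm_gabor_le x
        rw [eLpNorm_one_eq_lintegral_enorm, ← ofReal_integral_norm_eq_lintegral_enorm
          (integrable_gabor x), ← ofReal_norm] at h
        exact (ENNReal.ofReal_le_ofReal_iff (norm_nonneg _)).1 h

theorem lipschitzOnBalls_symbol : LipschitzOnBalls (symbol (d := d)) := by
  obtain ⟨C, hC, h⟩ := exists_norm_symbol_le (d := d)
  exact .of_le fun R _ => ⟨C, hC, fun x y _ _ => by rw [← symbol_sub]; exact h _⟩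

/-- The power `x ↦ x ^ (k + 1)` on `M^{1,1}`. -/
def power : ℕ → GaborSpace d 1 → GaborSpace d 1
  | 0 => id
  | k + 1 => fun x => mulFourier (symbol x) (power k x)

theorem lipschitzOnBalls_power (k : ℕ) : LipschitzOnBalls (power (d := d) k) := by
  induction k with
  | zero => exact lipschitzOnBalls_id
  | succ k ih =>
    exact lipschitzOnBalls_mulFourier lipschitzOnBalls_symbol ih

theorem coeFn_power (k : ℕ) (x : GaborSpace d 1) :
    fn (power k x) =ᵐ[volume] fun t => fn x t ^ (k + 1) := by
  induction k with
  | zero => exact .of_forall fun t => by simp [power]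
  | succ k ih =>
    filter_upwards [ih, coeFn_mulFourier (symbol x) (power k x), fourierInv_symbol x] with t h1 h2 h3
    rw [power, h2, h3, h1]
    ring

variable {p : ℝ≥0∞} [Fact (1 ≤ p)] {κ : Rd d → ℂ}

theorem _root_.HarmonicNLS.IsAdmissible.integrable (h : IsAdmissible p κ) (a b : GaborSpace d p) :
    Integrable fun ξ => κ ξ * productFourier (fn a) (fn b) ξ := by
  obtain ⟨hκ, C, hC, hb⟩ := h
  exact ⟨hκ.mul (continuous_productFourier _ _).aestronglyMeasurable,
    (hb a b).trans_lt ENNReal.ofReal_lt_top⟩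

/-- The integrable function `κ 𝓕(a b̄)`. -/
def potentialSymbol (h : IsAdmissible p κ) (a b : GaborSpace d p) :
    Lp ℂ 1 (volume : Measure (Rd d)) :=
  (h.integrable a b).toL1

theorem coeFn_potentialSymbol (h : IsAdmissible p κ) (a b : GaborSpace d p) :
    potentialSymbol h a b =ᵐ[volume] fun ξ => κ ξ * productFourier (fn a) (fn b) ξ :=
  Integrable.coeFn_toL1 _

theorem potentialSymbol_sub_left (h : IsAdmissible p κ) (a a' b : GaborSpace d p) :
    potentialSymbol h (a - a') b = potentialSymbol h a b - potentialSymbol h a' b := by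
  refine Lp.ext ?_
  filter_upwards [coeFn_potentialSymbol h a b, coeFn_potentialSymbol h a' b,
    coeFn_potentialSymbol h (a - a') b,
    Lp.coeFn_sub (potentialSymbol h a b) (potentialSymbol h a' b)] with ξ h1 h2 h3 h4
  rw [h3, h4, Pi.sub_apply, h1, h2, map_sub, productFourier_sub_left, mul_sub]

theorem potentialSymbol_sub_right (h : IsAdmissible p κ) (a b b' : GaborSpace d p) :
    potentialSymbol h a (b - b') = potentialSymbol h a b - potentialSymbol h a b' := by
  refine Lp.ext ?_
  filter_upwards [coeFn_potentialSymbol h a b, coeFn_potentialSymbol h a b',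
    coeFn_potentialSymbol h a (b - b'),
    Lp.coeFn_sub (potentialSymbol h a b) (potentialSymbol h a b')] with ξ h1 h2 h3 h4
  rw [h3, h4, Pi.sub_apply, h1, h2, map_sub, productFourier_sub_right, mul_sub]

theorem exists_norm_potentialSymbol_le (h : IsAdmissible p κ) : ∃ C : ℝ, 0 ≤ C ∧
    ∀ a b : GaborSpace d p, ‖potentialSymbol h a b‖ ≤ C * ‖a‖ * ‖b‖ := by
  obtain ⟨C, hC, hb⟩ := h.2
  refine ⟨C, hC, fun a b => ?_⟩
  have h1 : ‖potentialSymbol h a b‖ₑ ≤ ENNReal.ofReal (C * ‖a‖ * ‖b‖) := by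
    rw [Lp.enorm_def, eLpNorm_one_eq_lintegral_enorm]
    refine (lintegral_congr_ae ?_).trans_le (hb a b)
    filter_upwards [coeFn_potentialSymbol h a b] with ξ h1
    rw [h1]
  rw [← ofReal_norm] at h1
  exact (ENNReal.ofReal_le_ofReal_iff (by positivity)).1 h1

variable {k : ℕ} {P : GaborSpace d p → GaborSpace d p} {x : GaborSpace d p}

/-- Writing `|x|^{2k}` as `x^k` times its conjugate fits the bilinear estimate with both arguments
`P x`, so only powers of `x` itself have to be formed. -/
theorem mul_conj_power (hP : fn (P x) =ᵐ[volume] fun t => fn x t ^ k) :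
    (fun t => fn (P x) t * (starRingEnd ℂ) (fn (P x) t)) =ᵐ[volume]
      fun t => ((‖fn x t‖ ^ (2 * k) : ℝ) : ℂ) := by
  filter_upwards [hP] with t ht
  rw [ht, Complex.mul_conj, Complex.normSq_eq_norm_sq, norm_pow, ← pow_mul, mul_comm k]

variable [Fact (p ≠ ∞)]

/-- The Hartree nonlinearity `(K * |x|^{2k}) x`, where `P x = x^k` and `κ = 𝓕 K`. -/
def hartree (h : IsAdmissible p κ) (P : GaborSpace d p → GaborSpace d p) (x : GaborSpace d p) :
    GaborSpace d p :=
  mulFourier (potentialSymbol h (P x) (P x)) x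

theorem lipschitzOnBalls_hartree (h : IsAdmissible p κ) {P : GaborSpace d p → GaborSpace d p}
    (hP : LipschitzOnBalls P) : LipschitzOnBalls (hartree h P) := by
  obtain ⟨C, hC, hb⟩ := exists_norm_potentialSymbol_le h
  exact lipschitzOnBalls_mulFourier (LipschitzOnBalls.bilinear (B := potentialSymbol h) hC hb
    (potentialSymbol_sub_left h) (potentialSymbol_sub_right h) hP hP) lipschitzOnBalls_id

theorem isHartree (hP : fn (P x) =ᵐ[volume] fun t => fn x t ^ k) (h : IsAdmissible p κ)
    {K : 𝓢'(Rd d, ℂ)} (hK : IsRepresentedBy (𝓕 K) κ) :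
    IsHartree K k (fn x : 𝓢'(Rd d, ℂ)) (fn (hartree h P x) : 𝓢'(Rd d, ℂ)) := by
  have e := fourier_congr (mul_conj_power hP)
  have hi := h.integrable (P x) (P x)
  rw [productFourier, e] at hi
  refine ⟨fn x, _, isRepresentedBy_coe _,
    ⟨(integrable_mul_conj _ _).congr (mul_conj_power hP), κ, hK, hi, rfl⟩,
    (isRepresentedBy_coe _).congr ?_⟩
  filter_upwards [coeFn_mulFourier (potentialSymbol h (P x) (P x)) x] with t ht
  rw [hartree, ht, fourierInv_congr (coeFn_potentialSymbol h (P x) (P x)), productFourier, e]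

/-- The functions representing `x` and `𝓕 K` are unique almost everywhere, so every choice allowed
by `IsHartree` leads to the same `N`. Uniqueness of solutions depends on this. -/
theorem eq_of_isHartree (hP : fn (P x) =ᵐ[volume] fun t => fn x t ^ k) (h : IsAdmissible p κ)
    {K : 𝓢'(Rd d, ℂ)} (hK : IsRepresentedBy (𝓕 K) κ)
    {N : 𝓢'(Rd d, ℂ)} (hN : IsHartree K k (fn x : 𝓢'(Rd d, ℂ)) N) :
    N = (fn (hartree h P x) : 𝓢'(Rd d, ℂ)) := by
  obtain ⟨f, V, hf, ⟨-, κ', hκ', -, rfl⟩, hr⟩ := hN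
  have hfx : f =ᵐ[volume] fn x := hf.ae_eq (isRepresentedBy_coe _)
  have hκ : κ' =ᵐ[volume] κ := hκ'.ae_eq hK
  refine hr.unique ((isRepresentedBy_coe _).congr ?_)
  have e : 𝓕 (fun t => ((‖f t‖ ^ (2 * k) : ℝ) : ℂ)) = productFourier (fn (P x)) (fn (P x)) := by
    refine fourier_congr (EventuallyEq.trans ?_ (mul_conj_power hP).symm)
    filter_upwards [hfx] with t ht
    rw [ht]
  filter_upwards [coeFn_mulFourier (potentialSymbol h (P x) (P x)) x, hfx] with t ht h2
  rw [hartree, ht, fourierInv_congr (coeFn_potentialSymbol h (P x) (P x)), h2, e]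
  congr 1
  refine congrFun (fourierInv_congr ?_) t
  filter_upwards [hκ] with ξ hξ
  rw [hξ]

end GaborSpace

/-! ### Distributions in `M^{1,∞}` have bounded Fourier transforms -/

theorem continuous_apply_stftAtom (g : 𝓢(Rd d, ℂ)) (f : 𝓢'(Rd d, ℂ)) :
    Continuous fun z : Rd d × Rd d => f (stftAtom g z.1 z.2) :=
  f.continuous.comp (continuous_stftAtom g)

theorem enorm_stft (g : 𝓢(Rd d, ℂ)) (f : 𝓢'(Rd d, ℂ)) (x y : Rd d) :
    ‖stft g f x y‖ₑ = ENNReal.ofReal ((2 * Real.pi) ^ (-(d : ℝ) / 2)) * ‖f (stftAtom g x y)‖ₑ := by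
  have := Real.pi_pos
  rw [stft, enorm_mul]
  congr 1
  rw [← ofReal_norm, Complex.norm_real, Real.norm_of_nonneg (by positivity)]

theorem stftConst_pos : 0 < (2 * Real.pi) ^ (-(d : ℝ) / 2) := by
  have := Real.pi_pos
  positivity

/-- The inversion formula writes `𝓕 K` as a superposition of the Fourier transforms of
time-frequency shifts of `g`. Their modulus at `η` is `|𝓕 g (η - y/(2π))|`, independent of the
position: the `L¹_x` bound, uniform in `y`, handles position, and integrability of `𝓕 g` handles
frequency. -/
theorem exists_bounded_fourier_of_memModulation {g : 𝓢(Rd d, ℂ)} (hg : g ≠ 0) {K : 𝓢'(Rd d, ℂ)}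
    (hK : MemModulation g 1 ∞ K) : ∃ (κ : Rd d → ℂ) (M : ℝ), AEStronglyMeasurable κ ∧
      (∀ᵐ ξ, ‖κ ξ‖ ≤ M) ∧ IsRepresentedBy (𝓕 K) κ := by
  set a : Rd d × Rd d → ℂ := fun z => K (stftAtom g z.1 z.2) with ha
  have hac : Continuous a := continuous_apply_stftAtom g K
  set Fg : 𝓢(Rd d, ℂ) := 𝓕 g
  obtain ⟨M, hM⟩ : ∃ M : ℝ, ∀ᵐ y : Rd d, ∫⁻ x, ‖a (x, y)‖ₑ ≤ ENNReal.ofReal M := by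
    have h1 : eLpNormEssSup (fun y : Rd d => eLpNorm (fun x : Rd d => stft g K x y) 1 volume)
        volume < ∞ := by
      have := hK
      rwa [MemModulation, modNorm, eLpNorm_exponent_top] at this
    set S := eLpNormEssSup (fun y : Rd d => eLpNorm (fun x : Rd d => stft g K x y) 1 volume) volume
    set c := ENNReal.ofReal ((2 * Real.pi) ^ (-(d : ℝ) / 2))
    have hc : c ≠ 0 := by simpa [c] using stftConst_pos (d := d)
    have hc' : c ≠ ∞ := ENNReal.ofReal_ne_top
    have hS : c⁻¹ * S ≠ ∞ := ENNReal.mul_ne_top (ENNReal.inv_ne_top.2 hc) h1.ne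
    refine ⟨(c⁻¹ * S).toReal, ?_⟩
    filter_upwards [enorm_ae_le_eLpNormEssSup (fun y : Rd d => eLpNorm (fun x : Rd d =>
      stft g K x y) 1 volume) volume] with y hy
    rw [ENNReal.ofReal_toReal hS, ← ENNReal.mul_le_iff_le_inv hc hc']
    refine le_trans (le_of_eq ?_) hy
    simp only [enorm_eq_self, eLpNorm_one_eq_lintegral_enorm, enorm_stft]
    rw [lintegral_const_mul]
    exact (hac.comp (by fun_prop : Continuous fun x : Rd d => (x, y))).enorm.measurable
  have hFc : Continuous fun q : Rd d × (Rd d × Rd d) => (𝓕 (tfShift g q.2) : 𝓢(Rd d, ℂ)) q.1 := by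
    simp only [fourier_tfShift]
    unfold phase
    fun_prop
  -- the basic estimate, uniformly in the frequency
  set I : ℝ≥0∞ := ∫⁻ y, ‖Fg ((2 * Real.pi)⁻¹ • y)‖ₑ
  have hI : I ≠ ∞ := by
    have h := (Fg.integrable (μ := volume)).comp_smul (inv_ne_zero (by positivity : 2 * Real.pi ≠ 0))
    exact h.2.ne
  have hB : ∀ η, ∫⁻ z, ‖(𝓕 (tfShift g z) : 𝓢(Rd d, ℂ)) η * a z‖ₑ ≤ I * ENNReal.ofReal M := by
    intro η
    have hm : Measurable fun z : Rd d × Rd d => ‖(𝓕 (tfShift g z) : 𝓢(Rd d, ℂ)) η * a z‖ₑ :=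
      (((hFc.comp (by fun_prop : Continuous fun z : Rd d × Rd d => (η, z)))).mul hac).enorm.measurable
    rw [Measure.volume_eq_prod, lintegral_prod_symm _ hm.aemeasurable]
    calc _ ≤ ∫⁻ y, ‖Fg (η - (2 * Real.pi)⁻¹ • y)‖ₑ * ENNReal.ofReal M := by
          refine lintegral_mono_ae ?_
          filter_upwards [hM] with y hy
          have : ∀ x, ‖(𝓕 (tfShift g (x, y)) : 𝓢(Rd d, ℂ)) η * a (x, y)‖ₑ =
              ‖Fg (η - (2 * Real.pi)⁻¹ • y)‖ₑ * ‖a (x, y)‖ₑ := by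
            intro x
            rw [enorm_mul, ← ofReal_norm, norm_fourier_tfShift, ofReal_norm]
          simp only [this]
          rw [lintegral_const_mul]
          · gcongr
          · exact (hac.comp (by fun_prop : Continuous fun x : Rd d => (x, y))).enorm.measurable
      _ = (∫⁻ y, ‖Fg (η - (2 * Real.pi)⁻¹ • y)‖ₑ) * ENNReal.ofReal M := by
          rw [lintegral_mul_const]
          exact (Fg.continuous.comp
            (by fun_prop : Continuous fun y : Rd d => η - (2 * Real.pi)⁻¹ • y)).enorm.measurable
      _ = I * ENNReal.ofReal M := by
          congr 1
          have e : ∀ y, ‖Fg (η - (2 * Real.pi)⁻¹ • y)‖ₑ =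
              (fun y => ‖Fg ((2 * Real.pi)⁻¹ • y)‖ₑ) ((2 * Real.pi) • η - y) := by
            intro y
            have : 2 * Real.pi ≠ 0 := by positivity
            simp only [smul_sub, smul_smul, inv_mul_cancel₀ this, one_smul]
          simp only [e]
          exact lintegral_sub_left_eq_self (fun y => ‖Fg ((2 * Real.pi)⁻¹ • y)‖ₑ) _
  have hwc := windowConst_ne_zero hg
  set κ : Rd d → ℂ := fun η => (windowConst g)⁻¹ *
    ∫ z, (𝓕 (tfShift g z) : 𝓢(Rd d, ℂ)) η * a z with hκ
  have hmeas : AEStronglyMeasurable κ := by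
    have : AEStronglyMeasurable (fun q : Rd d × (Rd d × Rd d) =>
        (𝓕 (tfShift g q.2) : 𝓢(Rd d, ℂ)) q.1 * a q.2) (volume.prod volume) :=
      (hFc.mul (hac.comp continuous_snd)).aestronglyMeasurable
    exact this.integral_prod_right'.const_mul _
  refine ⟨κ, ‖(windowConst g)⁻¹‖ * (I * ENNReal.ofReal M).toReal, hmeas, .of_forall fun η => ?_,
    fun φ => ?_⟩
  · rw [hκ, norm_mul]
    gcongr
    rw [← toReal_enorm]
    exact ENNReal.toReal_mono (by finiteness)
      ((enorm_integral_le_lintegral_enorm _).trans (hB η))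
  · have hprod : Integrable (fun q : Rd d × (Rd d × Rd d) => φ q.1 *
        ((𝓕 (tfShift g q.2) : 𝓢(Rd d, ℂ)) q.1 * a q.2)) (volume.prod volume) := by
      refine ⟨((φ.continuous.comp continuous_fst).mul
        (hFc.mul (hac.comp continuous_snd))).aestronglyMeasurable, ?_⟩
      have hm : AEMeasurable (fun q : Rd d × (Rd d × Rd d) => ‖φ q.1 *
          ((𝓕 (tfShift g q.2) : 𝓢(Rd d, ℂ)) q.1 * a q.2)‖ₑ) (volume.prod volume) :=
        ((φ.continuous.comp continuous_fst).mul
          (hFc.mul (hac.comp continuous_snd))).enorm.measurable.aemeasurable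
      rw [HasFiniteIntegral, lintegral_prod _ hm]
      calc _ ≤ ∫⁻ η, ‖φ η‖ₑ * (I * ENNReal.ofReal M) := by
            refine lintegral_mono fun η => ?_
            simp only [enorm_mul (φ η)]
            rw [lintegral_const_mul' _ _ enorm_ne_top]
            gcongr
            exact hB η
        _ < ∞ := by
            rw [lintegral_mul_const' _ _ (by finiteness)]
            exact ENNReal.mul_lt_top (φ.integrable (μ := volume)).2 (by finiteness)
    have e1 : ∀ η, φ η * κ η = (windowConst g)⁻¹ *
        ∫ z, φ η * ((𝓕 (tfShift g z) : 𝓢(Rd d, ℂ)) η * a z) := by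
      intro η
      rw [integral_const_mul]
      ring
    constructor
    · simp only [e1]
      exact hprod.integral_prod_left.const_mul _
    · simp only [e1]
      -- Testing `𝓕 K` on `φ` is testing `K` on `𝓕 φ`, to which the inversion formula applies;
      -- Parseval rewrites its coefficients as integrals over `η`.
      rw [integral_const_mul, integral_integral_swap hprod, TemperedDistribution.fourier_apply,
        eq_inv_mul_iff_mul_eq₀ hwc, windowConst_mul_apply g (𝓕 φ) hg K]
      refine integral_congr_ae (.of_forall fun z => ?_)
      dsimp only
      rw [amb_eq_fourier, FourierTransform.fourierInv_fourier_eq, ← integral_mul_const]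
      refine integral_congr_ae (.of_forall fun η => ?_)
      simp only [ha]
      ring

/-! ### The Gabor transform of a tempered distribution -/

/-- The Gabor transform of a tempered distribution. -/
def gaborDist (f : 𝓢'(Rd d, ℂ)) (z : Rd d × Rd d) : ℂ := gaborConst d * f (conjS (coherent z))

theorem gaborDist_coe (F : Lp ℂ 2 (volume : Measure (Rd d))) :
    gaborDist (F : 𝓢'(Rd d, ℂ)) = gabor F := by
  ext z
  rw [gaborDist, coe_apply_eq_inner, conjS_conjS, gabor_eq_inner]

theorem continuous_gaborDist (f : 𝓢'(Rd d, ℂ)) : Continuous (gaborDist f) := by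
  have h : gaborDist f = fun z => gaborConst d *
      (Complex.exp (Complex.I * ((inner ℝ z.1 z.2 / 2 : ℝ) : ℂ)) * f (stftAtom gauss z.1 z.2)) := by
    ext z
    rw [gaborDist, conjS_coherent, map_smul, smul_eq_mul]
  rw [h]
  exact continuous_const.mul ((by fun_prop : Continuous fun z : Rd d × Rd d =>
    Complex.exp (Complex.I * ((inner ℝ z.1 z.2 / 2 : ℝ) : ℂ))).mul
      (continuous_apply_stftAtom gauss f))

theorem gaborConst_sq_mul_windowConst :
    ((gaborConst d : ℝ) : ℂ) ^ 2 * windowConst (gauss : 𝓢(Rd d, ℂ)) = 1 := by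
  have h := gaborConst_sq (d := d)
  rw [windowConst]
  exact_mod_cast h

/-- The reproducing formula for tempered distributions. -/
theorem apply_eq_integral_gaborDist (f : 𝓢'(Rd d, ℂ)) (φ : 𝓢(Rd d, ℂ)) :
    f φ = ∫ z, (starRingEnd ℂ) (gabor (conjS φ) z) * gaborDist f z := by
  have h := windowConst_mul_apply gauss φ gauss_ne_zero f
  have h2 : f φ = ((gaborConst d : ℝ) : ℂ) ^ 2 *
      ∫ z, amb gauss φ z * f (stftAtom gauss z.1 z.2) := by
    rw [← h, ← mul_assoc, gaborConst_sq_mul_windowConst, one_mul]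
  rw [h2, ← integral_const_mul]
  refine integral_congr_ae (.of_forall fun z => ?_)
  have h3 : (starRingEnd ℂ) (gabor (conjS φ) z) = gaborConst d *
      (Complex.exp (-(Complex.I * ((inner ℝ z.1 z.2 / 2 : ℝ) : ℂ))) * amb gauss φ z) := by
    rw [gabor, map_mul, Complex.conj_ofReal, ← integral_conj, amb]
    refine congrArg _ ?_
    rw [← integral_const_mul]
    refine integral_congr_ae (.of_forall fun t => ?_)
    simp only [map_mul, Complex.conj_conj, conjS_apply, coherent, _root_.smul_apply,
      smul_eq_mul]
    ring
  have h4 : Complex.exp (-(Complex.I * ((inner ℝ z.1 z.2 / 2 : ℝ) : ℂ))) *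
      Complex.exp (Complex.I * ((inner ℝ z.1 z.2 / 2 : ℝ) : ℂ)) = 1 := by
    rw [← Complex.exp_add, neg_add_cancel, Complex.exp_zero]
  dsimp only
  rw [h3, gaborDist, conjS_coherent, map_smul, smul_eq_mul]
  linear_combination -(((gaborConst d : ℝ) : ℂ) ^ 2 * amb gauss φ z *
    f (stftAtom gauss z.1 z.2)) * h4

/-- The counterpart of `enorm_gabor_le` for distributions; it is used to prove membership in `L²`
and therefore cannot presuppose it. -/
theorem enorm_gaborDist_le (f : 𝓢'(Rd d, ℂ)) (z : Rd d × Rd d) :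
    ‖gaborDist f z‖ₑ ≤ ∫⁻ w, ENNReal.ofReal (gaborKernel z w) * ‖gaborDist f w‖ₑ := by
  rw [gaborDist, apply_eq_integral_gaborDist, ← integral_const_mul, conjS_conjS]
  refine (enorm_integral_le_lintegral_enorm _).trans (lintegral_mono fun w => ?_)
  rw [← mul_assoc, enorm_mul, ← norm_gabor_coherent]
  gcongr
  rw [enorm_mul, RCLike.enorm_conj, ← ofReal_norm, ← ofReal_norm, Complex.norm_real,
    Real.norm_of_nonneg gaborConst_pos.le, ENNReal.ofReal_mul gaborConst_pos.le]

/-! ### Change of window -/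

/-- Time-frequency shifts compose up to a unimodular factor, so the modulus depends on `z - w` only.
A change of window thus becomes a convolution estimate on phase space. -/
theorem norm_gabor_tfShift (g : 𝓢(Rd d, ℂ)) (z w : Rd d × Rd d) :
    ‖gabor (tfShift g z) w‖ = gaborConst d * ‖amb g gauss (z - w)‖ := by
  have h : ∫ t, (starRingEnd ℂ) (coherent w t) * tfShift g z t =
      Complex.exp (Complex.I * ((inner ℝ w.1 w.2 / 2 + inner ℝ (z.2 - w.2) w.1 : ℝ) : ℂ)) *
        ∫ t, tfShift g (z - w) t * gauss t := by
    rw [← integral_add_right_eq_self _ w.1, ← integral_const_mul]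
    refine integral_congr_ae (.of_forall fun t => ?_)
    simp only [coherent_apply, tfShift_apply, gauss_apply, phase, ← Complex.exp_conj, Prod.fst_sub,
      Prod.snd_sub, add_sub_cancel_right, Complex.ofReal_exp, map_add, map_mul, Complex.conj_I,
      Complex.conj_ofReal]
    rw [show t + w.1 - z.1 = t - (z.1 - w.1) by abel]
    have e : Complex.exp (-Complex.I * ((inner ℝ w.2 (t + w.1) - inner ℝ w.1 w.2 / 2 : ℝ) : ℂ) +
        ((-‖t‖ ^ 2 / 2 : ℝ) : ℂ)) *
        Complex.exp (-(Complex.I * ((inner ℝ (-z.2) (t + w.1) : ℝ) : ℂ))) =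
        Complex.exp (Complex.I * ((inner ℝ w.1 w.2 / 2 + inner ℝ (z.2 - w.2) w.1 : ℝ) : ℂ)) *
        (Complex.exp (-(Complex.I * ((inner ℝ (-(z.2 - w.2)) t : ℝ) : ℂ))) *
          Complex.exp ((-‖t‖ ^ 2 / 2 : ℝ) : ℂ)) := by
      rw [← Complex.exp_add, ← Complex.exp_add, ← Complex.exp_add]
      congr 1
      simp only [inner_add_right, inner_neg_left, inner_sub_left, real_inner_comm w.2 w.1]
      push_cast
      ring
    linear_combination g (t - (z.1 - w.1)) * e
  rw [gabor, h, norm_mul, norm_mul, Complex.norm_exp, Complex.norm_real,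
    Real.norm_of_nonneg gaborConst_pos.le, amb]
  simp

/-- The kernel for the passage between the window `g` and the Gaussian window. -/
def windowKernel (g : 𝓢(Rd d, ℂ)) (z w : Rd d × Rd d) : ℝ≥0∞ := ‖amb g gauss (z - w)‖ₑ

theorem measurable_windowKernel (g : 𝓢(Rd d, ℂ)) :
    Measurable (Function.uncurry (windowKernel g)) :=
  ((continuous_amb g gauss).comp (continuous_fst.sub continuous_snd)).enorm.measurable

theorem lintegral_windowKernel_lt_top (g : 𝓢(Rd d, ℂ)) : ∫⁻ z, ‖amb g gauss z‖ₑ < ∞ :=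
  (integrable_amb g gauss).2

theorem lintegral_windowKernel_left (g : 𝓢(Rd d, ℂ)) (w : Rd d × Rd d) :
    ∫⁻ z, windowKernel g z w = ∫⁻ z, ‖amb g gauss z‖ₑ :=
  lintegral_sub_right_eq_self (fun z => ‖amb g gauss z‖ₑ) w

theorem lintegral_windowKernel_right (g : 𝓢(Rd d, ℂ)) (z : Rd d × Rd d) :
    ∫⁻ w, windowKernel g z w = ∫⁻ z, ‖amb g gauss z‖ₑ := by
  have : (volume : Measure (Rd d × Rd d)).IsNegInvariant :=
    Measure.IsAddHaarMeasure.isNegInvariant_of_regular _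
  exact lintegral_sub_left_eq_self (fun z => ‖amb g gauss z‖ₑ) z

/-- From the Gaussian window to `g`: the reproducing formula with coherent states is applied to the
atoms of `g`. -/
theorem enorm_apply_stftAtom_le (g : 𝓢(Rd d, ℂ)) (f : 𝓢'(Rd d, ℂ)) (z : Rd d × Rd d) :
    ‖f (stftAtom g z.1 z.2)‖ₑ ≤
      ENNReal.ofReal (gaborConst d) * ∫⁻ w, windowKernel g z w * ‖gaborDist f w‖ₑ := by
  rw [apply_eq_integral_gaborDist, ← conjS_tfShift, conjS_conjS]
  refine (enorm_integral_le_lintegral_enorm _).trans_eq ?_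
  rw [← lintegral_const_mul' _ _ ENNReal.ofReal_ne_top]
  refine lintegral_congr fun w => ?_
  rw [enorm_mul, RCLike.enorm_conj, ← ofReal_norm, norm_gabor_tfShift,
    ENNReal.ofReal_mul gaborConst_pos.le, ofReal_norm, windowKernel, mul_assoc]

/-- From `g` back to the Gaussian: now the inversion formula is used with the window `g`, whose
constant must be invertible. -/
theorem exists_enorm_gaborDist_le {g : 𝓢(Rd d, ℂ)} (hg : g ≠ 0) : ∃ C : ℝ≥0∞, C ≠ ∞ ∧
    ∀ (f : 𝓢'(Rd d, ℂ)) (w : Rd d × Rd d), ‖gaborDist f w‖ₑ ≤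
      C * ∫⁻ z, windowKernel g z w * ‖f (stftAtom g z.1 z.2)‖ₑ := by
  have hw := windowConst_ne_zero hg
  refine ⟨‖(windowConst g)⁻¹‖ₑ * ENNReal.ofReal (gaborConst d), by finiteness, fun f w => ?_⟩
  have h : gaborDist f w = (windowConst g)⁻¹ * ∫ z, (gaborConst d * amb g (conjS (coherent w)) z) *
      f (stftAtom g z.1 z.2) := by
    rw [gaborDist, eq_inv_mul_iff_mul_eq₀ hw, mul_left_comm, windowConst_mul_apply g _ hg f,
      ← integral_const_mul]
    simp only [mul_assoc]
  rw [h, enorm_mul, mul_assoc]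
  gcongr
  refine (enorm_integral_le_lintegral_enorm _).trans_eq ?_
  rw [← lintegral_const_mul' _ _ ENNReal.ofReal_ne_top]
  refine lintegral_congr fun z => ?_
  have e : gaborConst d * amb g (conjS (coherent w)) z = gabor (tfShift g z) w := by
    rw [gabor, amb]
    congr 1
    refine integral_congr_ae (.of_forall fun t => ?_)
    simp only [conjS_apply, mul_comm]
  rw [e, enorm_mul, ← ofReal_norm, norm_gabor_tfShift, ENNReal.ofReal_mul gaborConst_pos.le,
    ofReal_norm, windowKernel, mul_assoc]

/-! ### The modulation norm and the norm of the Gabor space -/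

section ModNorm

variable {p : ℝ≥0∞} [Fact (1 ≤ p)] [Fact (p ≠ ∞)]

theorem eLpNorm_eLpNorm_rpow {F : Rd d × Rd d → ℂ} (hF : Continuous F) :
    eLpNorm (fun y => eLpNorm (fun x => F (x, y)) p volume) p volume ^ p.toReal =
      ∫⁻ z, ‖F z‖ₑ ^ p.toReal := by
  have h0 : p ≠ 0 := (zero_lt_one.trans_le Fact.out).ne'
  have hpt : p ≠ ∞ := Fact.out
  have hp := one_le_toReal p
  have hm : Measurable fun z => ‖F z‖ₑ ^ p.toReal := hF.enorm.measurable.pow_const _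
  rw [eLpNorm_eq_lintegral_rpow_enorm_toReal h0 hpt, ← ENNReal.rpow_mul,
    one_div_mul_cancel (by linarith), ENNReal.rpow_one, Measure.volume_eq_prod,
    lintegral_prod_symm' _ hm]
  simp only [enorm_eq_self, eLpNorm_eq_rpow]

theorem modNorm_rpow (g : 𝓢(Rd d, ℂ)) (f : 𝓢'(Rd d, ℂ)) :
    modNorm g p p f ^ p.toReal = ENNReal.ofReal ((2 * Real.pi) ^ (-(d : ℝ) / 2)) ^ p.toReal *
      ∫⁻ z : Rd d × Rd d, ‖f (stftAtom g z.1 z.2)‖ₑ ^ p.toReal := by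
  have hp := one_le_toReal p
  obtain ⟨F, hF⟩ : ∃ F : Rd d × Rd d → ℂ, F = fun z => stft g f z.1 z.2 := ⟨_, rfl⟩
  have hc : Continuous F := by
    rw [hF]
    exact continuous_const.mul (continuous_apply_stftAtom g f)
  have h : modNorm g p p f =
      eLpNorm (fun y => eLpNorm (fun x => F (x, y)) p volume) p volume := by
    rw [hF, modNorm]
  rw [h, eLpNorm_eLpNorm_rpow hc, ← lintegral_const_mul' _ _ (by finiteness)]
  refine lintegral_congr fun z => ?_
  rw [← ENNReal.mul_rpow_of_nonneg _ _ (zero_le_one.trans hp), ← enorm_stft, hF]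

open GaborSpace

/-- The window kernel has the same finite integral in either variable, so Schur's test transfers the
`L^p` bound. -/
theorem exists_modNorm_le (g : 𝓢(Rd d, ℂ)) : ∃ C : ℝ≥0∞, C ≠ ∞ ∧ ∀ x : GaborSpace d p,
    modNorm g p p (fn x : 𝓢'(Rd d, ℂ)) ≤ C * ‖x‖ₑ := by
  have hp := one_le_toReal p
  set a := ENNReal.ofReal ((2 * Real.pi) ^ (-(d : ℝ) / 2))
  set b := ENNReal.ofReal (gaborConst d)
  set I := ∫⁻ z, ‖amb g (gauss (d := d)) z‖ₑ
  have hI : I ≠ ∞ := (lintegral_windowKernel_lt_top g).ne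
  refine ⟨a * (b * I), by finiteness, fun x => ?_⟩
  rw [← ENNReal.rpow_le_rpow_iff (zero_lt_one.trans_le hp), modNorm_rpow]
  have h1 : ∫⁻ z : Rd d × Rd d, ‖(fn x : 𝓢'(Rd d, ℂ)) (stftAtom g z.1 z.2)‖ₑ ^ p.toReal ≤
      (b * (I * ‖x‖ₑ)) ^ p.toReal := by
    calc _ ≤ ∫⁻ z, b ^ p.toReal * (∫⁻ w, windowKernel g z w * ‖gabor (fn x) w‖ₑ) ^ p.toReal := by
          refine lintegral_mono fun z => ?_
          dsimp only
          rw [← ENNReal.mul_rpow_of_nonneg _ _ (zero_le_one.trans hp), ← gaborDist_coe]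
          exact ENNReal.rpow_le_rpow (enorm_apply_stftAtom_le g _ z) (by linarith)
      _ = b ^ p.toReal * ∫⁻ z, (∫⁻ w, windowKernel g z w * ‖gabor (fn x) w‖ₑ) ^ p.toReal :=
          lintegral_const_mul' _ _ (by finiteness)
      _ ≤ b ^ p.toReal * (I ^ (p.toReal - 1) * I * ∫⁻ w, ‖gabor (fn x) w‖ₑ ^ p.toReal) := by
          gcongr
          exact lintegral_kernel_rpow_le hp (measurable_windowKernel g)
            (continuous_gabor _).enorm.measurable (fun z => (lintegral_windowKernel_right g z).le)
            (fun w => (lintegral_windowKernel_left g w).le)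
      _ ≤ b ^ p.toReal * (I ^ (p.toReal - 1) * I * ‖x‖ₑ ^ p.toReal) := by
          rw [← eLpNorm_eq_rpow]
          gcongr
          exact eLpNorm_gabor_le x
      _ = _ := by
          rw [ENNReal.mul_rpow_of_nonneg _ _ (zero_le_one.trans hp),
            ENNReal.mul_rpow_of_nonneg _ _ (zero_le_one.trans hp)]
          congr 2
          nth_rewrite 2 [← ENNReal.rpow_one I]
          rw [← ENNReal.rpow_add_of_nonneg _ _ (by linarith) zero_le_one, sub_add_cancel]
  calc _ ≤ a ^ p.toReal * (b * (I * ‖x‖ₑ)) ^ p.toReal := by gcongr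
    _ = _ := by
      rw [← ENNReal.mul_rpow_of_nonneg _ _ (zero_le_one.trans hp)]
      congr 1
      ring

end ModNorm

/-! ### Tempered distributions in the modulation space as elements of the Gabor space -/

/-- The candidate is the adjoint of the Gabor isometry applied to `gaborDist f`; the reproducing
formula for distributions shows that it acts on test functions as `f` does. -/
theorem exists_coe_eq_of_memLp_two {f : 𝓢'(Rd d, ℂ)} (h : MemLp (gaborDist f) 2) :
    ∃ F : Lp ℂ 2 (volume : Measure (Rd d)), (F : 𝓢'(Rd d, ℂ)) = f := by
  refine ⟨ContinuousLinearMap.adjoint gaborL2.toContinuousLinearMap h.toLp, ?_⟩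
  ext φ
  rw [coe_apply_eq_inner, ContinuousLinearMap.adjoint_inner_right, apply_eq_integral_gaborDist f φ,
    L2.inner_def]
  refine integral_congr_ae ?_
  filter_upwards [h.coeFn_toLp, coeFn_gaborL2 ((conjS φ).toLp 2 volume)] with z h1 h2
  rw [h1, LinearIsometry.coe_toContinuousLinearMap, h2, gabor_toLp, RCLike.inner_apply, mul_comm]

section

variable {p : ℝ≥0∞} [Fact (1 ≤ p)] [Fact (p ≠ ∞)]

theorem exists_eLpNorm_gaborDist_le {g : 𝓢(Rd d, ℂ)} (hg : g ≠ 0) : ∃ C : ℝ≥0∞, C ≠ ∞ ∧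
    ∀ f : 𝓢'(Rd d, ℂ), eLpNorm (gaborDist f) p volume ≤ C * modNorm g p p f := by
  have hp := one_le_toReal p
  have hp0 := zero_le_one.trans hp
  obtain ⟨c, hc, hcf⟩ := exists_enorm_gaborDist_le hg
  have ha : ENNReal.ofReal ((2 * Real.pi) ^ (-(d : ℝ) / 2)) ≠ 0 := by
    rw [Ne, ENNReal.ofReal_eq_zero, not_le]
    positivity
  have hI : ∫⁻ z, ‖amb g (gauss (d := d)) z‖ₑ ≠ ∞ := (lintegral_windowKernel_lt_top g).ne
  have hmod := fun f => modNorm_rpow (p := p) g f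
  set a := ENNReal.ofReal ((2 * Real.pi) ^ (-(d : ℝ) / 2))
  set I := ∫⁻ z, ‖amb g (gauss (d := d)) z‖ₑ
  refine ⟨c * (I * a⁻¹), by finiteness, fun f => eLpNorm_le_of_rpow_le ?_⟩
  obtain ⟨G, hG⟩ : ∃ G : Rd d × Rd d → ℝ≥0∞, G = fun z => ‖f (stftAtom g z.1 z.2)‖ₑ := ⟨_, rfl⟩
  have hGm : Measurable G := by
    rw [hG]
    exact (continuous_apply_stftAtom g f).enorm.measurable
  have hcG : ∀ w, ‖gaborDist f w‖ₑ ≤ c * ∫⁻ z, windowKernel g z w * G z := by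
    rw [hG]
    exact hcf f
  have hmG : modNorm g p p f ^ p.toReal = a ^ p.toReal * ∫⁻ z, G z ^ p.toReal := by
    rw [hG]
    exact hmod f
  have hA : Measurable (Function.uncurry fun w z : Rd d × Rd d => windowKernel g z w) :=
    ((continuous_amb g gauss).comp (continuous_snd.sub continuous_fst)).enorm.measurable
  have hf : ∫⁻ z, G z ^ p.toReal = (a⁻¹ * modNorm g p p f) ^ p.toReal := by
    rw [ENNReal.mul_rpow_of_nonneg _ _ hp0, hmG, ← mul_assoc,
      ← ENNReal.mul_rpow_of_nonneg _ _ hp0, ENNReal.inv_mul_cancel ha ENNReal.ofReal_ne_top,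
      ENNReal.one_rpow, one_mul]
  calc _ ≤ ∫⁻ w, c ^ p.toReal *
        (∫⁻ z, windowKernel g z w * G z) ^ p.toReal := by
        refine lintegral_mono fun w => ?_
        dsimp only
        rw [← ENNReal.mul_rpow_of_nonneg _ _ hp0]
        exact ENNReal.rpow_le_rpow (hcG w) hp0
    _ = c ^ p.toReal * ∫⁻ w, (∫⁻ z, windowKernel g z w * G z) ^ p.toReal :=
        lintegral_const_mul' _ _ (by finiteness)
    _ ≤ c ^ p.toReal * (I ^ (p.toReal - 1) * I *
        ∫⁻ z, G z ^ p.toReal) := by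
        gcongr
        exact lintegral_kernel_rpow_le hp hA hGm
          (fun z => (lintegral_windowKernel_left g z).le)
          (fun w => (lintegral_windowKernel_right g w).le)
    _ = (c * (I * (a⁻¹ * modNorm g p p f))) ^ p.toReal := by
        rw [hf, ENNReal.mul_rpow_of_nonneg c _ hp0, ENNReal.mul_rpow_of_nonneg I _ hp0]
        congr 2
        nth_rewrite 2 [← ENNReal.rpow_one I]
        rw [← ENNReal.rpow_add_of_nonneg _ _ (by linarith) zero_le_one, sub_add_cancel]
    _ = _ := by
        congr 1
        ring

/-- Jensen's inequality for the reproducing kernel, which is both integrable and bounded, gives the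
passage from `L^p` to `L^∞`. -/
theorem exists_enorm_gaborDist_le_eLpNorm : ∃ C : ℝ≥0∞, C ≠ ∞ ∧
    ∀ (f : 𝓢'(Rd d, ℂ)) (z : Rd d × Rd d), ‖gaborDist f z‖ₑ ≤
      C * eLpNorm (gaborDist f) p volume := by
  have hp := one_le_toReal p
  have hp0 := zero_le_one.trans hp
  have hJ : ENNReal.ofReal (gaborConst d ^ 2 * gaussMass d) *
      ((∫⁻ x : Rd d, gaussProfile x) * ∫⁻ x : Rd d, gaussProfile x) ≠ ∞ := by
    have := (lintegral_gaussProfile_lt_top (d := d)).ne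
    finiteness
  have hker := lintegral_gaborKernel (d := d)
  set J := ENNReal.ofReal (gaborConst d ^ 2 * gaussMass d) *
      ((∫⁻ x : Rd d, gaussProfile x) * ∫⁻ x : Rd d, gaussProfile x)
  set m := ENNReal.ofReal (gaborConst d ^ 2 * gaussMass d)
  have hm : ∀ z w : Rd d × Rd d, ENNReal.ofReal (gaborKernel z w) ≤ m := by
    intro z w
    rw [ofReal_gaborKernel]
    exact mul_le_of_le_one_right' (mul_le_one' (gaussProfile_le_one _) (gaussProfile_le_one _))
  have hs : p.toReal ≠ 0 := by linarith
  refine ⟨(J ^ (p.toReal - 1) * m) ^ (p.toReal)⁻¹, by finiteness, fun f z => ?_⟩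
  rw [← ENNReal.rpow_le_rpow_iff (zero_lt_one.trans_le hp), ENNReal.mul_rpow_of_nonneg _ _ hp0,
    ← ENNReal.rpow_mul, inv_mul_cancel₀ hs, ENNReal.rpow_one, eLpNorm_eq_rpow]
  have hk : Measurable fun w => ENNReal.ofReal (gaborKernel z w) := by
    unfold gaborKernel
    fun_prop
  calc _ ≤ (∫⁻ w, ENNReal.ofReal (gaborKernel z w) * ‖gaborDist f w‖ₑ) ^ p.toReal :=
        ENNReal.rpow_le_rpow (enorm_gaborDist_le f z) hp0
    _ ≤ J ^ (p.toReal - 1) *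
        ∫⁻ w, ENNReal.ofReal (gaborKernel z w) * ‖gaborDist f w‖ₑ ^ p.toReal := by
        rw [← hker z]
        exact lintegral_mul_rpow_le hp hk.aemeasurable
          (continuous_gaborDist f).enorm.measurable.aemeasurable
    _ ≤ J ^ (p.toReal - 1) * ∫⁻ w, m * ‖gaborDist f w‖ₑ ^ p.toReal := by
        gcongr
        exact hm _ _
    _ = _ := by
        rw [lintegral_const_mul' _ _ ENNReal.ofReal_ne_top, mul_assoc]

/-- Interpolation between `L^p` and the supremum bound. It is the reason why the distributions in
`M^{p,p}`, `p ≤ 2`, are square integrable functions. -/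
theorem exists_eLpNorm_two_gaborDist_le (hp2 : p.toReal ≤ 2) : ∃ C : ℝ≥0∞, C ≠ ∞ ∧
    ∀ f : 𝓢'(Rd d, ℂ), eLpNorm (gaborDist f) 2 volume ≤
      C * eLpNorm (gaborDist f) p volume := by
  have hp := one_le_toReal p
  have hp0 := zero_le_one.trans hp
  have : Fact ((2 : ℝ≥0∞) ≠ ∞) := ⟨by norm_num⟩
  obtain ⟨C, hC, hCf⟩ := exists_enorm_gaborDist_le_eLpNorm (d := d) (p := p)
  have h2 : 0 ≤ 2 - p.toReal := by linarith
  refine ⟨(C ^ (2 - p.toReal)) ^ ((2 : ℝ)⁻¹), by finiteness, fun f => eLpNorm_le_of_rpow_le ?_⟩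
  rw [ENNReal.toReal_ofNat, ENNReal.mul_rpow_of_nonneg _ _ zero_le_two, ← ENNReal.rpow_mul,
    inv_mul_cancel₀ two_ne_zero, ENNReal.rpow_one]
  have e : ∀ x : ℝ≥0∞, x ^ (2 : ℝ) = x ^ (2 - p.toReal) * x ^ p.toReal := fun x => by
    rw [← ENNReal.rpow_add_of_nonneg _ _ h2 hp0, sub_add_cancel]
  have hm : Measurable fun z => ‖gaborDist f z‖ₑ ^ p.toReal :=
    (continuous_gaborDist f).enorm.measurable.pow_const _
  calc _ ≤ ∫⁻ z, (C * eLpNorm (gaborDist f) p volume) ^ (2 - p.toReal) *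
        ‖gaborDist f z‖ₑ ^ p.toReal := by
        refine lintegral_mono fun z => ?_
        dsimp only
        rw [e]
        gcongr
        exact hCf f z
    _ = _ := by
        rw [lintegral_const_mul _ hm, ← eLpNorm_eq_rpow, e (eLpNorm (gaborDist f) p volume),
          ENNReal.mul_rpow_of_nonneg _ _ h2, mul_assoc]

open GaborSpace

/-- This realizes `M^{p,p}` as `GaborSpace`; the uniform constant later lets the lifespan depend on
the modulation norm alone. -/
theorem exists_coe_fn_eq (hp2 : p.toReal ≤ 2) {g : 𝓢(Rd d, ℂ)} (hg : g ≠ 0) :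
    ∃ C : ℝ≥0∞, C ≠ ∞ ∧ ∀ f : 𝓢'(Rd d, ℂ), MemModulation g p p f →
      ∃ x : GaborSpace d p, (fn x : 𝓢'(Rd d, ℂ)) = f ∧ ‖x‖ₑ ≤ C * modNorm g p p f := by
  obtain ⟨C₁, h₁, hC₁⟩ := exists_eLpNorm_gaborDist_le (p := p) hg
  obtain ⟨C₂, h₂, hC₂⟩ := exists_eLpNorm_two_gaborDist_le (d := d) hp2
  refine ⟨C₂ * C₁ + C₁, by finiteness, fun f hf => ?_⟩
  have hm := (continuous_gaborDist f).aestronglyMeasurable (μ := volume)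
  have hp : MemLp (gaborDist f) p :=
    ⟨hm, (hC₁ f).trans_lt (ENNReal.mul_lt_top h₁.lt_top hf)⟩
  obtain ⟨F, rfl⟩ := exists_coe_eq_of_memLp_two
    ⟨hm, (hC₂ f).trans_lt (ENNReal.mul_lt_top h₂.lt_top hp.2)⟩
  have h1 := hC₁ (F : 𝓢'(Rd d, ℂ))
  have h2 := hC₂ (F : 𝓢'(Rd d, ℂ))
  rw [gaborDist_coe] at hp h1 h2
  refine ⟨ofFn F hp, by rw [fn_ofFn], (enorm_le_add _).trans ?_⟩
  rw [fn_ofFn, ← (gabor_memLp_two F).2, add_mul, mul_assoc]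
  gcongr
  exact h2.trans (by gcongr)

theorem coe_injective {F H : Lp ℂ 2 (volume : Measure (Rd d))}
    (h : (F : 𝓢'(Rd d, ℂ)) = (H : 𝓢'(Rd d, ℂ))) : F = H :=
  gabor_ext fun z => by rw [← gaborDist_coe, h, gaborDist_coe]

theorem coe_sub (F H : Lp ℂ 2 (volume : Measure (Rd d))) :
    ((F - H : Lp ℂ 2 (volume : Measure (Rd d))) : 𝓢'(Rd d, ℂ)) =
      (F : 𝓢'(Rd d, ℂ)) - (H : 𝓢'(Rd d, ℂ)) := by
  ext φ
  rw [coe_apply_eq_inner, inner_sub_right, ← coe_apply_eq_inner, ← coe_apply_eq_inner]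
  rfl

theorem exists_enorm_le_modNorm (hp2 : p.toReal ≤ 2) {g : 𝓢(Rd d, ℂ)} (hg : g ≠ 0) :
    ∃ C : ℝ≥0∞, C ≠ ∞ ∧ ∀ x : GaborSpace d p,
      ‖x‖ₑ ≤ C * modNorm g p p (fn x : 𝓢'(Rd d, ℂ)) := by
  obtain ⟨C, hC, h⟩ := exists_coe_fn_eq hp2 hg
  obtain ⟨C', hC', h'⟩ := exists_modNorm_le (p := p) g
  refine ⟨C, hC, fun x => ?_⟩
  obtain ⟨y, hy, hle⟩ := h _ ((h' x).trans_lt (ENNReal.mul_lt_top hC'.lt_top (by finiteness)))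
  rwa [ext_fn (coe_injective hy)] at hle

end

/-! ### The equation in the interaction picture -/

section Interaction

variable {X : Type*} [NormedAddCommGroup X] [NormedSpace ℂ X]

/-- The vector field of the equation for `y(t) = U(-t) u(t)`, where `U` is the propagator. -/
def interaction (U : ℝ → X →L[ℂ] X) (N : X → X) (t : ℝ) (y : X) : X :=
  -Complex.I • U (-t) (N (U t y))

variable {U : ℝ → X →L[ℂ] X} {N : X → X}

theorem norm_interaction (hU : ∀ t x, ‖U t x‖ = ‖x‖) (t : ℝ) (y : X) :
    ‖interaction U N t y‖ = ‖N (U t y)‖ := by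
  rw [interaction, norm_smul, norm_neg, Complex.norm_I, one_mul, hU]

theorem norm_interaction_sub (hU : ∀ t x, ‖U t x‖ = ‖x‖) (t : ℝ) (y y' : X) :
    ‖interaction U N t y - interaction U N t y'‖ = ‖N (U t y) - N (U t y')‖ := by
  rw [interaction, interaction, ← smul_sub, ← map_sub, norm_smul, norm_neg, Complex.norm_I,
    one_mul, hU]

theorem continuousOn_interaction (hUc : ∀ (s : Set ℝ) (a : ℝ → ℝ) (u : ℝ → X), ContinuousOn a s →
    ContinuousOn u s → ContinuousOn (fun t => U (a t) (u t)) s) (hN : LipschitzOnBalls N)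
    {s : Set ℝ} {y : ℝ → X} (hy : ContinuousOn y s) :
    ContinuousOn (fun t => interaction U N t (y t)) s :=
  (hUc s _ _ continuousOn_id.neg
    (hN.continuous.comp_continuousOn (hUc s _ _ continuousOn_id hy))).const_smul _

theorem exists_lipschitzOnWith_interaction (hU : ∀ t x, ‖U t x‖ = ‖x‖) (hN : LipschitzOnBalls N)
    (R : ℝ) :
    ∃ L : NNReal, ∀ t, LipschitzOnWith L (interaction U N t) (Metric.closedBall 0 R) := by
  obtain ⟨L, hL⟩ := hN R
  refine ⟨L, fun t => LipschitzOnWith.of_dist_le_mul fun x hx y hy => ?_⟩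
  rw [mem_closedBall_zero_iff] at hx hy
  have h := hL.dist_le_mul (U t x) (by simpa [hU] using hx) (U t y) (by simpa [hU] using hy)
  rwa [dist_eq_norm, dist_eq_norm, ← norm_interaction_sub hU, ← map_sub, hU, ← dist_eq_norm,
    ← dist_eq_norm] at h

theorem exists_time_interaction [CompleteSpace X] (hU : ∀ t x, ‖U t x‖ = ‖x‖)
    (hUc : ∀ (s : Set ℝ) (a : ℝ → ℝ) (u : ℝ → X), ContinuousOn a s →
      ContinuousOn u s → ContinuousOn (fun t => U (a t) (u t)) s)
    (hN : LipschitzOnBalls N) (R : ℝ) (hR : 0 ≤ R) :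
    ∃ τ : ℝ, 0 < τ ∧ ∀ y₀ : X, ‖y₀‖ ≤ R → ∃ y : ℝ → X, y 0 = y₀ ∧
      ∀ t ∈ Icc 0 τ, HasDerivWithinAt y (interaction U N t (y t)) (Icc 0 τ) t := by
  obtain ⟨L, hL⟩ := exists_lipschitzOnWith_interaction hU hN (R + 1)
  obtain ⟨-, B, -, hB, hB', -⟩ := hN.exists_bound (R + 1) (by linarith)
  -- On the unit ball about `y₀` the field is bounded by `B`, so over this time the Picard iterates
  -- stay in the ball. The added `1` avoids division by zero.
  have hτ : 0 < 1 / (B + 1) := by positivity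
  refine ⟨1 / (B + 1), hτ, fun y₀ hy₀ => ?_⟩
  have hsub : Metric.closedBall y₀ ((1 : NNReal) : ℝ) ⊆ Metric.closedBall 0 (R + 1) :=
    Metric.closedBall_subset_closedBall' (by
      rw [NNReal.coe_one, dist_zero_right]
      linarith)
  have hpl : IsPicardLindelof (interaction U N)
      (⟨0, left_mem_Icc.2 hτ.le⟩ : Icc 0 (1 / (B + 1))) y₀ 1 0 ⟨B, hB⟩ L :=
    { lipschitzOnWith := fun t _ => (hL t).mono hsub
      continuousOn := fun y _ => continuousOn_interaction hUc hN continuousOn_const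
      norm_le := fun t _ y hy => by
        rw [norm_interaction hU]
        refine hB' _ ?_
        rw [hU]
        simpa using hsub hy
      mul_max_le := by
        change B * max (1 / (B + 1) - 0) (0 - 0) ≤ 1 - 0
        rw [sub_zero, sub_zero, sub_zero, max_eq_left hτ.le, mul_one_div,
          div_le_one (by positivity)]
        linarith }
  exact hpl.exists_eq_forall_mem_Icc_hasDerivWithinAt₀

/-- By compactness both curves stay in one ball, where a single Lipschitz constant is available and
Grönwall's inequality applies. -/
theorem eqOn_of_hasDerivWithinAt_interaction (hU : ∀ t x, ‖U t x‖ = ‖x‖) (hN : LipschitzOnBalls N)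
    {b : ℝ} {x y : ℝ → X} (hx : ContinuousOn x (Icc 0 b))
    (hx' : ∀ t ∈ Ico 0 b, HasDerivWithinAt x (interaction U N t (x t)) (Ici t) t)
    (hy : ContinuousOn y (Icc 0 b))
    (hy' : ∀ t ∈ Ico 0 b, HasDerivWithinAt y (interaction U N t (y t)) (Ici t) t)
    (h0 : x 0 = y 0) : EqOn x y (Icc 0 b) := by
  obtain ⟨R₁, hR₁⟩ := isCompact_Icc.exists_bound_of_continuousOn hx
  obtain ⟨R₂, hR₂⟩ := isCompact_Icc.exists_bound_of_continuousOn hy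
  obtain ⟨L, hL⟩ := exists_lipschitzOnWith_interaction hU hN (max R₁ R₂)
  refine ODE_solution_unique_of_mem_Icc_right (s := fun _ => Metric.closedBall 0 (max R₁ R₂))
    (fun t _ => hL t) hx hx' (fun t ht => ?_) hy hy' (fun t ht => ?_) h0
  · exact mem_closedBall_zero_iff.2 ((hR₁ t (Ico_subset_Icc_self ht)).trans (le_max_left _ _))
  · exact mem_closedBall_zero_iff.2 ((hR₂ t (Ico_subset_Icc_self ht)).trans (le_max_right _ _))

/-- A curve whose increments are given weakly by the integral of a continuous curve is
differentiable from the right. -/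
theorem hasDerivWithinAt_of_weak [CompleteSpace X] {b : ℝ} {ι : Type*} {Λ : ι → X →L[ℂ] ℂ}
    (hΛ : ∀ x y, (∀ i, Λ i x = Λ i y) → x = y) {y w : ℝ → X} (hw : ContinuousOn w (Icc 0 b))
    (hy : ContinuousOn y (Icc 0 b))
    (h : ∀ i, ∀ t ∈ Ico 0 b, HasDerivWithinAt (fun s => Λ i (y s)) (Λ i (w t)) (Ici t) t) :
    ∀ t ∈ Ico 0 b, HasDerivWithinAt y (w t) (Ici t) t := by
  intro t ht
  have hb : 0 ≤ b := ht.1.trans ht.2.le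
  -- Extending `w` continuously beyond the interval makes its primitive differentiable at the
  -- endpoints too.
  set W := IccExtend hb ((Icc 0 b).domRestrict w) with hW
  have hWc : Continuous W := (continuousOn_iff_continuous_domRestrict.1 hw).Icc_extend'
  have hWw : ∀ s ∈ Icc 0 b, W s = w s := fun s hs => by
    rw [hW, IccExtend_of_mem hb _ hs, domRestrict_apply]
  have hint : ∀ s ∈ Icc 0 b, y s = y 0 + ∫ r in (0 : ℝ)..s, W r := by
    intro s hs
    refine hΛ _ _ fun i => ?_
    have h1 : ∫ r in (0 : ℝ)..s, Λ i (W r) = Λ i (y s) - Λ i (y 0) := by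
      refine intervalIntegral.integral_eq_sub_of_hasDeriv_right_of_le
        (f := fun s => Λ i (y s)) hs.1
        ((Λ i).continuous.comp_continuousOn (hy.mono (Icc_subset_Icc_right hs.2)))
        (fun r hr => ?_) (((Λ i).continuous.comp hWc).intervalIntegrable _ _)
      rw [hWw r ⟨hr.1.le, hr.2.le.trans hs.2⟩]
      exact (h i r ⟨hr.1.le, hr.2.trans_le hs.2⟩).mono Ioi_subset_Ici_self
    rw [map_add, ← (Λ i).intervalIntegral_comp_comm (hWc.intervalIntegrable _ _), h1]
    ring
  have h2 : HasDerivWithinAt (fun s => y 0 + ∫ r in (0 : ℝ)..s, W r) (w t) (Ici t) t := by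
    rw [← hWw t (Ico_subset_Icc_self ht)]
    exact ((intervalIntegral.integral_hasDerivAt_right (hWc.intervalIntegrable _ _)
      (hWc.stronglyMeasurableAtFilter _ _) hWc.continuousAt).const_add _).hasDerivWithinAt
  refine h2.congr_of_eventuallyEq ?_ (hint t (Ico_subset_Icc_self ht))
  filter_upwards [Ico_mem_nhdsGE ht.2] with s hs
  exact hint s ⟨ht.1.trans hs.1, hs.2.le⟩

end Interaction

/-! ### Strong solutions are distributional solutions, and conversely -/

/-- The propagator is shifted to the test function, where it is differentiable because the function
is Schwartz; the rest is the product rule for the inner product. -/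
theorem hasDerivWithinAt_coe_prop_apply {F : ℝ → Lp ℂ 2 (volume : Measure (Rd d))}
    {F' : Lp ℂ 2 (volume : Measure (Rd d))} {t : ℝ} {s : Set ℝ} (hF : HasDerivWithinAt F F' s t)
    (φ : 𝓢(Rd d, ℂ)) :
    HasDerivWithinAt (fun τ => (prop τ (F τ) : 𝓢'(Rd d, ℂ)) φ)
      (-Complex.I * oscillator (prop t (F t) : 𝓢'(Rd d, ℂ)) φ +
        (prop t F' : 𝓢'(Rd d, ℂ)) φ) s t := by
  set Φ := (conjS φ).toLp 2 volume with hΦ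
  have h1 : HasDerivWithinAt (fun τ => prop (-τ) Φ)
      (-prop (-t) (-Complex.I • (hermite (conjS φ)).toLp 2 volume)) s t := by
    have h := (hasDerivAt_prop (conjS φ) (-t)).scomp t (hasDerivAt_neg t)
    rw [neg_one_smul] at h
    exact h.hasDerivWithinAt
  have h3 := h1.inner ℂ hF
  have e : ∀ τ H, (prop τ H : 𝓢'(Rd d, ℂ)) φ = inner ℂ (prop (-τ) Φ) H := by
    intro τ H
    rw [coe_apply_eq_inner, inner_prop_left, neg_neg]
  simp only [e]
  refine h3.congr_deriv ?_
  rw [oscillator_eq_hermite, coe_apply_eq_inner, hermite_conjS, inner_neg_left,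
    inner_prop_left _ (_ • _), neg_neg, inner_smul_left]
  simp only [map_neg, Complex.conj_I]
  ring

/-- The action of the oscillator on a propagated Schwartz function that stays a Schwartz
function. -/
theorem toLp_hermite_of_prop_eq {φ ψ : 𝓢(Rd d, ℂ)} {t : ℝ}
    (h : prop t (φ.toLp 2 volume) = ψ.toLp 2 volume) :
    (hermite ψ).toLp 2 volume = prop t ((hermite φ).toLp 2 volume) := by
  -- The curve `s ↦ prop s ψ = prop (s + t) φ` is differentiated at `0` in two ways.
  have h1 := hasDerivAt_prop ψ 0
  have h2 : HasDerivAt (fun s => prop (s + t) (φ.toLp 2 volume))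
      (prop (0 + t) (-Complex.I • (hermite φ).toLp 2 volume)) 0 :=
    (hasDerivAt_prop φ (0 + t)).comp_add_const 0 t
  simp only [prop_add, h] at h2
  have h3 := h1.unique h2
  rw [map_smul, map_smul, map_smul, prop_zero, prop_zero] at h3
  exact smul_right_injective _ (neg_ne_zero.2 Complex.I_ne_zero) h3

/-- A product rule in which `G` need not be differentiable: continuity suffices for the term with
`A'`, and for the other one only the pairing with the fixed vector `A t` is differentiated. -/
theorem hasDerivWithinAt_inner_of_tendsto {E : Type*} [NormedAddCommGroup E]
    [InnerProductSpace ℂ E] {A G : ℝ → E} {A' : E} {G' : ℂ} {t : ℝ} {s : Set ℝ}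
    (hA : HasDerivWithinAt A A' s t) (hG : Tendsto G (𝓝[s] t) (𝓝 (G t)))
    (hG' : HasDerivWithinAt (fun τ => inner ℂ (A t) (G τ)) G' s t) :
    HasDerivWithinAt (fun τ => inner ℂ (A τ) (G τ)) (inner ℂ A' (G t) + G') s t := by
  have h : HasDerivWithinAt (fun τ => inner ℂ (A τ - A t) (G τ)) (inner ℂ A' (G t)) s t := by
    rw [hasDerivWithinAt_iff_tendsto_slope] at hA ⊢
    refine ((hA.inner (hG.mono_left (nhdsWithin_mono _ sdiff_subset)))).congr fun τ => ?_
    rw [slope_def_module, slope_def_module, sub_self, inner_zero_left, sub_zero,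
      inner_smul_left_eq_smul]
  refine (h.add hG').congr_of_eventuallyEq (.of_forall fun τ => ?_) ?_
  · simp
  · simp

/-- At time `t` the propagated coherent state is again a multiple of a coherent state, hence an
admissible test function for the equation. The two oscillator terms cancel and only the nonlinearity
remains. -/
theorem hasDerivWithinAt_inner_coherent {x : ℝ → Lp ℂ 2 (volume : Measure (Rd d))}
    {n : Lp ℂ 2 (volume : Measure (Rd d))} {t : ℝ} {s : Set ℝ} (hx : Tendsto x (𝓝[s] t) (𝓝 (x t)))
    (h : ∀ φ : 𝓢(Rd d, ℂ), HasDerivWithinAt (fun τ => (x τ : 𝓢'(Rd d, ℂ)) φ)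
      (-Complex.I * (oscillator (x t : 𝓢'(Rd d, ℂ)) φ + (n : 𝓢'(Rd d, ℂ)) φ)) s t)
    (z : Rd d × Rd d) :
    HasDerivWithinAt (fun τ => inner ℂ ((coherent z).toLp 2 volume) (prop (-τ) (x τ)))
      (inner ℂ ((coherent z).toLp 2 volume) (-Complex.I • prop (-t) n)) s t := by
  set ψ : 𝓢(Rd d, ℂ) := Complex.exp (-(Complex.I * ((d * t : ℝ) : ℂ))) • coherent (rot t z) with hψ
  have hprop : prop t ((coherent z).toLp 2 volume) = ψ.toLp 2 volume := by
    rw [prop_coherent]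
    exact (map_smul (SchwartzMap.toLpCLM ℂ (E := Rd d) ℂ 2 volume) _ _).symm
  have h1 : HasDerivWithinAt (fun τ => inner ℂ (prop t ((coherent z).toLp 2 volume)) (x τ))
      (-Complex.I * (inner ℂ (prop t ((hermite (coherent z)).toLp 2 volume)) (x t) +
        inner ℂ (prop t ((coherent z).toLp 2 volume)) n)) s t := by
    have h2 := h (conjS ψ)
    simp only [oscillator_eq_hermite, hermite_conjS, coe_apply_eq_inner, conjS_conjS,
      toLp_hermite_of_prop_eq hprop] at h2
    rwa [← hprop] at h2
  have h3 := hasDerivWithinAt_inner_of_tendsto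
    (hasDerivAt_prop (coherent z) t).hasDerivWithinAt hx h1
  simp only [inner_prop_left _ ((coherent z).toLp 2 volume)] at h3
  refine h3.congr_deriv ?_
  rw [map_smul, inner_smul_left, inner_smul_right]
  simp only [map_neg, Complex.conj_I]
  ring

/-! ### Existence and uniqueness -/

theorem hasDerivWithinAt_clm_apply {X Y : Type*} [NormedAddCommGroup X]
    [NormedSpace ℂ X] [NormedAddCommGroup Y] [NormedSpace ℂ Y] {y : ℝ → X} {y' : X} {s : Set ℝ}
    {t : ℝ} (h : HasDerivWithinAt y y' s t) (L : X →L[ℂ] Y) :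
    HasDerivWithinAt (fun τ => L (y τ)) (L y') s t :=
  (L.restrictScalars ℝ).hasFDerivAt.comp_hasDerivWithinAt t h

section WellPosed

open GaborSpace

variable {p : ℝ≥0∞} [Fact (1 ≤ p)]

/-- The Gabor transform at `z`, up to a constant, as a functional on the Gabor space. -/
def gaborFunctional (p : ℝ≥0∞) [Fact (1 ≤ p)] (z : Rd d × Rd d) : GaborSpace d p →L[ℂ] ℂ :=
  (innerSL ℂ ((coherent z).toLp 2 volume)).comp fn

theorem gaborFunctional_apply (z : Rd d × Rd d) (x : GaborSpace d p) :
    gaborFunctional p z x = inner ℂ ((coherent z).toLp 2 volume) (fn x) := rfl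

theorem ext_gaborFunctional (x y : GaborSpace d p)
    (h : ∀ z, gaborFunctional p z x = gaborFunctional p z y) : x = y := by
  refine ext_fn (gabor_ext fun z => ?_)
  rw [gabor_eq_inner, gabor_eq_inner, ← gaborFunctional_apply, h, gaborFunctional_apply]

theorem fn_interaction (N : GaborSpace d p → GaborSpace d p) (t : ℝ) (y : GaborSpace d p) :
    fn (interaction flow N t y) = -Complex.I • prop (-t) (fn (N (flow t y))) := by
  rw [interaction, map_smul, fn_flow]

theorem modNorm_fn_tendsto [Fact (p ≠ ∞)] (g : 𝓢(Rd d, ℂ)) {x : ℝ → GaborSpace d p} {s : Set ℝ}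
    (hx : ContinuousOn x s) {t : ℝ} (ht : t ∈ s) :
    Tendsto (fun τ => modNorm g p p ((fn (x τ) : 𝓢'(Rd d, ℂ)) - (fn (x t) : 𝓢'(Rd d, ℂ))))
      (𝓝[s] t) (𝓝 0) := by
  obtain ⟨C, hC, h⟩ := exists_modNorm_le (p := p) g
  have h1 : Tendsto (fun τ => ‖x τ - x t‖ₑ) (𝓝[s] t) (𝓝 0) := by
    have h2 := tendsto_iff_edist_tendsto_0.1 (hx t ht)
    simpa only [edist_eq_enorm_sub] using h2
  have h3 : Tendsto (fun τ => C * ‖x τ - x t‖ₑ) (𝓝[s] t) (𝓝 0) := by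
    simpa using ENNReal.Tendsto.const_mul h1 (Or.inr hC)
  refine tendsto_of_tendsto_of_tendsto_of_le_of_le tendsto_const_nhds h3 (fun _ => zero_le) ?_
  intro τ
  dsimp only
  rw [← coe_sub, ← map_sub]
  exact h _

theorem continuousOn_of_modNorm_tendsto [Fact (p ≠ ∞)] (hp2 : p.toReal ≤ 2) {g : 𝓢(Rd d, ℂ)}
    (hg : g ≠ 0) {x : ℝ → GaborSpace d p} {s : Set ℝ}
    (h : ∀ t ∈ s, Tendsto (fun τ => modNorm g p p ((fn (x τ) : 𝓢'(Rd d, ℂ)) -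
      (fn (x t) : 𝓢'(Rd d, ℂ)))) (𝓝[s] t) (𝓝 0)) : ContinuousOn x s := by
  obtain ⟨C, hC, hb⟩ := exists_enorm_le_modNorm hp2 hg
  intro t ht
  rw [ContinuousWithinAt, tendsto_iff_edist_tendsto_0]
  have h3 := ENNReal.Tendsto.const_mul (h t ht) (Or.inr hC)
  rw [mul_zero] at h3
  refine tendsto_of_tendsto_of_tendsto_of_le_of_le tendsto_const_nhds h3 (fun _ => zero_le) ?_
  intro τ
  dsimp only
  rw [edist_eq_enorm_sub, ← coe_sub, ← map_sub]
  exact hb _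

variable {K : 𝓢'(Rd d, ℂ)} {k : ℕ} {N : GaborSpace d p → GaborSpace d p}

theorem continuousOn_flow (hp : p ≠ ∞) (s : Set ℝ) (a : ℝ → ℝ) (u : ℝ → GaborSpace d p)
    (ha : ContinuousOn a s) (hu : ContinuousOn u s) : ContinuousOn (fun t => flow (a t) (u t)) s :=
  continuousOn_flow_apply hp ha hu

-- Undoing the interaction picture: applying `U(t)` to `-i U(-t) N` leaves `-i N`, while the
-- derivative of `U(t)` supplies the oscillator term.
set_option maxHeartbeats 1000000 in
theorem isSolution_of_interaction [hp : Fact (p ≠ ∞)] (g : 𝓢(Rd d, ℂ))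
    (hN : ∀ x, IsHartree K k (fn x : 𝓢'(Rd d, ℂ)) (fn (N x) : 𝓢'(Rd d, ℂ)))
    {τ : ℝ} {y : ℝ → GaborSpace d p}
    (hy : ∀ t ∈ Icc 0 τ, HasDerivWithinAt y (interaction flow N t (y t)) (Icc 0 τ) t) :
    IsSolution g p K k (fn (y 0) : 𝓢'(Rd d, ℂ)) τ
      fun t => (fn (flow t (y t)) : 𝓢'(Rd d, ℂ)) where
  continuous := by
    have hc : ContinuousOn (fun t => flow t (y t)) (Ico 0 τ) :=
      continuousOn_flow_apply hp.out continuousOn_id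
        fun t ht => ((hy t (Ico_subset_Icc_self ht)).mono Ico_subset_Icc_self).continuousWithinAt
    obtain ⟨C, hC, hb⟩ := exists_modNorm_le (p := p) g
    exact fun t ht => ⟨(hb _).trans_lt (ENNReal.mul_lt_top hC.lt_top enorm_lt_top),
      modNorm_fn_tendsto g hc ht⟩
  initial := by rw [flow_zero]
  equation t ht := by
    refine ⟨_, hN _, fun φ => ?_⟩
    have h1 := hasDerivWithinAt_clm_apply
      ((hy t (Ico_subset_Icc_self ht)).mono Ico_subset_Icc_self) fn
    have h2 := hasDerivWithinAt_coe_prop_apply h1 φ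
    rw [fn_interaction, map_smul, ← prop_add, add_neg_cancel, prop_zero] at h2
    refine h2.congr_deriv ?_
    rw [fn_flow, coe_apply_eq_inner (-Complex.I • _), inner_smul_right, ← coe_apply_eq_inner]
    ring

-- Every distributional solution solves the Banach space equation. Norm equivalence lifts it to a
-- continuous curve in the Gabor space; pairing with coherent states gives the weak derivative,
-- which `hasDerivWithinAt_of_weak` makes strong on closed subintervals.
set_option maxHeartbeats 1000000 in
theorem exists_interaction_of_isSolution [hp : Fact (p ≠ ∞)] (hp2 : p.toReal ≤ 2)
    {g : 𝓢(Rd d, ℂ)} (hg : g ≠ 0) (hNl : LipschitzOnBalls N)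
    (hN : ∀ x M, IsHartree K k (fn x : 𝓢'(Rd d, ℂ)) M → M = (fn (N x) : 𝓢'(Rd d, ℂ)))
    {u₀ : 𝓢'(Rd d, ℂ)} {T : ℝ} {u : ℝ → 𝓢'(Rd d, ℂ)} (hu : IsSolution g p K k u₀ T u) :
    ∃ y : ℝ → GaborSpace d p, (∀ t ∈ Ico 0 T, u t = (fn (flow t (y t)) : 𝓢'(Rd d, ℂ))) ∧
      ContinuousOn y (Ico 0 T) ∧ ∀ b < T, ∀ t ∈ Ico 0 b,
        HasDerivWithinAt y (interaction flow N t (y t)) (Ici t) t := by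
  obtain ⟨C, hC, h⟩ := exists_coe_fn_eq hp2 hg
  have hx : ∀ t, ∃ x : GaborSpace d p, t ∈ Ico 0 T → (fn x : 𝓢'(Rd d, ℂ)) = u t := by
    intro t
    -- Outside `[0, T)` the value plays no role, and `0` is chosen.
    by_cases ht : t ∈ Ico 0 T
    · obtain ⟨x, hx, -⟩ := h (u t) (hu.continuous t ht).1
      exact ⟨x, fun _ => hx⟩
    · exact ⟨0, fun h => absurd h ht⟩
  choose x hx using hx
  have hxc : ContinuousOn x (Ico 0 T) := by
    refine continuousOn_of_modNorm_tendsto hp2 hg fun t ht => ?_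
    refine (hu.continuous t ht).2.congr' ?_
    filter_upwards [self_mem_nhdsWithin] with s hs
    rw [hx s hs, hx t ht]
  have hyc : ContinuousOn (fun t => flow (-t) (x t)) (Ico 0 T) :=
    continuousOn_flow_apply hp.out continuousOn_id.neg hxc
  refine ⟨fun t => flow (-t) (x t), fun t ht => by rw [flow_flow_neg, hx t ht], hyc,
    fun b hb => ?_⟩
  have hsub : Icc 0 b ⊆ Ico 0 T := fun t ht => ⟨ht.1, ht.2.trans_lt hb⟩
  have hwc : ContinuousOn (fun t => interaction flow N t (flow (-t) (x t))) (Ico 0 T) :=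
    continuousOn_interaction (continuousOn_flow hp.out) hNl hyc
  refine hasDerivWithinAt_of_weak (Λ := gaborFunctional p) ext_gaborFunctional (hwc.mono hsub)
    (hyc.mono hsub) fun z t ht => ?_
  have htT : t ∈ Ico 0 T := hsub (Ico_subset_Icc_self ht)
  have hfx : Tendsto (fun τ => fn (x τ)) (𝓝[Ico 0 T] t) (𝓝 (fn (x t))) :=
    ((fn (d := d) (p := p)).continuous.tendsto _).comp (hxc t htT)
  obtain ⟨M, hM, heq⟩ := hu.equation t htT
  rw [← hx t htT] at hM heq
  obtain rfl := hN _ _ hM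
  have h1 := hasDerivWithinAt_inner_coherent hfx (fun φ => (heq φ).congr
    (fun s hs => by rw [hx s hs]) (by rw [hx t htT])) z
  have h2 := h1.mono_of_mem_nhdsWithin (s := Ici t)
    (mem_of_superset (Ico_mem_nhdsGE htT.2) (Ico_subset_Ico_left htT.1))
  rw [gaborFunctional_apply, fn_interaction, flow_flow_neg]
  exact h2

set_option maxHeartbeats 1000000 in
theorem uniquelySolvable [hp : Fact (p ≠ ∞)] (hp2 : p.toReal ≤ 2) {g : 𝓢(Rd d, ℂ)} (hg : g ≠ 0)
    (hNl : LipschitzOnBalls N)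
    (hN : ∀ x, IsHartree K k (fn x : 𝓢'(Rd d, ℂ)) (fn (N x) : 𝓢'(Rd d, ℂ)))
    (hN' : ∀ x M, IsHartree K k (fn x : 𝓢'(Rd d, ℂ)) M → M = (fn (N x) : 𝓢'(Rd d, ℂ))) :
    UniquelySolvable g p K k := by
  obtain ⟨C, hC, h⟩ := exists_coe_fn_eq hp2 hg
  -- The lifespan for modulation norm `a` is the Picard time for the ball of radius `C |a|` in the
  -- Gabor space. The absolute value keeps the radius nonnegative for every real `a`.
  choose T hT hsol using fun a : ℝ =>
    exists_time_interaction norm_flow (continuousOn_flow hp.out) hNl (C.toReal * |a|)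
      (by positivity)
  refine ⟨T, hT, fun u₀ hu₀ => ⟨?_, fun u v hu hv t ht => ?_⟩⟩
  · obtain ⟨x₀, rfl, hle⟩ := h u₀ hu₀
    obtain ⟨y, rfl, hy⟩ := hsol (modNorm g p p (fn x₀ : 𝓢'(Rd d, ℂ))).toReal x₀ (by
      have h1 := ENNReal.toReal_mono (ENNReal.mul_ne_top hC hu₀.ne) hle
      rwa [ENNReal.toReal_mul, toReal_enorm, ← abs_of_nonneg (ENNReal.toReal_nonneg
        (a := modNorm g p p (fn x₀ : 𝓢'(Rd d, ℂ))))] at h1)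
    exact ⟨_, isSolution_of_interaction g hN hy⟩
  · obtain ⟨x, hx, hxc, hxd⟩ := exists_interaction_of_isSolution hp2 hg hNl hN' hu
    obtain ⟨y, hy, hyc, hyd⟩ := exists_interaction_of_isSolution hp2 hg hNl hN' hv
    have h0T := hT (modNorm g p p u₀).toReal
    have hsub : Icc 0 t ⊆ Ico 0 (T (modNorm g p p u₀).toReal) :=
      fun s hs => ⟨hs.1, hs.2.trans_lt ht.2⟩
    have h0 : x 0 = y 0 := by
      have h1 := (hx 0 (left_mem_Ico.2 h0T)).symm.trans
        ((hu.initial.trans hv.initial.symm).trans (hy 0 (left_mem_Ico.2 h0T)))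
      rw [flow_zero, flow_zero] at h1
      exact ext_fn (coe_injective h1)
    rw [hx t ht, hy t ht, eqOn_of_hasDerivWithinAt_interaction norm_flow hNl (hxc.mono hsub)
      (hxd t ht.2) (hyc.mono hsub) (hyd t ht.2) h0 (right_mem_Icc.2 ht.1)]

theorem uniquelySolvable_of_isAdmissible [Fact (p ≠ ∞)] (hp2 : p.toReal ≤ 2) {g : 𝓢(Rd d, ℂ)}
    (hg : g ≠ 0) {κ : Rd d → ℂ} (hK : IsRepresentedBy (𝓕 K) κ) (hκ : IsAdmissible p κ)
    {P : GaborSpace d p → GaborSpace d p} (hP : LipschitzOnBalls P)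
    (hPk : ∀ x, fn (P x) =ᵐ[volume] fun t => fn x t ^ k) : UniquelySolvable g p K k :=
  uniquelySolvable hp2 hg (lipschitzOnBalls_hartree hκ hP) (fun x => isHartree (hPk x) hκ hK)
    fun x _ hM => eq_of_isHartree (hPk x) hκ hK hM

end WellPosed

end HarmonicNLS

end

/-! ### The three classes of convolution kernels -/

open HarmonicNLS in
theorem theorem1p4 (d : ℕ) (hd : 1 ≤ d) (k : ℕ) (hk : 1 ≤ k)
    (g : 𝓢(Rd d, ℂ)) (hg : g ≠ 0) (K : 𝓢'(Rd d, ℂ)) :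
    (∀ q : ℝ, 1 < q → MemFourierLebesgue (ENNReal.ofReal q) K →
      UniquelySolvable g 1 K k) ∧
    (∀ q r : ℝ, 1 < q → q < 2 → q < r → MemFourierLebesgue (ENNReal.ofReal q) K →
      UniquelySolvable g (ENNReal.ofReal (2 * r / (2 * r - 1))) K 1) ∧
    (MemModulation g 1 ∞ K → UniquelySolvable g 1 K k) := by
  -- `GaborSpace.power k` is the power `k + 1`, hence the shift of the exponent.
  obtain ⟨k, rfl⟩ := Nat.exists_eq_add_of_le' hk
  refine ⟨fun q hq ⟨κ, hκ, hK⟩ => ?_, fun q r hq _ hqr ⟨κ, hκ, hK⟩ => ?_, fun hK => ?_⟩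
  · refine uniquelySolvable_of_isAdmissible (by simp) hg hK (isAdmissible_of_memLp hq hκ ?_)
      (GaborSpace.lipschitzOnBalls_power k) (GaborSpace.coeFn_power k)
    rw [ENNReal.toReal_one, one_le_div (by linarith)]
    linarith
  · have hr : 0 < 2 * r - 1 := by linarith
    have hq' : 0 < 2 * q - 1 := by linarith
    have h1 : 1 ≤ 2 * r / (2 * r - 1) := by
      rw [one_le_div hr]
      linarith
    -- The function `r ↦ 2r/(2r-1)` decreases, so `q < r` places the exponent below the Young
    -- exponent of `q`.
    have h2 : 2 * r / (2 * r - 1) ≤ 2 * q / (2 * q - 1) := by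
      rw [div_le_div_iff₀ hr hq']
      nlinarith
    have h3 : 2 * r / (2 * r - 1) ≤ 2 := by
      rw [div_le_iff₀ hr]
      linarith
    have : Fact (1 ≤ ENNReal.ofReal (2 * r / (2 * r - 1))) := ⟨ENNReal.one_le_ofReal.2 h1⟩
    have : Fact (ENNReal.ofReal (2 * r / (2 * r - 1)) ≠ ∞) := ⟨ENNReal.ofReal_ne_top⟩
    have e : (ENNReal.ofReal (2 * r / (2 * r - 1))).toReal = 2 * r / (2 * r - 1) :=
      ENNReal.toReal_ofReal (zero_le_one.trans h1)
    -- For `k = 1` the power map is the identity, so no algebra property of `M^{s,s}` is needed.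
    exact uniquelySolvable_of_isAdmissible (e.trans_le h3) hg hK
      (isAdmissible_of_memLp hq hκ (e.trans_le h2)) lipschitzOnBalls_id
      fun x => .of_forall fun t => (pow_one _).symm
  · obtain ⟨κ, M, hκ, hM, hK'⟩ := exists_bounded_fourier_of_memModulation hg hK
    exact uniquelySolvable_of_isAdmissible (by simp) hg hK' (isAdmissible_of_bounded hκ hM)
      (GaborSpace.lipschitzOnBalls_power k) (GaborSpace.coeFn_power k)
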